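/- Let $W$ be the ground model and let $\kappa$ be an uncountable regular cardinal with $2^{<\kappa}=\kappa$ and $2^{\kappa}=\kappa^+$ (in $W$). In a forcing notion, $p\le q$ means that $p$ is stronger than $q$. For a set $C$ of ordinals, $\mathrm{acc}(C)$ is the set of ordinals $\beta>0$ with $\sup(C\cap\beta)=\beta$. - $\mathbb{S}$ is the forcing whose conditions are the sequences $\langle C_\alpha : \alpha\le\gamma\rangle$, $\gamma<\kappa$, such that each $C_\alpha\subseteq\alpha$ is closed and unbounded in $\alpha$, $C_{\alpha+1}=\{\alpha\}$, and $C_\alpha\cap\beta=C_\beta$ whenever $\beta\in\mathrm{acc}(C_\alpha)$; the order is end-extension. - $\mathbb{T}\in W^{\mathbb{S}}$ is the threading forcing: its conditions are the members $C_\alpha$, $\alpha<\kappa$ a limit ordinal or $0$, of the generic sequence added by $\mathbb{S}$, ordered by end-extension. - $\mathbb{R}=\mathbb{R}_{\kappa^+}$ is the iteration, after $\mathbb{S}$, of length $\kappa^+$ with supports of size less than $\kappa$, of forcings $\dot{\mathbb{Q}}_\alpha$ ($\alpha<\kappa^+$) defined as follows. Fix a surjection $f:\kappa^+\to\kappa^+\times\kappa^+\times\kappa^+$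 such that, for $\alpha>0$, the first coordinate of $f(\alpha)$ is less than $\alpha$, and, for each $\beta<\kappa^+$, an enumeration in length $\kappa^+$ of the $\mathbb{S}*\mathbb{R}_\beta$-names for subsets of $\kappa$ (up to forced equality). If $\alpha>0$ and $f(\alpha)=(\beta,\gamma,\delta)$, let $\dot A$ be the $\gamma$-th $\mathbb{S}*\mathbb{R}_\beta$-name. If every condition of $\mathbb{S}*\mathbb{R}_\alpha*\mathbb{T}$ forces that $\dot A$ is a non-stationary subset of $\kappa$, let $\dot A_\alpha=\dot A$; otherwise let $\dot A_\alpha=\emptyset$; also let $\dot A_0=\emptyset$. Then $\dot{\mathbb{Q}}_\alpha$ is the $\mathbb{S}*\mathbb{R}_\alpha$-name for the forcing that shoots a club disjoint from $\dot A_\alpha$: its conditions are the closed bounded subsets of $\kappa\setminus\dot A_\alpha$, ordered by end-extension. Then, for every choice of $f$ and of the enumerations, $$W^{\mathbb{S}*\mathbb{R}}\models\ \mathbb{T}\text{ generically preserves stationary subsets of }\kappa,$$ that is, in $W^{\mathbb{S}*\mathbb{R}}$, for every stationary set $A\subseteq\kappa$ there is a condition $t\in\mathbb{T}$ such that $t\Vdash_{\mathbb{T}}$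 "$\check A$ is stationary". -/

import Mathlib

open Cardinal Set

universe u

noncomputable section

/-! ### Forcing notions, names and the forcing relation

The universe of types plays the role of the ground model `W`. -/

/-- A forcing notion whose conditions form the set `cond` of elements of `X`;
`le p q` says that `p` is stronger than `q`. -/
structure ForcingNotion (X : Type u) where
  cond : Set X
  le : X → X → Prop
  le_refl : ∀ p ∈ cond, le p p
  le_trans : ∀ p ∈ cond, ∀ q ∈ cond, ∀ r ∈ cond, le p q → le q r → le p r

/-- (Canonical) names for subsets of the ground-model set `K`: sets of pairs `(p, x)` with `p` a
condition and `x ∈ K`, standing for the usual name `{(p, x̌)}`.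
See `ForcingNotion.IsName` for the requirement that the first components are conditions. -/
abbrev SetName (X K : Type u) : Type u := Set (X × K)

namespace ForcingNotion

variable {X K : Type u} (F : ForcingNotion X)

/-- `A` is an `F`-name. -/
def IsName (A : SetName X K) : Prop := ∀ z ∈ A, z.1 ∈ F.cond

/-! A statement of the forcing language is given by the set of those `p` that force it.
The following are the usual clauses of the (strong) definition of forcing. -/

/-- `p ⊩ x̌ ∈ A`: the conditions below some `a` with `(a, x) ∈ A` are dense below `p`. -/
def mem (A : SetName X K) (x : K) (p : X) : Prop :=
  ∀ q ∈ F.cond, F.le q p → ∃ r ∈ F.cond, F.le r q ∧ ∃ a ∈ F.cond, (a, x) ∈ A ∧ F.le r a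

/-- `p ⊩ ¬ φ`. -/
def neg (φ : X → Prop) (p : X) : Prop := ∀ q ∈ F.cond, F.le q p → ¬ φ q

/-- `p ⊩ φ → ψ`. -/
def imp (φ ψ : X → Prop) (p : X) : Prop := ∀ q ∈ F.cond, F.le q p → φ q → ψ q

/-- `p ⊩ ∃ i, φ i`. -/
def ex {ι : Type u} (φ : ι → X → Prop) (p : X) : Prop :=
  ∀ q ∈ F.cond, F.le q p → ∃ r ∈ F.cond, F.le r q ∧ ∃ i, φ i r

/-- `1 ⊩ φ`, that is `W^F ⊨ φ`: every condition forces `φ`. -/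
def Valid (φ : X → Prop) : Prop := ∀ p ∈ F.cond, φ p

/-- `p ⊩ A = B`. -/
def eqName (A B : SetName X K) (p : X) : Prop :=
  ∀ x, F.imp (F.mem A x) (F.mem B x) p ∧ F.imp (F.mem B x) (F.mem A x) p

variable [LinearOrder K]

/-- `p ⊩` "`a` is a nonzero limit of elements of `A` below `a`". -/
def accName (A : SetName X K) (a : K) (p : X) : Prop :=
  ¬ IsMin a ∧ ∀ b < a, F.ex (fun (x : {x : K // b < x ∧ x < a}) => F.mem A x.1) p

/-- `p ⊩` "`A` is closed in `K`". -/
def closedName (A : SetName X K) (p : X) : Prop :=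
  ∀ a : K, F.imp (F.accName A a) (F.mem A a) p

/-- `p ⊩` "`A` is a club in `K`". -/
def clubName (A : SetName X K) (p : X) : Prop :=
  F.closedName A p ∧ ∀ b : K, F.ex (fun (x : {x : K // b < x}) => F.mem A x.1) p

/-- `p ⊩` "`A` is stationary in `K`": it meets every club of the extension. -/
def stationaryName (A : SetName X K) (p : X) : Prop :=
  ∀ C : SetName X K,
    F.imp (F.clubName C) (F.ex fun x : K => fun q => F.mem A x q ∧ F.mem C x q) p

/-- `p ⊩` "`c` end-extends `d`". -/
def endExtName (c d : SetName X K) (p : X) : Prop :=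
  (∀ x, F.imp (F.mem d x) (F.mem c x) p) ∧
    ∀ x y, x ≤ y → F.imp (fun q => F.mem c x q ∧ F.mem d y q) (F.mem d x) p

variable {F}

theorem imp_mono {φ ψ : X → Prop} {p q : X} (hp : p ∈ F.cond) (hq : q ∈ F.cond)
    (h : F.le q p) (hi : F.imp φ ψ p) : F.imp φ ψ q :=
  fun r hr hrq => hi r hr (F.le_trans r hr q hq p hp hrq h)

theorem endExtName_mono {c d : SetName X K} {p q : X} (hp : p ∈ F.cond) (hq : q ∈ F.cond)
    (h : F.le q p) (hi : F.endExtName c d p) : F.endExtName c d q :=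
  ⟨fun x => imp_mono hp hq h (hi.1 x), fun x y hxy => imp_mono hp hq h (hi.2 x y hxy)⟩

theorem endExtName_refl (c : SetName X K) (p : X) : F.endExtName c c p :=
  ⟨fun _ _ _ _ h => h, fun _ _ _ _ _ _ h => h.1⟩

theorem endExtName_trans {c d e : SetName X K} {p : X} (h₁ : F.endExtName c d p)
    (h₂ : F.endExtName d e p) : F.endExtName c e p :=
  ⟨fun x q hq hqp h => h₁.1 x q hq hqp (h₂.1 x q hq hqp h),
    fun x y hxy q hq hqp h => h₂.2 x y hxy q hq hqp
      ⟨h₁.2 x y hxy q hq hqp ⟨h.1, h₂.1 y q hq hqp h.2⟩, h.2⟩⟩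

end ForcingNotion

/-! ### Forcing notions in the extension, and two-step iterations -/

/-- A name for a forcing notion of `W^F` whose conditions are subsets of `K`:
`mem c p` says `p ⊩ c ∈ Q`, and `le c d p` says `p ⊩ c ≤ d`. -/
structure NamedForcing {X : Type u} (F : ForcingNotion X) (K : Type u) where
  mem : SetName X K → X → Prop
  le : SetName X K → SetName X K → X → Prop
  le_refl : ∀ c p, le c c p
  le_trans : ∀ c d e p, le c d p → le d e p → le c e p
  le_mono : ∀ c d, ∀ p ∈ F.cond, ∀ q ∈ F.cond, F.le q p → le c d p → le c d q

/-- The two-step iteration `F * Q`: pairs `(p, c)` with `p ⊩ c ∈ Q`. -/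
def twoStep {X K : Type u} (F : ForcingNotion X) (Q : NamedForcing F K) :
    ForcingNotion (X × SetName X K) where
  cond := {z | z.1 ∈ F.cond ∧ F.IsName z.2 ∧ Q.mem z.2 z.1}
  le z w := F.le z.1 w.1 ∧ Q.le z.2 w.2 z.1
  le_refl _ hz := ⟨F.le_refl _ hz.1, Q.le_refl _ _⟩
  le_trans _ hz _ hw _ hv h₁ h₂ :=
    ⟨F.le_trans _ hz.1 _ hw.1 _ hv.1 h₁.1 h₂.1,
      Q.le_trans _ _ _ _ h₁.2 (Q.le_mono _ _ _ hw.1 _ hz.1 h₁.1 h₂.2)⟩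

/-- An `F`-name regarded as an `F * Q`-name. -/
def twoStepName {X K : Type u} (A : SetName X K) : SetName (X × SetName X K) K :=
  {z | (z.1.1, z.2) ∈ A}

/-- `W^F ⊨` "`Q` generically preserves stationary subsets of `K`": for every stationary `A ⊆ K` of
`W^F` there is `t ∈ Q` such that `t ⊩_Q` "`A` is stationary". As usual, a condition `p` of `F`
forces `t ⊩_Q φ` if and only if `(p, t)` is a condition of `F * Q` that forces `φ`. -/
def GenericallyPreservesStationary {X K : Type u} [LinearOrder K] (F : ForcingNotion X)
    (Q : NamedForcing F K) : Prop :=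
  F.Valid fun p => ∀ A : SetName X K,
    F.imp (F.stationaryName A)
      (F.ex fun t : SetName X K => fun q =>
        (q, t) ∈ (twoStep F Q).cond ∧
          (twoStep F Q).stationaryName (twoStepName A) (q, t)) p

/-- The forcing notion of `W^F` that shoots a club disjoint from `A`: its conditions are the closed
bounded subsets of `K` disjoint from `A`, ordered by end-extension. -/
def shootClub {X K : Type u} [LinearOrder K] (F : ForcingNotion X) (A : SetName X K) :
    NamedForcing F K where
  mem c p := F.closedName c p ∧
    F.ex (fun b : K => fun q => ∀ x, b < x → F.neg (F.mem c x) q) p ∧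
    ∀ x, F.neg (fun q => F.mem c x q ∧ F.mem A x q) p
  le c d p := F.endExtName c d p
  le_refl c p := ForcingNotion.endExtName_refl c p
  le_trans _ _ _ _ h₁ h₂ := ForcingNotion.endExtName_trans h₁ h₂
  le_mono _ _ _ hp _ hq h hi := ForcingNotion.endExtName_mono hp hq h hi

/-! ### The forcing `S` adding a square sequence -/

/-- The accumulation points of a set: the nonzero `a` with `sup (c ∩ a) = a`. -/
def accPoints {K : Type u} [LinearOrder K] (c : Set K) : Set K :=
  {a | ¬ IsMin a ∧ ∀ b < a, ∃ x ∈ c, b < x ∧ x < a}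

/-- `c ⊆ a` is closed and unbounded in `a`. -/
def IsClubIn {K : Type u} [LinearOrder K] (c : Set K) (a : K) : Prop :=
  c ⊆ Iio a ∧ (∀ b < a, ∃ x ∈ c, b ≤ x) ∧ ∀ b < a, b ∈ accPoints c → b ∈ c

/-- Conditions of `S`: coherent sequences `⟨C a ; a ≤ top⟩` of clubs `C a ⊆ a` with
`C (a + 1) = {a}`. The value `C a` for `a > top` is irrelevant, and set to `∅`. -/
@[ext] structure SquareCond (K : Type u) [LinearOrder K] where
  top : K
  C : K → Set K
  club : ∀ a ≤ top, IsClubIn (C a) a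
  succ : ∀ a ≤ top, ∀ b, b ⋖ a → C a = {b}
  coherent : ∀ a ≤ top, ∀ b ∈ accPoints (C a), C a ∩ Iio b = C b
  junk : ∀ a, top < a → C a = ∅

/-- `s` is stronger than `t`: the sequence `s` end-extends the sequence `t`. -/
def SquareCond.le {K : Type u} [LinearOrder K] (s t : SquareCond K) : Prop :=
  t.top ≤ s.top ∧ ∀ a ≤ t.top, s.C a = t.C a

/-! ### The threading forcing `T` -/

/-- The name of the `a`-th member `C a` of the generic square sequence added by `S`, with respect
to a forcing notion whose conditions have a condition of `S` as their first coordinate. -/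
def genericSquare {K Y : Type u} [LinearOrder K] (a : K) : SetName (SquareCond K × Y) K :=
  {z | a ≤ z.1.1.top ∧ z.2 ∈ z.1.1.C a}

/-- The threading forcing `T`: its conditions are the members `C a` of the generic square sequence,
`a` a limit ordinal (or `0`, which gives the maximal condition `∅`), ordered by end-extension. -/
def threadForcing {K Y : Type u} [LinearOrder K] (F : ForcingNotion (SquareCond K × Y)) :
    NamedForcing F K where
  mem t p := F.ex (fun a : {a : K // Order.IsSuccPrelimit a} => F.eqName t (genericSquare a.1)) p
  le t t' p := F.endExtName t t' p
  le_refl c p := ForcingNotion.endExtName_refl c p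
  le_trans _ _ _ _ h₁ h₂ := ForcingNotion.endExtName_trans h₁ h₂
  le_mono _ _ _ hp _ hq h hi := ForcingNotion.endExtName_mono hp hq h hi

/-! ### The iteration `S * R` -/

section Iteration

variable (K : Type u) [LinearOrder K] {I : Type u} [LinearOrder I] [WellFoundedLT I]

/-- Sequences of length `α` whose `β`-th entry is a set of pairs
`((s, r), x)` with `s ∈ S`, `r` such a sequence of length `β`, and `x ∈ K`. -/
def RawSeq (α : I) : Type u :=
  (wellFounded_lt (α := I)).fix
    (fun α RawSeq => ∀ β : Iio α, SetName (SquareCond K × RawSeq β.1 β.2) K) α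

/-- The type in which the conditions of `S * R_α` live. -/
abbrev RawCond (α : I) : Type u := SquareCond K × RawSeq K α

variable {K}

/-- A raw sequence as a function. -/
def rawEquiv (α : I) : RawSeq K α ≃ ∀ β : Iio α, SetName (RawCond K β.1) K :=
  Equiv.cast (WellFounded.fix_eq _ _ α)

/-- The entry `c(β)`, for `β < α`. -/
def RawCond.entry {α β : I} (c : RawCond K α) (h : β < α) : SetName (RawCond K β) K :=
  rawEquiv α c.2 ⟨β, h⟩

/-- The restriction `c ↾ β`, for `β < α`. -/
def RawCond.res {α β : I} (c : RawCond K α) (h : β < α) : RawCond K β :=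
  (c.1, (rawEquiv β).symm fun γ => rawEquiv α c.2 ⟨γ.1, lt_trans γ.2 h⟩)

/-- An `S * R_β`-name regarded as an `S * R_α`-name, for `β < α`. -/
def liftName {α β : I} (h : β < α) (A : SetName (RawCond K β) K) : SetName (RawCond K α) K :=
  {z | (z.1.res h, z.2) ∈ A}

variable (K) in
/-- What is constructed at stage `α` of the iteration: the forcing notion `P = S * R_α`, and the
`P`-name `A` for the set `A_α` that is to be killed at this stage. -/
structure Stage (α : I) where
  P : ForcingNotion (RawCond K α)
  A : SetName (RawCond K α) K

/-- `S * R_α`, given the previous stages: the iteration, with supports of size less than `#K`,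
of the forcings `Q_β` (`β < α`) that shoot a club disjoint from `A_β`, after `S`. -/
def iterate {α : I} (prev : ∀ β < α, Stage K β) : ForcingNotion (RawCond K α) where
  cond := {c | #{β : Iio α | c.entry β.2 ≠ ∅} < #K ∧
    ∀ β, ∀ h : β < α, c.res h ∈ (prev β h).P.cond ∧
      (prev β h).P.IsName (c.entry h) ∧
      (shootClub (prev β h).P (prev β h).A).mem (c.entry h) (c.res h)}
  le c d := c.1.le d.1 ∧
    ∀ β, ∀ h : β < α, (prev β h).P.le (c.res h) (d.res h) ∧
      (shootClub (prev β h).P (prev β h).A).le (c.entry h) (d.entry h) (c.res h)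
  le_refl _ hc := ⟨⟨le_rfl, fun _ _ => rfl⟩, fun β h =>
    ⟨(prev β h).P.le_refl _ (hc.2 β h).1, NamedForcing.le_refl _ _ _⟩⟩
  le_trans _ hc _ hd _ he h₁ h₂ :=
    ⟨⟨h₂.1.1.trans h₁.1.1, fun a ha => (h₁.1.2 a (ha.trans h₂.1.1)).trans (h₂.1.2 a ha)⟩,
      fun β h =>
        ⟨(prev β h).P.le_trans _ (hc.2 β h).1 _ (hd.2 β h).1 _ (he.2 β h).1
          (h₁.2 β h).1 (h₂.2 β h).1,
        NamedForcing.le_trans _ _ _ _ _ (h₁.2 β h).2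
          (NamedForcing.le_mono _ _ _ _ (hd.2 β h).1 _ (hc.2 β h).1 (h₁.2 β h).1 (h₂.2 β h).2)⟩⟩

end Iteration

/-- `e` lists, up to forced equality, all `F`-names for subsets of `K`. -/
def Exhausts {X K L : Type u} (F : ForcingNotion X) (e : L → SetName X K) : Prop :=
  ∀ A : SetName X K, F.IsName A → ∃ γ, F.Valid (F.eqName A (e γ))

/-- The choices made in the definition of `R`: the function `f`, and for every forcing notion `F`
an enumeration, in length `L`, of the `F`-names for subsets of `K` (it lists all of them
up to forced equality, whenever some enumeration of that length does). -/
structure Bookkeeping (K L : Type u) [LinearOrder L] where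
  f : L → L × L × L
  f_surjective : Function.Surjective f
  f_lt : ∀ α, ¬ IsMin α → (f α).1 < α
  enum : ∀ {X : Type u}, ForcingNotion X → L → SetName X K
  enum_exhausts : ∀ {X : Type u} (F : ForcingNotion X),
    (∃ e : L → SetName X K, Exhausts F e) → Exhausts F (enum F)

section Preparatory

variable {K L : Type u} [LinearOrder K] [LinearOrder L] [WellFoundedLT L]

/-- The name proposed at stage `α`: if `f(α) = (β, γ, δ)` with `β < α`, the `γ`-th
`S * R_β`-name for a subset of `K`, as an `S * R_α`-name.
(For the first and for the last stage this is the empty name.) -/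
def proposedName (B : Bookkeeping K L) (α : WithTop L) (prev : ∀ β < α, Stage K β) :
    SetName (RawCond K α) K :=
  {z | ∃ (a : L) (_ : α = (a : WithTop L)) (h : ((B.f a).1 : WithTop L) < α),
    z ∈ liftName h (B.enum (prev _ h).P (B.f a).2.1)}

open Classical in
/-- Stage `α` of the iteration, by recursion on `α ≤ L`: `A_α` is the proposed name if every
condition of `S * R_α * T` forces that it is non-stationary, and the empty name otherwise. -/
def stage (B : Bookkeeping K L) (α : WithTop L) : Stage K α :=
  (wellFounded_lt (α := WithTop L)).fix (C := fun α => Stage K α) (fun α prev =>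
  let P := iterate prev
  let A := proposedName B α prev
  { P := P
    A := if (twoStep P (threadForcing P)).Valid
          ((twoStep P (threadForcing P)).neg
            ((twoStep P (threadForcing P)).stationaryName (twoStepName A)))
        then A else ∅ }) α

/-- `S * R`, where `R = R_L`. -/
def squarePreparation (B : Bookkeeping K L) :
    ForcingNotion (SquareCond K × RawSeq K (⊤ : WithTop L)) :=
  (stage B ⊤).P

end Preparatory

end

/-! Suppose that a condition `p` forces `A` to be stationary, while below `p` no condition of `T`
can force this. Let `A'` be `A` cut down to the conditions below `p`. Then every condition of `S * R
* T` forces `A'` to be non-stationary, and by mixing there is one name `E` for a club disjoint from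
it. If `A'` and `E` reflect to a stage `α < κ⁺`, then at some stage `a > α` the bookkeeping proposes
the reflected `A'`. The reflected `E` shows that `T` kills this set already over `S * R_a`, so stage
`a` shoots a club disjoint from it. Below `p` this club also has to avoid `A`, contradicting
stationarity.

Reflection rests on a dense set of conditions of `S * R_α * T` that is closed under limits of length
less than `κ`. A tight condition consists of ground-model data: a square condition, whose last club
serves as the condition of `T`, and for each stage `β` a closed bounded set that is empty or ends
exactly at the length of the square sequence; this length is moreover forced into a club avoiding
`A_β`. Such a club has a name over `S * R_β * T` because `A_β` is only killed if `T` destroys it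
anyway. Along a chain of tight conditions the last clubs end-extend each other, so their union is a
legitimate next club. The supremum of the lengths can be put on top of all nonempty entries, because
it is a limit of points of the avoiding club and hence forced outside `A_β` (`exists_limit`).
Density is proved by induction on `α` (`denseAt`): closure at earlier stages turns the names in a
condition into ground-model sets.

By `2^{<κ} = κ` there are at most `κ` tight conditions with support below a given stage before `κ⁺`
(`mk_tightBelow_le`), so `2^κ = κ⁺` makes the enumerations of names exhaustive there. Closing off
under witnesses `κ` times yields the stage `α` (`exists_reflecting_stage`): it has cofinality `κ`,
so the part below `α` of a support, being of size less than `κ`, is bounded below `α`. -/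

noncomputable section

/-! ### Membership in names, and names for clubs avoiding a set. -/

namespace ForcingNotion

variable {X K : Type u} {F : ForcingNotion X}

theorem mem_mono {A : SetName X K} {x : K} {p q : X} (hp : p ∈ F.cond) (hq : q ∈ F.cond)
    (h : F.le q p) (hm : F.mem A x p) : F.mem A x q :=
  fun r hr hrq => hm r hr (F.le_trans r hr q hq p hp hrq h)

theorem mem_of_dense {A : SetName X K} {x : K} {p : X}
    (h : ∀ q ∈ F.cond, F.le q p → ∃ r ∈ F.cond, F.le r q ∧ F.mem A x r) : F.mem A x p := by
  intro q hq hqp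
  obtain ⟨r, hr, hrq, hm⟩ := h q hq hqp
  obtain ⟨s, hs, hsr, a, ha, hax, hsa⟩ := hm r hr (F.le_refl r hr)
  exact ⟨s, hs, F.le_trans s hs r hr q hq hsr hrq, a, ha, hax, hsa⟩

theorem mem_of_mem_name {A : SetName X K} {x : K} {p a : X} (hp : p ∈ F.cond) (ha : a ∈ F.cond)
    (hax : (a, x) ∈ A) (h : F.le p a) : F.mem A x p :=
  fun q hq hqp => ⟨q, hq, F.le_refl q hq, a, ha, hax, F.le_trans q hq p hp a ha hqp h⟩

theorem exists_mem_or_not_mem (A : SetName X K) (x : K) {p : X} (hp : p ∈ F.cond) :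
    ∃ q ∈ F.cond, F.le q p ∧ (F.mem A x q ∨ ∀ r ∈ F.cond, F.le r q → ¬ F.mem A x r) := by
  by_cases h : ∃ q ∈ F.cond, F.le q p ∧ F.mem A x q
  · obtain ⟨q, hq, hqp, hm⟩ := h
    exact ⟨q, hq, hqp, Or.inl hm⟩
  · exact ⟨p, hp, F.le_refl p hp, Or.inr fun r hr hrp hm => h ⟨r, hr, hrp, hm⟩⟩

/-- The name of those `x` whose membership is forced according to `φ`. -/
def nameOf (F : ForcingNotion X) (φ : K → X → Prop) : SetName X K := {z | z.1 ∈ F.cond ∧ φ z.2 z.1}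

/-- The device for changing `A` off `p`: whatever puts an element into the truncated name lies below
a condition below `p`, while under `p` itself nothing is lost. -/
theorem mem_nameOf_below {A : SetName X K} {p q : X} {x : K} (hq : q ∈ F.cond) (hqp : F.le q p) :
    F.mem (F.nameOf fun x c => F.le c p ∧ F.mem A x c) x q ↔ F.mem A x q := by
  refine ⟨fun h => ?_, fun h => mem_of_mem_name hq hq ⟨hq, hqp, h⟩ (F.le_refl q hq)⟩
  refine mem_of_dense fun r hr hrq => ?_
  obtain ⟨s, hs, hsr, a, ha, hax, hsa⟩ := h r hr hrq
  exact ⟨s, hs, hsr, mem_mono ha hs hsa hax.2.2⟩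

variable [LinearOrder K]

/-- `E` is forced by every condition to be a club disjoint from `A`. -/
structure AvoidingClub (F : ForcingNotion X) (A E : SetName X K) : Prop where
  unbounded : ∀ p ∈ F.cond, ∀ b : K, ∃ q ∈ F.cond, F.le q p ∧ ∃ x, b < x ∧ F.mem E x q
  closed : ∀ p ∈ F.cond, ∀ y, F.accName E y p → F.mem E y p
  disjoint : ∀ p ∈ F.cond, ∀ x, F.mem E x p → ¬ F.mem A x p

theorem AvoidingClub.clubName {A E : SetName X K} (h : F.AvoidingClub A E) (p : X) :
    F.clubName E p := by
  refine ⟨fun a q hq _ => h.closed q hq a, fun b q hq _ => ?_⟩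
  obtain ⟨r, hr, hrq, x, hx, hm⟩ := h.unbounded q hq b
  exact ⟨r, hr, hrq, ⟨x, hx⟩, hm⟩

theorem AvoidingClub.valid {A E : SetName X K} (h : F.AvoidingClub A E) :
    F.Valid (F.neg (F.stationaryName A)) := by
  intro p hp q hq hqp hs
  obtain ⟨r, hr, _, x, hx, hx'⟩ :=
    hs E q hq (F.le_refl q hq) (h.clubName q) q hq (F.le_refl q hq)
  exact h.disjoint r hr x hx' hx

theorem accName_mono {A : SetName X K} {a : K} {p q : X} (hp : p ∈ F.cond) (hq : q ∈ F.cond)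
    (h : F.le q p) (ha : F.accName A a p) : F.accName A a q :=
  ⟨ha.1, fun b hb r hr hrq => ha.2 b hb r hr (F.le_trans r hr q hq p hp hrq h)⟩

theorem accName_congr {A B : SetName X K} {a : K} {p : X} (hp : p ∈ F.cond)
    (h : ∀ x, ∀ q ∈ F.cond, F.le q p → F.mem A x q → F.mem B x q) (ha : F.accName A a p) :
    F.accName B a p := by
  refine ⟨ha.1, fun b hb r hr hrp => ?_⟩
  obtain ⟨s, hs, hsr, i, hi⟩ := ha.2 b hb r hr hrp
  exact ⟨s, hs, hsr, i, h _ s hs (F.le_trans s hs r hr p hp hsr hrp) hi⟩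

/-- A single name for a club witnesses that every condition forces non-stationarity. -/
theorem exists_avoidingClub {A : SetName X K} (h : F.Valid (F.neg (F.stationaryName A))) :
    ∃ E : SetName X K, F.AvoidingClub A E := by
  have key : ∀ p ∈ F.cond, ∃ q ∈ F.cond, F.le q p ∧ ∃ C : SetName X K, F.clubName C q ∧
      ∀ x, ∀ r ∈ F.cond, F.le r q → F.mem C x r → ¬ F.mem A x r := by
    intro p hp
    have h1 := h p hp p hp (F.le_refl p hp)
    simp only [stationaryName, imp, ex, not_forall] at h1
    obtain ⟨C, q, hq, hqp, hC, r, hr, hrq, hn⟩ := h1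
    push Not at hn
    refine ⟨r, hr, F.le_trans r hr q hq p hp hrq hqp, C,
      ⟨fun a => imp_mono hq hr hrq (hC.1 a),
        fun b s hs hsr => hC.2 b s hs (F.le_trans s hs r hr q hq hsr hrq)⟩,
      fun x s hs hsr hc ha => hn s hs hsr x ha hc⟩
  -- Conditions that carry a club of their own are dense by `key`; the single name is obtained by
  -- mixing these clubs.
  let good : Set X := {q | q ∈ F.cond ∧ ∃ C : SetName X K, F.clubName C q ∧
      ∀ x, ∀ r ∈ F.cond, F.le r q → F.mem C x r → ¬ F.mem A x r}
  have hC : ∀ q : X, ∃ C : SetName X K, q ∈ good → F.clubName C q ∧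
      ∀ x, ∀ r ∈ F.cond, F.le r q → F.mem C x r → ¬ F.mem A x r := by
    intro q
    by_cases hq : q ∈ good
    · obtain ⟨C, hC⟩ := hq.2
      exact ⟨C, fun _ => hC⟩
    · exact ⟨∅, fun h => absurd h hq⟩
  choose C hC using hC
  -- `q` is the first good condition compatible with `r`, in an arbitrary well-order, and `r` is
  -- below it. This replaces a maximal antichain: `q` is unique, and it stays the same for all
  -- conditions stronger than `r`.
  let assigned : X → X → Prop := fun r q => r ∈ F.cond ∧ q ∈ good ∧ F.le r q ∧
    ∀ q' ∈ good, WellOrderingRel q' q → ¬ ∃ s ∈ F.cond, F.le s r ∧ F.le s q'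
  have ass_mono : ∀ r q s, assigned r q → s ∈ F.cond → F.le s r → assigned s q := by
    intro r q s hr hs hsr
    refine ⟨hs, hr.2.1, F.le_trans s hs r hr.1 q hr.2.1.1 hsr hr.2.2.1, ?_⟩
    rintro q' hq' hlt ⟨t, ht, hts, htq⟩
    exact hr.2.2.2 q' hq' hlt ⟨t, ht, F.le_trans t ht s hs r hr.1 hts hsr, htq⟩
  have ass_unique : ∀ r q q', assigned r q → assigned r q' → q = q' := by
    intro r q q' h1 h2
    rcases trichotomous_of WellOrderingRel q q' with h | h | h
    · exact absurd ⟨r, h1.1, F.le_refl r h1.1, h1.2.2.1⟩ (h2.2.2.2 q h1.2.1 h)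
    · exact h
    · exact absurd ⟨r, h1.1, F.le_refl r h1.1, h2.2.2.1⟩ (h1.2.2.2 q' h2.2.1 h)
  have ass_dense : ∀ p ∈ F.cond, ∃ r, F.le r p ∧ ∃ q, assigned r q := by
    intro p hp
    let S : Set X := {q | q ∈ good ∧ ∃ s ∈ F.cond, F.le s p ∧ F.le s q}
    have hS : S.Nonempty := by
      obtain ⟨q, hq, hqp, hq'⟩ := key p hp
      exact ⟨q, ⟨hq, hq'⟩, q, hq, hqp, F.le_refl q hq⟩
    have wf : WellFounded (WellOrderingRel : X → X → Prop) := IsWellFounded.wf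
    obtain ⟨hq, s, hs, hsp, hsq⟩ := wf.min_mem S hS
    refine ⟨s, hsp, wf.min S hS, hs, hq, hsq, ?_⟩
    rintro q' hq' hlt ⟨t, ht, hts, htq⟩
    exact wf.not_lt_min S ⟨hq', t, ht, F.le_trans t ht s hs p hp hts hsp, htq⟩ hlt
  let E : SetName X K := {z | ∃ q, assigned z.1 q ∧ F.mem (C q) z.2 z.1}
  have hE : ∀ r q x, assigned r q → (F.mem E x r ↔ F.mem (C q) x r) := by
    intro r q x hr
    constructor
    · intro hm
      refine mem_of_dense fun s hs hsr => ?_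
      obtain ⟨t, ht, hts, a, ha, ⟨q', hq', hm'⟩, hta⟩ := hm s hs hsr
      have h1 := ass_mono a q' t hq' ht hta
      have h2 := ass_mono r q t hr ht (F.le_trans t ht s hs r hr.1 hts hsr)
      obtain rfl := ass_unique t _ _ h1 h2
      exact ⟨t, ht, hts, mem_mono ha ht hta hm'⟩
    · intro hm
      exact mem_of_mem_name hr.1 hr.1 ⟨q, hr, hm⟩ (F.le_refl r hr.1)
  have club_of : ∀ r q, assigned r q → F.clubName (C q) q := fun r q h => (hC q h.2.1).1
  refine ⟨E, ?_, ?_, ?_⟩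
  · intro p hp b
    obtain ⟨r, hrp, q, hr⟩ := ass_dense p hp
    obtain ⟨s, hs, hsr, ⟨x, hx⟩, hm⟩ := (club_of r q hr).2 b r hr.1 hr.2.2.1
    exact ⟨s, hs, F.le_trans s hs r hr.1 p hp hsr hrp, x, hx,
      (hE s q x (ass_mono r q s hr hs hsr)).2 hm⟩
  · intro p hp y hacc
    refine mem_of_dense fun p' hp' hp'p => ?_
    obtain ⟨r, hrp, q, hr⟩ := ass_dense p' hp'
    refine ⟨r, hr.1, hrp, (hE r q y hr).2 ?_⟩
    refine (club_of r q hr).1 y r hr.1 hr.2.2.1 ?_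
    refine accName_congr hr.1 (fun x s hs hsr => (hE s q x (ass_mono r q s hr hs hsr)).1) ?_
    exact accName_mono hp hr.1 (F.le_trans r hr.1 p' hp' p hp hrp hp'p) hacc
  · intro p hp x hm ha
    obtain ⟨r, hrp, q, hr⟩ := ass_dense p hp
    exact (hC q hr.2.1).2 x r hr.1 hr.2.2.1 ((hE r q x hr).1 (mem_mono hp hr.1 hrp hm))
      (mem_mono hp hr.1 hrp ha)

/-- The club is the whole of `K`. It serves the stages at which nothing is killed, and it is a test
club for showing that stationary sets are nonempty. -/
theorem avoidingClub_empty [NoMaxOrder K] :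
    F.AvoidingClub (∅ : SetName X K) (F.nameOf fun _ _ => True) := by
  have hm : ∀ x : K, ∀ p ∈ F.cond, F.mem (F.nameOf fun _ _ => True) x p := fun x p hp =>
    mem_of_mem_name hp hp ⟨hp, trivial⟩ (F.le_refl p hp)
  refine ⟨fun p hp b => ?_, fun p hp y _ => hm y p hp, fun p hp x _ h => ?_⟩
  · obtain ⟨x, hx⟩ := exists_gt b
    exact ⟨p, hp, F.le_refl p hp, x, hx, hm x p hp⟩
  · obtain ⟨_, _, _, _, _, h, _⟩ := h p hp (F.le_refl p hp)
    exact h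

end ForcingNotion

/-! ### Regular well-orders and constructions of small length. -/

/-- Well-orders whose order type is an uncountable regular cardinal. -/
class UncountableRegularOrder (K : Type u) [LinearOrder K] : Prop extends WellFoundedLT K where
  regular : (#K).IsRegular
  uncountable : ℵ₀ < #K
  mk_Iio_lt : ∀ a : K, #(Iio a) < #K

namespace UncountableRegularOrder

variable {K : Type u} [LinearOrder K] [UncountableRegularOrder K]

theorem mk_Iic_lt (a : K) : #(Iic a) < #K := by
  have h : Iic a = insert a (Iio a) := by
    ext x
    simp [le_iff_eq_or_lt]
  rw [h]
  exact mk_insert_le.trans_lt (add_lt_of_lt regular.aleph0_le (mk_Iio_lt a)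
    (one_lt_aleph0.trans_le regular.aleph0_le))

theorem exists_forall_lt (S : Set K) (hS : #S < #K) : ∃ b, ∀ x ∈ S, x < b := by
  by_contra! h
  have hU : (⋃ x ∈ S, Iic x) = Set.univ := by
    refine eq_univ_of_forall fun b => ?_
    obtain ⟨x, hx, hbx⟩ := h b
    exact mem_biUnion hx hbx
  have h1 : #(⋃ x ∈ S, Iic x : Set K) < #K :=
    (card_biUnion_lt_iff_forall_of_isRegular regular hS).2 fun x _ => mk_Iic_lt x
  rw [hU, mk_univ] at h1
  exact h1.false

instance : NoMaxOrder K where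
  exists_gt a := by
    obtain ⟨b, hb⟩ := exists_forall_lt ({a} : Set K)
      (by simpa using one_lt_aleph0.trans_le regular.aleph0_le)
    exact ⟨b, hb a rfl⟩

/-- A small set without a last element has a limit as its supremum. -/
theorem exists_limit_lub (S : Set K) (hS : #S < #K) (hmax : ∀ x ∈ S, ∃ y ∈ S, x < y) :
    ∃ c, Order.IsSuccPrelimit c ∧ (∀ x ∈ S, x < c) ∧ ∀ b < c, ∃ x ∈ S, b < x := by
  have wf : WellFounded ((· < ·) : K → K → Prop) := wellFounded_lt
  let U : Set K := {b | ∀ x ∈ S, x < b}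
  have hU : U.Nonempty := exists_forall_lt S hS
  have hb : ∀ b < wf.min U hU, ∃ x ∈ S, b < x := by
    intro b hb
    have : b ∉ U := fun h => wf.not_lt_min U h hb
    simp only [U, mem_ofPred_eq, not_forall, not_lt] at this
    obtain ⟨x, hx, hbx⟩ := this
    obtain ⟨y, hy, hxy⟩ := hmax x hx
    exact ⟨y, hy, hbx.trans_lt hxy⟩
  refine ⟨wf.min U hU, fun b hcov => ?_, wf.min_mem U hU, hb⟩
  obtain ⟨x, hx, hbx⟩ := hb b hcov.lt
  exact hcov.2 hbx (wf.min_mem U hU x hx)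

theorem exists_limit_gt (b : K) : ∃ c, Order.IsSuccPrelimit c ∧ b < c := by
  choose f hf using fun a : K => exists_gt a
  let g : ℕ → K := fun n => f^[n] b
  have hg : ∀ n, g n < g (n + 1) := fun n => by
    simp only [g, Function.iterate_succ_apply']
    exact hf _
  obtain ⟨c, hc, hc', -⟩ := exists_limit_lub (range g)
    ((le_aleph0_iff_set_countable.2 (countable_range g)).trans_lt uncountable)
    (by rintro _ ⟨n, rfl⟩; exact ⟨_, ⟨n + 1, rfl⟩, hg n⟩)
  exact ⟨c, hc, hc' _ ⟨0, rfl⟩⟩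

end UncountableRegularOrder

/-- A construction of small length along the stages `I`, by recursion: `G i d` says that `d` is a
possible result at stage `i`, and the results get properly stronger in the sense of `R`. -/
theorem exists_climb {J D : Type u} [LinearOrder J] [WellFoundedLT J] {κ : Cardinal.{u}} {I : Set J}
    (hI : #I < κ) {R : D → D → Prop} (hR : ∀ {a b c}, R a b → R b c → R a c) {G : J → D → Prop}
    {i₀ τ : J} {d₀ : D} (hi₀ : i₀ ∈ I) (hτ : τ ∈ I) (hmax : ∀ i ∈ I, i ≤ τ) (h₀ : G i₀ d₀)
    (step : ∀ i ∈ I, ∀ j ∈ I, i < j → (∀ k ∈ I, k < j → k ≤ i) → ∀ d, G i d → ∃ e, R e d ∧ G j e)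
    (lim : ∀ j ∈ I, ∀ C : Set D, C.Nonempty → #C < κ → (∀ d ∈ C, ∃ i ∈ I, i < j ∧ G i d) →
      (∀ d ∈ C, ∀ e ∈ C, d = e ∨ R d e ∨ R e d) → (∀ d ∈ C, ∃ e ∈ C, R e d) →
      (∀ i ∈ I, i < j → ∃ d ∈ C, ∃ i' ∈ I, i < i' ∧ i' < j ∧ G i' d) →
      ∃ e, (∀ d ∈ C, R e d) ∧ G j e) :
    ∃ e, (e = d₀ ∨ R e d₀) ∧ G τ e := by
  -- Zorn's lemma takes the place of transfinite recursion. A pair records a stage and a result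
  -- there; going up means a later stage and a stronger result. A maximal pair has reached `τ`.
  let T := {z : J × D // z.1 ∈ I ∧ G z.1 z.2 ∧ (z.2 = d₀ ∨ R z.2 d₀)}
  let r : T → T → Prop := fun z w => z = w ∨ (z.1.1 < w.1.1 ∧ R w.1.2 z.1.2)
  have wf : WellFounded ((· < ·) : J → J → Prop) := wellFounded_lt
  have hrt : ∀ {a b c}, r a b → r b c → r a c := by
    rintro a b c (rfl | h1) (rfl | h2)
    · exact Or.inl rfl
    · exact Or.inr h2
    · exact Or.inr h1
    · exact Or.inr ⟨h1.1.trans h2.1, hR h2.2 h1.2⟩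
  obtain ⟨m, hm⟩ := exists_maximal_of_chains_bounded (r := r) (by
    intro c hc
    by_cases hne : c.Nonempty
    swap
    · exact ⟨⟨(i₀, d₀), hi₀, h₀, Or.inl rfl⟩, fun a ha => absurd ⟨a, ha⟩ hne⟩
    by_cases hmx : ∃ m ∈ c, ∀ a ∈ c, r a m
    · obtain ⟨m, -, hm⟩ := hmx
      exact ⟨m, hm⟩
    push Not at hmx
    have total : ∀ a ∈ c, ∀ b ∈ c, r a b ∨ r b a := fun a ha b hb => by
      by_cases hab : a = b
      · exact Or.inl (Or.inl hab)
      · exact hc ha hb hab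
    have up : ∀ a ∈ c, ∃ b ∈ c, a.1.1 < b.1.1 ∧ R b.1.2 a.1.2 := by
      intro a ha
      obtain ⟨b, hb, hba⟩ := hmx a ha
      rcases total a ha b hb with h | h
      · rcases h with rfl | h
        · exact absurd (Or.inl rfl) hba
        · exact ⟨b, hb, h⟩
      · exact absurd h hba
    -- The limit of a chain without a last element is placed at the least index above all its
    -- stages.
    let U : Set J := {j | j ∈ I ∧ ∀ a ∈ c, a.1.1 < j}
    have hU : U.Nonempty := ⟨τ, hτ, fun a ha => by
      obtain ⟨b, -, hb⟩ := up a ha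
      exact hb.1.trans_le (hmax _ b.2.1)⟩
    obtain ⟨hjI, hj⟩ := wf.min_mem U hU
    -- A chain meets every stage at most once, so it is no larger than `I`.
    have hsz : #c < κ := by
      refine lt_of_le_of_lt ?_ hI
      refine mk_le_of_injective (f := fun a : c => (⟨a.1.1.1, a.1.2.1⟩ : I)) ?_
      rintro ⟨a, ha⟩ ⟨b, hb⟩ hab
      have hab' : a.1.1 = b.1.1 := congrArg Subtype.val hab
      rcases total a ha b hb with (h | h) | (h | h)
      · exact Subtype.ext h
      · exact absurd hab' h.1.ne
      · exact Subtype.ext h.symm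
      · exact absurd hab' h.1.ne'
    obtain ⟨e, he, hGe⟩ := lim _ hjI ((fun a : T => a.1.2) '' c) (hne.image _)
      (mk_image_le.trans_lt hsz)
      (by rintro _ ⟨a, ha, rfl⟩; exact ⟨a.1.1, a.2.1, hj a ha, a.2.2.1⟩)
      (by
        rintro _ ⟨a, ha, rfl⟩ _ ⟨b, hb, rfl⟩
        rcases total a ha b hb with (h | h) | (h | h)
        · exact Or.inl (by rw [h])
        · exact Or.inr (Or.inr h.2)
        · exact Or.inl (by rw [h])
        · exact Or.inr (Or.inl h.2))
      (by
        rintro _ ⟨a, ha, rfl⟩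
        obtain ⟨b, hb, h⟩ := up a ha
        exact ⟨_, ⟨b, hb, rfl⟩, h.2⟩)
      (by
        intro i hi hij
        have : i ∉ U := fun h => wf.not_lt_min U h hij
        simp only [U, mem_ofPred_eq, not_and, not_forall, not_lt] at this
        obtain ⟨a, ha, hia⟩ := this hi
        obtain ⟨b, hb, h⟩ := up a ha
        exact ⟨_, ⟨b, hb, rfl⟩, b.1.1, b.2.1, hia.trans_lt h.1, hj b hb, b.2.2.1⟩)
    obtain ⟨a, ha⟩ := hne
    refine ⟨⟨(_, e), hjI, hGe, ?_⟩, fun b hb => Or.inr ⟨hj b hb, he _ ⟨b, hb, rfl⟩⟩⟩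
    have h1 := he _ ⟨a, ha, rfl⟩
    rcases a.2.2.2 with h | h
    · exact Or.inr (h ▸ h1)
    · exact Or.inr (hR h1 h)) hrt
  obtain ⟨⟨i, d⟩, hi, hG, hd⟩ := m
  rcases (hmax i hi).eq_or_lt with rfl | hlt
  · exact ⟨d, hd, hG⟩
  let U : Set J := {j | j ∈ I ∧ i < j}
  have hU : U.Nonempty := ⟨τ, hτ, hlt⟩
  obtain ⟨hjI, hij⟩ := wf.min_mem U hU
  obtain ⟨e, he, hGe⟩ := step i hi _ hjI hij (fun k hk hkj => by
    by_contra! h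
    exact wf.not_lt_min U ⟨hk, h⟩ hkj) d hG
  have hed : e = d₀ ∨ R e d₀ := by
    rcases hd with rfl | hd
    · exact Or.inr he
    · exact Or.inr (hR he hd)
  rcases hm ⟨(_, e), hjI, hGe, hed⟩ (Or.inr ⟨hij, he⟩) with h | h
  · exact absurd (congrArg (fun z : T => z.1.1) h) hij.ne'
  · exact absurd h.1 (not_lt.2 hij.le)

/-! ### End-extension, accumulation points and lengthening of square sequences. -/

section Squares

variable {K : Type u} [LinearOrder K]

/-- `c` end-extends `d`. -/
def EndExt (c d : Set K) : Prop := d ⊆ c ∧ ∀ x y, x ≤ y → x ∈ c → y ∈ d → x ∈ d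

theorem EndExt.refl (c : Set K) : EndExt c c := ⟨Subset.rfl, fun _ _ _ h _ => h⟩

theorem EndExt.trans {c d e : Set K} (h₁ : EndExt c d) (h₂ : EndExt d e) : EndExt c e :=
  ⟨h₂.1.trans h₁.1, fun x y hxy hx hy => h₂.2 x y hxy (h₁.2 x y hxy hx (h₂.1 hy)) hy⟩

theorem EndExt.empty (c : Set K) : EndExt c ∅ := ⟨empty_subset c, fun _ _ _ _ h => h.elim⟩

theorem accPoints_mono_below {c d : Set K} {a t : K} (hat : a ≤ t) (h : ∀ x ∈ c, x < t → x ∈ d)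
    (ha : a ∈ accPoints c) : a ∈ accPoints d := by
  refine ⟨ha.1, fun b hb => ?_⟩
  obtain ⟨x, hx, hbx, hxa⟩ := ha.2 b hb
  exact ⟨x, h x hx (hxa.trans_le hat), hbx, hxa⟩

theorem isSuccPrelimit_of_mem_accPoints {c : Set K} {a : K} (ha : a ∈ accPoints c) :
    Order.IsSuccPrelimit a := by
  intro b hb
  obtain ⟨x, -, hbx, hxa⟩ := ha.2 b hb.lt
  exact hb.2 hbx hxa

theorem not_mem_accPoints_of_forall_le {c : Set K} {a t : K} (hta : t < a)
    (h : ∀ x ∈ c, x < a → x ≤ t) : a ∉ accPoints c := by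
  intro ha
  obtain ⟨x, hx, htx, hxa⟩ := ha.2 t hta
  exact absurd (h x hx hxa) (not_le.2 htx)

theorem SquareCond.le_refl (s : SquareCond K) : s.le s := ⟨le_rfl, fun _ _ => rfl⟩

theorem SquareCond.le_trans {s t v : SquareCond K} (h₁ : s.le t) (h₂ : t.le v) : s.le v :=
  ⟨h₂.1.trans h₁.1, fun a ha => (h₁.2 a (ha.trans h₂.1)).trans (h₂.2 a ha)⟩

/-- A condition of `S` can be made arbitrarily long, with a last club that end-extends any given
club of the condition. -/
theorem SquareCond.exists_extension [UncountableRegularOrder K] (s : SquareCond K) (a : K)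
    (ha : a ≤ s.top) (x : K) : ∃ t : SquareCond K, t.le s ∧ x < t.top ∧ s.top < t.top ∧
      Order.IsSuccPrelimit t.top ∧ EndExt (t.C t.top) (s.C a) := by
  classical
  obtain ⟨δ, hδ, hδx⟩ := UncountableRegularOrder.exists_limit_gt (max x s.top)
  have hxδ : x < δ := (le_max_left _ _).trans_lt hδx
  have hsδ : s.top < δ := (le_max_right _ _).trans_lt hδx
  -- The club used at every new limit `b`: follow `s.C a`, then `a`, then everything from `s.top`
  -- on. The new clubs are initial segments of each other, and their accumulation points up to
  -- `s.top` are at most `a`, where the coherence of `s` applies.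
  let long : K → Set K := fun b => s.C a ∪ {a} ∪ Ico s.top b
  let C : K → Set K := fun b => if b ≤ s.top then s.C b else if b ≤ δ then
    (if Order.IsSuccPrelimit b then long b else {c | c ⋖ b}) else ∅
  have C1 : ∀ b ≤ s.top, C b = s.C b := fun b hb => if_pos hb
  have C2 : ∀ b, s.top < b → b ≤ δ → Order.IsSuccPrelimit b → C b = long b := fun b h1 h2 h3 => by
    simp [C, not_le.2 h1, h2, h3]
  have C3 : ∀ b, s.top < b → b ≤ δ → ¬ Order.IsSuccPrelimit b → C b = {c | c ⋖ b} :=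
    fun b h1 h2 h3 => by simp [C, not_le.2 h1, h2, h3]
  have hsa := (s.club a ha).1
  have long_inter : ∀ b c, b ≤ c → s.top < b → long c ∩ Iio b = long b := by
    intro b c hbc hb
    ext y
    simp only [long, mem_inter_iff, mem_union, mem_singleton_iff, mem_Ico, mem_Iio]
    constructor
    · rintro ⟨(h | h) | h, hy⟩
      · exact Or.inl (Or.inl h)
      · exact Or.inl (Or.inr h)
      · exact Or.inr ⟨h.1, hy⟩
    · rintro ((h | h) | h)
      · exact ⟨Or.inl (Or.inl h), ((hsa h).trans_le ha).trans hb⟩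
      · exact ⟨Or.inl (Or.inr h), h ▸ ha.trans_lt hb⟩
      · exact ⟨Or.inr ⟨h.1, h.2.trans_le hbc⟩, h.2⟩
  have long_acc : ∀ b c, b ∈ accPoints (long c) → b ≤ s.top → (b = a ∨ b ∈ accPoints (s.C a)) ∧
      b ≤ a := by
    intro b c hb hbs
    have hba : b ≤ a := by
      by_contra! hab
      refine not_mem_accPoints_of_forall_le hab (fun y hy hyb => ?_) hb
      rcases hy with (h | h) | h
      · exact (hsa h).le
      · exact h.le
      · exact absurd (hyb.trans_le hbs) (not_lt.2 h.1)
    refine ⟨Or.inr ?_, hba⟩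
    refine accPoints_mono_below (t := b) le_rfl (fun y hy hyb => ?_) hb
    rcases hy with (h | h) | h
    · exact h
    · exact absurd (hyb.trans_le hba) (by rw [h]; exact lt_irrefl _)
    · exact absurd (hyb.trans_le hbs) (not_lt.2 h.1)
  refine ⟨⟨δ, C, ?_, ?_, ?_, ?_⟩, ⟨hsδ.le, C1⟩, hxδ, hsδ, hδ, ?_⟩
  · intro b hb
    rcases le_or_gt b s.top with h | h
    · rw [C1 b h]
      exact s.club b h
    by_cases hl : Order.IsSuccPrelimit b
    · rw [C2 b h hb hl]
      refine ⟨?_, ?_, ?_⟩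
      · rintro y ((hy | hy) | hy)
        · exact ((hsa hy).trans_le ha).trans h
        · exact (show y = a from hy) ▸ ha.trans_lt h
        · exact hy.2
      · intro y hy
        exact ⟨max y s.top, Or.inr ⟨le_max_right _ _, max_lt hy h⟩, le_max_left _ _⟩
      · intro y hy hacc
        rcases le_or_gt s.top y with h' | h'
        · exact Or.inr ⟨h', hy⟩
        · obtain ⟨h1, h2⟩ := long_acc y b hacc h'.le
          rcases h2.eq_or_lt with rfl | h2
          · exact Or.inl (Or.inr rfl)
          · exact Or.inl (Or.inl ((s.club a ha).2.2 y h2 (h1.resolve_left h2.ne)))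
    · rw [C3 b h hb hl]
      refine ⟨fun y hy => hy.lt, ?_, ?_⟩
      · intro y hy
        simp only [Order.IsSuccPrelimit, not_forall, not_not] at hl
        obtain ⟨c, hc⟩ := hl
        exact ⟨c, hc, le_of_not_gt fun h => hc.2 h hy⟩
      · intro y hy hacc
        exfalso
        obtain ⟨z, hz, -, hzy⟩ := hacc.2 _ (not_isMin_iff.1 hacc.1).choose_spec
        exact hz.2 hzy hy
  · intro b hb c hcb
    rcases le_or_gt b s.top with h | h
    · rw [C1 b h]
      exact s.succ b h c hcb
    · rw [C3 b h hb fun hl => hl c hcb]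
      ext y
      exact ⟨fun hy => hy.unique_left hcb, fun hy => (show y = c from hy) ▸ hcb⟩
  · intro b hb c hc
    rcases le_or_gt b s.top with h | h
    · rw [C1 b h] at hc ⊢
      rw [s.coherent b h c hc, C1 c]
      by_contra! hlt
      exact not_mem_accPoints_of_forall_le (h.trans_lt hlt)
        (fun y hy _ => ((s.club b h).1 hy).le) hc
    by_cases hl : Order.IsSuccPrelimit b
    · rw [C2 b h hb hl] at hc ⊢
      have hcb : c ≤ b := by
        by_contra! hlt
        refine not_mem_accPoints_of_forall_le hlt (fun y hy _ => ?_) hc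
        rcases hy with (hy | hy) | hy
        · exact (((hsa hy).trans_le ha).trans h).le
        · exact (show y = a from hy) ▸ (ha.trans_lt h).le
        · exact hy.2.le
      rcases le_or_gt c s.top with h' | h'
      · obtain ⟨h1, h2⟩ := long_acc c b hc h'
        have h3 : long b ∩ Iio c = s.C a ∩ Iio c := by
          ext y
          constructor
          · rintro ⟨(hy | hy) | hy, hyc⟩
            · exact ⟨hy, hyc⟩
            · exact absurd ((show y < c from hyc).trans_le h2)
                ((show y = a from hy) ▸ lt_irrefl _)
            · exact absurd ((show y < c from hyc).trans_le h') (not_lt.2 hy.1)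
          · exact fun hy => ⟨Or.inl (Or.inl hy.1), hy.2⟩
        rw [h3, C1 c h']
        rcases h1 with rfl | h1
        · exact inter_eq_left.2 hsa
        · exact s.coherent a ha c h1
      · rw [C2 c h' (hcb.trans hb) (isSuccPrelimit_of_mem_accPoints hc)]
        exact long_inter c b hcb h'
    · rw [C3 b h hb hl] at hc
      exfalso
      simp only [Order.IsSuccPrelimit, not_forall, not_not] at hl
      obtain ⟨p, hp⟩ := hl
      obtain ⟨z, hz, -, hzy⟩ := hc.2 _ (not_isMin_iff.1 hc.1).choose_spec
      obtain ⟨w, hw, hzw, -⟩ := hc.2 z hzy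
      exact hzw.ne ((show z ⋖ b from hz).unique_left hw)
  · intro b hb
    simp [C, not_le.2 hb, not_le.2 (hsδ.trans hb)]
  · show EndExt (C δ) (s.C a)
    rw [C2 δ hsδ le_rfl hδ]
    refine ⟨fun y hy => Or.inl (Or.inl hy), fun y z hyz hy hz => ?_⟩
    rcases hy with (hy | hy) | hy
    · exact hy
    · exact absurd (hyz.trans_lt (hsa hz)) ((show y = a from hy) ▸ lt_irrefl _)
    · exact absurd (hyz.trans_lt ((hsa hz).trans_le ha)) (not_lt.2 hy.1)

end Squares

/-! ### Raw conditions, and the threading forcing over a forcing that begins with `S`. -/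

section Raw

variable {K : Type u} [LinearOrder K] {I : Type u} [LinearOrder I] [WellFoundedLT I]

@[simp] theorem RawCond.res_res {α β γ : I} (c : RawCond K α) (h : β < α) (h' : γ < β) :
    (c.res h).res h' = c.res (h'.trans h) := by
  simp [RawCond.res]

@[simp] theorem RawCond.entry_res {α β γ : I} (c : RawCond K α) (h : β < α) (h' : γ < β) :
    (c.res h).entry h' = c.entry (h'.trans h) := by
  simp [RawCond.res, RawCond.entry]

end Raw

section Thread

variable {K Y : Type u} [LinearOrder K] {F : ForcingNotion (SquareCond K × Y)}

theorem genericSquare_mem_iff (hF : ∀ p q, F.le p q → p.1.le q.1) {a x : K}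
    {p : SquareCond K × Y} (hp : p ∈ F.cond) (ha : a ≤ p.1.top) :
    F.mem (genericSquare a) x p ↔ x ∈ p.1.C a := by
  constructor
  · intro h
    obtain ⟨r, -, hrp, b, -, ⟨hba, hbx⟩, hrb⟩ := h p hp (F.le_refl p hp)
    rw [← (hF _ _ hrp).2 a ha, (hF _ _ hrb).2 a hba]
    exact hbx
  · exact fun h => ForcingNotion.mem_of_mem_name hp hp ⟨ha, h⟩ (F.le_refl p hp)

/-- The name of the `a`-th member of the generic square sequence, restricted to conditions. -/
def threadName (F : ForcingNotion (SquareCond K × Y)) (a : K) : SetName (SquareCond K × Y) K :=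
  {z | z.1 ∈ F.cond ∧ z ∈ genericSquare (Y := Y) a}

theorem threadName_mem_iff_genericSquare {a x : K} {p : SquareCond K × Y} :
    F.mem (threadName F a) x p ↔ F.mem (genericSquare a) x p :=
  ⟨fun h q hq hqp => let ⟨r, hr, hrq, b, hb, hbx, hrb⟩ := h q hq hqp
    ⟨r, hr, hrq, b, hb, hbx.2, hrb⟩,
  fun h q hq hqp => let ⟨r, hr, hrq, b, hb, hbx, hrb⟩ := h q hq hqp
    ⟨r, hr, hrq, b, hb, ⟨hb, hbx⟩, hrb⟩⟩

theorem threadName_mem_iff (hF : ∀ p q, F.le p q → p.1.le q.1) {a x : K}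
    {p : SquareCond K × Y} (hp : p ∈ F.cond) (ha : a ≤ p.1.top) :
    F.mem (threadName F a) x p ↔ x ∈ p.1.C a :=
  threadName_mem_iff_genericSquare.trans (genericSquare_mem_iff hF hp ha)

theorem threadForcing_mem_threadName {a : K} (ha : Order.IsSuccPrelimit a)
    (p : SquareCond K × Y) : (threadForcing F).mem (threadName F a) p :=
  fun q hq _ => ⟨q, hq, F.le_refl q hq, ⟨a, ha⟩, fun _ =>
    ⟨fun _ _ _ h => threadName_mem_iff_genericSquare.1 h,
      fun _ _ _ h => threadName_mem_iff_genericSquare.2 h⟩⟩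

theorem mk_threadName_mem {a : K} (ha : Order.IsSuccPrelimit a)
    {p : SquareCond K × Y} (hp : p ∈ F.cond) :
    (p, threadName F a) ∈ (twoStep F (threadForcing F)).cond :=
  ⟨hp, fun _ hz => hz.1, threadForcing_mem_threadName ha p⟩

theorem threadForcing_mem_mono {t : SetName (SquareCond K × Y) K} {p q : SquareCond K × Y}
    (hp : p ∈ F.cond) (hq : q ∈ F.cond) (h : F.le q p) (ht : (threadForcing F).mem t p) :
    (threadForcing F).mem t q :=
  fun r hr hrq => ht r hr (F.le_trans r hr q hq p hp hrq h)

theorem twoStep_mk_mem {t : SetName (SquareCond K × Y) K} {p q : SquareCond K × Y}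
    (hpt : (p, t) ∈ (twoStep F (threadForcing F)).cond) (hq : q ∈ F.cond) (h : F.le q p) :
    (q, t) ∈ (twoStep F (threadForcing F)).cond ∧
      (twoStep F (threadForcing F)).le (q, t) (p, t) :=
  ⟨⟨hq, hpt.2.1, threadForcing_mem_mono hpt.1 hq h hpt.2.2⟩, h, NamedForcing.le_refl _ _ _⟩

theorem mem_empty_name {x : K} {p : SquareCond K × Y} (hp : p ∈ F.cond) :
    ¬ F.mem (∅ : SetName (SquareCond K × Y) K) x p := fun h =>
  let ⟨_, _, _, _, _, ha, _⟩ := h p hp (F.le_refl p hp)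
  ha

theorem endExtName_empty (c : SetName (SquareCond K × Y) K) (p : SquareCond K × Y) :
    F.endExtName c ∅ p :=
  ⟨fun _ _ hq _ h => (mem_empty_name hq h).elim,
    fun _ _ _ _ hq _ h => (mem_empty_name hq h.2).elim⟩

variable [WellFoundedLT K]

/-- The empty name denotes the club at the least element of `K`, which is vacuously a limit and has
nothing below it. -/
theorem mk_empty_mem (hF : ∀ p q, F.le p q → p.1.le q.1) {p : SquareCond K × Y}
    (hp : p ∈ F.cond) : (p, ∅) ∈ (twoStep F (threadForcing F)).cond := by
  refine ⟨hp, fun z hz => hz.elim, ?_⟩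
  obtain ⟨m, hm⟩ : ∃ m : K, ∀ b, m ≤ b :=
    ⟨wellFounded_lt.min Set.univ ⟨p.1.top, trivial⟩, fun b =>
      not_lt.1 (wellFounded_lt.not_lt_min (s := Set.univ) trivial)⟩
  have hlim : Order.IsSuccPrelimit m := fun b hb => absurd hb.lt (not_lt.2 (hm b))
  intro q hq _
  refine ⟨q, hq, F.le_refl q hq, ⟨m, hlim⟩, fun x => ⟨fun r hr _ h => (mem_empty_name hr h).elim,
    fun r hr _ h => ?_⟩⟩
  have h1 := (genericSquare_mem_iff hF hr (hm _)).1 h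
  exact absurd ((r.1.club m (hm _)).1 h1) (not_lt.2 (hm x))

theorem twoStepName_mem_iff (hF : ∀ p q, F.le p q → p.1.le q.1)
    {A : SetName (SquareCond K × Y) K} {x : K} {p : SquareCond K × Y}
    {t : SetName (SquareCond K × Y) K} (hpt : (p, t) ∈ (twoStep F (threadForcing F)).cond) :
    (twoStep F (threadForcing F)).mem (twoStepName A) x (p, t) ↔ F.mem A x p := by
  constructor
  · intro h q hq hqp
    obtain ⟨h1, h2⟩ := twoStep_mk_mem hpt hq hqp
    obtain ⟨⟨r, s⟩, hr, hrq, ⟨a, t'⟩, ha, hax, hra⟩ := h _ h1 h2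
    exact ⟨r, hr.1, hrq.1, a, ha.1, hax, hra.1⟩
  · rintro h ⟨q, s⟩ hqs hqp
    obtain ⟨r, hr, hrq, a, ha, hax, hra⟩ := h q hqs.1 hqp.1
    obtain ⟨h1, h2⟩ := twoStep_mk_mem hqs hr hrq
    exact ⟨(r, s), h1, h2, (a, ∅), mk_empty_mem hF ha, hax, hra, endExtName_empty _ _⟩

end Thread

/-! ### The stages of the iteration and the clubs that avoid their targets. -/

namespace Bookkeeping

variable {K L : Type u} [LinearOrder K] [LinearOrder L] [WellFoundedLT L] (B : Bookkeeping K L)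

/-- The forcing notion `S * R_α`. -/
def forcing (α : WithTop L) : ForcingNotion (RawCond K α) := (stage B α).P

/-- The name of the set killed at stage `α`. -/
def target (α : WithTop L) : SetName (RawCond K α) K := (stage B α).A

/-- The forcing notion `S * R_α * T`. -/
def threaded (α : WithTop L) : ForcingNotion (RawCond K α × SetName (RawCond K α) K) :=
  twoStep (B.forcing α) (threadForcing (B.forcing α))

open Classical in
theorem stage_eq (α : WithTop L) : stage B α =
    { P := iterate fun β _ => stage B β
      A := if (twoStep (iterate fun β (_ : β < α) => stage B β)
          (threadForcing (iterate fun β (_ : β < α) => stage B β))).Valid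
          ((twoStep (iterate fun β (_ : β < α) => stage B β)
            (threadForcing (iterate fun β (_ : β < α) => stage B β))).neg
            ((twoStep (iterate fun β (_ : β < α) => stage B β)
              (threadForcing (iterate fun β (_ : β < α) => stage B β))).stationaryName
                (twoStepName (proposedName B α fun β _ => stage B β))))
        then proposedName B α fun β _ => stage B β else ∅ } := by
  rw [stage, WellFounded.fix_eq]
  rfl

theorem forcing_eq (α : WithTop L) : B.forcing α = iterate fun β _ => stage B β := by
  rw [forcing, stage_eq]

/-- The name that is considered at stage `α`. -/
def candidate (α : WithTop L) : SetName (RawCond K α) K := proposedName B α fun β _ => stage B β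

open Classical in
theorem target_eq (α : WithTop L) : B.target α =
    if (B.threaded α).Valid ((B.threaded α).neg
        ((B.threaded α).stationaryName (twoStepName (B.candidate α))))
      then B.candidate α else ∅ := by
  rw [threaded, forcing_eq]
  exact congrArg Stage.A (stage_eq B α)

theorem mem_forcing {α : WithTop L} {c : RawCond K α} : c ∈ (B.forcing α).cond ↔
    #{β : Iio α | c.entry β.2 ≠ ∅} < #K ∧ ∀ β, ∀ h : β < α, c.res h ∈ (B.forcing β).cond ∧
      (B.forcing β).IsName (c.entry h) ∧
      (shootClub (B.forcing β) (B.target β)).mem (c.entry h) (c.res h) := by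
  rw [forcing_eq]
  rfl

theorem forcing_le {α : WithTop L} {c d : RawCond K α} : (B.forcing α).le c d ↔
    c.1.le d.1 ∧ ∀ β, ∀ h : β < α, (B.forcing β).le (c.res h) (d.res h) ∧
      (B.forcing β).endExtName (c.entry h) (d.entry h) (c.res h) := by
  rw [forcing_eq]
  rfl

/-- The order on the restrictions is given by the same clauses at smaller stages, so it need not be
checked separately. -/
theorem forcing_le_of {α : WithTop L} {c d : RawCond K α} (h₁ : c.1.le d.1)
    (h₂ : ∀ β, ∀ h : β < α, (B.forcing β).endExtName (c.entry h) (d.entry h) (c.res h)) :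
    (B.forcing α).le c d := by
  induction α using WellFoundedLT.induction with
  | ind α ih =>
    refine B.forcing_le.2 ⟨h₁, fun β h => ⟨ih β h h₁ fun γ hγ => ?_, h₂ β h⟩⟩
    simpa using h₂ γ (hγ.trans h)

theorem forcing_le_fst {α : WithTop L} (c d : RawCond K α) (h : (B.forcing α).le c d) :
    c.1.le d.1 := (B.forcing_le.1 h).1

theorem res_mem {α β : WithTop L} (h : β < α) {c : RawCond K α} (hc : c ∈ (B.forcing α).cond) :
    c.res h ∈ (B.forcing β).cond := ((B.mem_forcing.1 hc).2 β h).1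

theorem res_le {α β : WithTop L} (h : β < α) {c d : RawCond K α} (hc : (B.forcing α).le c d) :
    (B.forcing β).le (c.res h) (d.res h) := ((B.forcing_le.1 hc).2 β h).1

variable [UncountableRegularOrder K]

/-- The target is either a set that every condition of `S * R_α * T` forces to be non-stationary, or
empty. Having a club name in both cases avoids all later case distinctions. -/
theorem exists_targetClub (α : WithTop L) :
    ∃ E, (B.threaded α).AvoidingClub (twoStepName (B.target α)) E := by
  rw [target_eq]
  split_ifs with h
  · exact ForcingNotion.exists_avoidingClub h
  · have h0 : (twoStepName ∅ : SetName (RawCond K α × SetName (RawCond K α) K) K) = ∅ := rfl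
    rw [h0]
    exact ⟨_, ForcingNotion.avoidingClub_empty⟩

/-- A name for a club of the extension by `S * R_α * T`, disjoint from the set killed at
stage `α`. -/
def targetClub (α : WithTop L) : SetName (RawCond K α × SetName (RawCond K α) K) K :=
  (B.exists_targetClub α).choose

theorem targetClub_spec (α : WithTop L) :
    (B.threaded α).AvoidingClub (twoStepName (B.target α)) (B.targetClub α) :=
  (B.exists_targetClub α).choose_spec

theorem mem_twoStepName {α : WithTop L} {A : SetName (RawCond K α) K} {x : K}
    {z : RawCond K α × SetName (RawCond K α) K} (hz : z ∈ (B.threaded α).cond) :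
    (B.threaded α).mem (twoStepName A) x z ↔ (B.forcing α).mem A x z.1 :=
  twoStepName_mem_iff B.forcing_le_fst hz

/-- Membership in the target does not involve `T`: an extension `q` of `p` forcing `x` into it could
be paired with the same `t`, contradicting disjointness. -/
theorem not_mem_target {α : WithTop L} {x : K} {p q : RawCond K α} {t : SetName (RawCond K α) K}
    (hz : (p, t) ∈ (B.threaded α).cond) (hx : (B.threaded α).mem (B.targetClub α) x (p, t))
    (hq : q ∈ (B.forcing α).cond) (hqp : (B.forcing α).le q p) :
    ¬ (B.forcing α).mem (B.target α) x q := by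
  intro h
  obtain ⟨h1, h2⟩ := twoStep_mk_mem hz hq hqp
  exact (B.targetClub_spec α).disjoint _ h1 x (ForcingNotion.mem_mono hz h1 h2 hx)
    ((B.mem_twoStepName h1).2 h)

end Bookkeeping

/-! ### Flat conditions, and the sound and tight ones among them. -/

/-- A condition of `S`, together with a set for every stage of the iteration. -/
@[ext] structure FlatCond (K J : Type u) [LinearOrder K] where
  sq : SquareCond K
  val : J → Set K

namespace FlatCond

variable {K J : Type u} [LinearOrder K]

/-- The last club of the square sequence. -/
def thread (d : FlatCond K J) : Set K := d.sq.C d.sq.top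

/-- `d` end-extends `e` at every stage below `α`. -/
structure leBelow [LT J] (α : J) (d e : FlatCond K J) : Prop where
  sq : d.sq.le e.sq
  thread : EndExt d.thread e.thread
  val : ∀ β < α, EndExt (d.val β) (e.val β)

/-- `d` end-extends `e`. -/
structure le (d e : FlatCond K J) : Prop where
  sq : d.sq.le e.sq
  thread : EndExt d.thread e.thread
  val : ∀ β, EndExt (d.val β) (e.val β)

theorem le.refl (d : FlatCond K J) : d.le d :=
  ⟨d.sq.le_refl, EndExt.refl _, fun _ => EndExt.refl _⟩

theorem le.trans {d e f : FlatCond K J} (h₁ : d.le e) (h₂ : e.le f) : d.le f :=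
  ⟨SquareCond.le_trans h₁.sq h₂.sq, h₁.thread.trans h₂.thread, fun β => (h₁.val β).trans (h₂.val β)⟩

theorem le.below [LT J] {d e : FlatCond K J} (h : d.le e) (α : J) : d.leBelow α e :=
  ⟨h.sq, h.thread, fun β _ => h.val β⟩

/-- The stages at which `d` is nontrivial are below `α`. -/
def SuppBelow [LE J] (d : FlatCond K J) (α : J) : Prop := ∀ β, α ≤ β → d.val β = ∅

theorem leBelow.le [LinearOrder J] {α : J} {d e : FlatCond K J} (h : d.leBelow α e)
    (he : e.SuppBelow α) : d.le e := by
  refine ⟨h.sq, h.thread, fun β => ?_⟩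
  rcases lt_or_ge β α with hβ | hβ
  · exact h.val β hβ
  · rw [he β hβ]
    exact EndExt.empty _

/-- The condition that is `e` below `α`, and `d` from `α` on. -/
def glue [LinearOrder J] (α : J) (e d : FlatCond K J) : FlatCond K J :=
  ⟨e.sq, fun β => if β < α then e.val β else d.val β⟩

/-- The restriction to the stages below `α`. -/
def restrict [LinearOrder J] (α : J) (d : FlatCond K J) : FlatCond K J :=
  ⟨d.sq, fun β => if β < α then d.val β else ∅⟩

section Glue

variable [LinearOrder J] {α β : J} {d e : FlatCond K J}

theorem glue_val_of_lt (h : β < α) : (glue α e d).val β = e.val β := if_pos h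

theorem glue_val_of_ge (h : α ≤ β) : (glue α e d).val β = d.val β := if_neg (not_lt.2 h)

theorem restrict_val_of_lt (h : β < α) : (restrict α d).val β = d.val β := if_pos h

theorem restrict_val_of_ge (h : α ≤ β) : (restrict α d).val β = ∅ := if_neg (not_lt.2 h)

theorem restrict_suppBelow : (restrict α d).SuppBelow α := fun _ h => restrict_val_of_ge h

theorem glue_le (h : e.leBelow α d) : (glue α e d).le d := by
  refine ⟨h.sq, h.thread, fun β => ?_⟩
  rcases lt_or_ge β α with hβ | hβ
  · rw [glue_val_of_lt hβ]
    exact h.val β hβ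
  · rw [glue_val_of_ge hβ]
    exact EndExt.refl _

theorem glue_le_of_suppBelow (he : e.SuppBelow α) : (glue α e d).le e := by
  refine leBelow.le ⟨e.sq.le_refl, EndExt.refl _, fun β hβ => ?_⟩ he
  rw [glue_val_of_lt hβ]
  exact EndExt.refl _

theorem le_restrict : d.le (restrict α d) := by
  refine leBelow.le (α := α) ⟨d.sq.le_refl, EndExt.refl _, fun β hβ => ?_⟩ restrict_suppBelow
  rw [restrict_val_of_lt hβ]
  exact EndExt.refl _

end Glue

theorem mk_supp_glue_lt [LinearOrder J] [UncountableRegularOrder K] {e d : FlatCond K J} (α : J) (he : #{β | e.val β ≠ ∅} < #K) (hd : #{β | d.val β ≠ ∅} < #K) :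
    #{β | (glue α e d).val β ≠ ∅} < #K := by
  have h : {β | (glue α e d).val β ≠ ∅} ⊆
      {β | e.val β ≠ ∅} ∪ {β | d.val β ≠ ∅} := by
    intro β hβ
    rcases lt_or_ge β α with h | h
    · left
      simpa [glue_val_of_lt h] using hβ
    · right
      simpa [glue_val_of_ge h] using hβ
  exact (mk_le_mk_of_subset h).trans_lt ((mk_union_le _ _).trans_lt
    (add_lt_of_lt UncountableRegularOrder.regular.aleph0_le he hd))

end FlatCond

namespace Bookkeeping

variable {K L : Type u} [LinearOrder K] [LinearOrder L] [WellFoundedLT L] (B : Bookkeeping K L)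

/-- The canonical name of a set of the ground model. -/
def check (α : WithTop L) (c : Set K) : SetName (RawCond K α) K :=
  {z | z.1 ∈ (B.forcing α).cond ∧ z.2 ∈ c}

/-- The condition of `S * R_α` with the given entries. -/
def real (α : WithTop L) (d : FlatCond K (WithTop L)) : RawCond K α :=
  (d.sq, (rawEquiv α).symm fun β => B.check β.1 (d.val β.1))

/-- The condition of `S * R_α * T` with the given entries, and the last club of the square
sequence as its last component. -/
def star (α : WithTop L) (d : FlatCond K (WithTop L)) :
    RawCond K α × SetName (RawCond K α) K :=
  (B.real α d, threadName (B.forcing α) d.sq.top)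

@[simp] theorem real_fst (α : WithTop L) (d : FlatCond K (WithTop L)) :
    (B.real α d).1 = d.sq := rfl

@[simp] theorem real_entry {α β : WithTop L} (h : β < α) (d : FlatCond K (WithTop L)) :
    (B.real α d).entry h = B.check β (d.val β) := by
  simp [RawCond.entry, real]

@[simp] theorem real_res {α β : WithTop L} (h : β < α) (d : FlatCond K (WithTop L)) :
    (B.real α d).res h = B.real β d := by
  simp [RawCond.res, real]

theorem mem_check {α : WithTop L} {c : Set K} {x : K} {p : RawCond K α}
    (hp : p ∈ (B.forcing α).cond) : (B.forcing α).mem (B.check α c) x p ↔ x ∈ c :=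
  ⟨fun h => let ⟨_, _, _, _, _, h, _⟩ := h p hp ((B.forcing α).le_refl p hp); h.2,
    fun h => ForcingNotion.mem_of_mem_name hp hp ⟨hp, h⟩ ((B.forcing α).le_refl p hp)⟩

theorem endExtName_check {α : WithTop L} {c d : Set K} (h : EndExt c d) (p : RawCond K α) :
    (B.forcing α).endExtName (B.check α c) (B.check α d) p :=
  ⟨fun _ _ hq _ hx => (B.mem_check hq).2 (h.1 ((B.mem_check hq).1 hx)),
    fun _ _ hxy _ hq _ hx => (B.mem_check hq).2
      (h.2 _ _ hxy ((B.mem_check hq).1 hx.1) ((B.mem_check hq).1 hx.2))⟩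

theorem endExt_of_endExtName_check {α : WithTop L} {c d : Set K} {p : RawCond K α}
    (hp : p ∈ (B.forcing α).cond)
    (h : (B.forcing α).endExtName (B.check α c) (B.check α d) p) : EndExt c d :=
  ⟨fun x hx => (B.mem_check hp).1
      (h.1 x p hp ((B.forcing α).le_refl p hp) ((B.mem_check hp).2 hx)),
    fun x y hxy hx hy => (B.mem_check hp).1 (h.2 x y hxy p hp ((B.forcing α).le_refl p hp)
      ⟨(B.mem_check hp).2 hx, (B.mem_check hp).2 hy⟩)⟩

theorem real_congr {α : WithTop L} {d e : FlatCond K (WithTop L)} (hsq : d.sq = e.sq)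
    (h : ∀ β < α, d.val β = e.val β) : B.real α d = B.real α e := by
  simp only [real, hsq]
  congr 2
  funext β
  rw [h β.1 β.2]

theorem star_congr {α : WithTop L} {d e : FlatCond K (WithTop L)} (hsq : d.sq = e.sq)
    (h : ∀ β < α, d.val β = e.val β) : B.star α d = B.star α e := by
  rw [star, star, B.real_congr hsq h, hsq]

theorem real_le {α : WithTop L} {d e : FlatCond K (WithTop L)} (hsq : d.sq.le e.sq)
    (h : ∀ β < α, EndExt (d.val β) (e.val β)) : (B.forcing α).le (B.real α d) (B.real α e) :=
  B.forcing_le_of hsq fun β hβ => by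
    simpa using B.endExtName_check (h β hβ) _

theorem endExtName_threadName {α : WithTop L} {p : RawCond K α} {a b : K} (ha : a ≤ p.1.top)
    (hb : b ≤ p.1.top) (h : EndExt (p.1.C a) (p.1.C b)) : (B.forcing α).endExtName
      (threadName (B.forcing α) a) (threadName (B.forcing α) b) p := by
  have key : ∀ q ∈ (B.forcing α).cond, (B.forcing α).le q p → ∀ c ≤ p.1.top, ∀ x,
      (B.forcing α).mem (threadName (B.forcing α) c) x q ↔ x ∈ p.1.C c := by
    intro q hq hqp c hc x
    have h1 := B.forcing_le_fst _ _ hqp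
    rw [threadName_mem_iff B.forcing_le_fst hq (hc.trans h1.1), h1.2 c hc]
  refine ⟨fun x q hq hqp hx => ?_, fun x y hxy q hq hqp hx => ?_⟩
  · rw [key q hq hqp _ ha]
    rw [key q hq hqp _ hb] at hx
    exact h.1 hx
  · rw [key q hq hqp _ hb]
    exact h.2 x y hxy ((key q hq hqp _ ha x).1 hx.1) ((key q hq hqp _ hb y).1 hx.2)

theorem star_le {α : WithTop L} {d e : FlatCond K (WithTop L)} (h : d.leBelow α e) :
    (B.threaded α).le (B.star α d) (B.star α e) := by
  refine ⟨B.real_le h.sq h.val, B.endExtName_threadName (p := B.real α d) le_rfl h.sq.1 ?_⟩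
  have h1 := h.thread
  rw [FlatCond.thread, FlatCond.thread, ← h.sq.2 _ le_rfl] at h1
  exact h1

theorem le_of_real_le {α : WithTop L} {d e : FlatCond K (WithTop L)}
    (hd : B.real α d ∈ (B.forcing α).cond) (h : (B.forcing α).le (B.real α d) (B.real α e)) :
    d.sq.le e.sq ∧ ∀ β < α, EndExt (d.val β) (e.val β) := by
  have h1 := B.forcing_le.1 h
  simp only [real_fst, real_entry, real_res] at h1
  exact ⟨h1.1, fun β hβ =>
    B.endExt_of_endExtName_check (by simpa using B.res_mem hβ hd) (h1.2 β hβ).2⟩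

theorem leBelow_of_star_le {α : WithTop L} {d e : FlatCond K (WithTop L)}
    (hd : B.real α d ∈ (B.forcing α).cond)
    (h : (B.threaded α).le (B.star α d) (B.star α e)) : d.leBelow α e := by
  have h1 := B.le_of_real_le hd h.1
  refine ⟨h1.1, ?_, h1.2⟩
  have key : ∀ c ≤ d.sq.top, ∀ x,
      (B.forcing α).mem (threadName (B.forcing α) c) x (B.real α d) ↔ x ∈ d.sq.C c :=
    fun c hc x => threadName_mem_iff B.forcing_le_fst hd hc
  have h2 : EndExt (d.sq.C d.sq.top) (d.sq.C e.sq.top) := by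
    refine ⟨fun x hx => ?_, fun x y hxy hx hy => ?_⟩
    · have := h.2.1 x _ hd ((B.forcing α).le_refl _ hd) ((key _ h1.1.1 x).2 hx)
      exact (key _ le_rfl x).1 this
    · have := h.2.2 x y hxy _ hd ((B.forcing α).le_refl _ hd)
        ⟨(key _ le_rfl x).2 hx, (key _ h1.1.1 y).2 hy⟩
      exact (key _ h1.1.1 x).1 this
  rw [h1.1.2 _ le_rfl] at h2
  exact h2

/-- `d`, as a condition of `S * R_β`, forces that `x` is not in the set killed at stage `β`. -/
def Avoids (β : WithTop L) (d : FlatCond K (WithTop L)) (x : K) : Prop :=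
  ∀ q ∈ (B.forcing β).cond, (B.forcing β).le q (B.real β d) →
    ¬ (B.forcing β).mem (B.target β) x q

theorem Avoids.mono {β : WithTop L} {d e : FlatCond K (WithTop L)} {x : K} (h : B.Avoids β e x)
    (hd : B.real β d ∈ (B.forcing β).cond) (he : B.real β e ∈ (B.forcing β).cond)
    (hde : (B.forcing β).le (B.real β d) (B.real β e)) : B.Avoids β d x :=
  fun q hq hqd => h q hq ((B.forcing β).le_trans _ hq _ hd _ he hqd hde)

/-- `d` represents a condition of the iteration, with a last club that is a condition of `T`. -/
structure Sound (d : FlatCond K (WithTop L)) : Prop where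
  limit : Order.IsSuccPrelimit d.sq.top
  small : #{β | d.val β ≠ ∅} < #K
  closed : ∀ β, accPoints (d.val β) ⊆ d.val β
  bounded : ∀ β, ∃ b, d.val β ⊆ Iic b
  avoids : ∀ β, ∀ x ∈ d.val β, B.Avoids β d x

/-- Avoidance at stage `β` is only required once the restriction to `β` is known to be a condition.
The induction supplies this, and later constructions need it in order to verify avoidance at all. -/
theorem real_mem_of {α : WithTop L} {d : FlatCond K (WithTop L)}
    (small : #{β | d.val β ≠ ∅} < #K) (closed : ∀ β, accPoints (d.val β) ⊆ d.val β)
    (bounded : ∀ β, ∃ b, d.val β ⊆ Iic b)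
    (avoids : ∀ β, B.real β d ∈ (B.forcing β).cond → ∀ x ∈ d.val β, B.Avoids β d x) :
    B.real α d ∈ (B.forcing α).cond := by
  induction α using WellFoundedLT.induction with
  | ind α ih =>
    refine B.mem_forcing.2 ⟨?_, fun β h => ?_⟩
    · refine lt_of_le_of_lt (mk_le_of_injective
        (f := fun β : {β : Iio α | (B.real α d).entry β.2 ≠ ∅} =>
          (⟨β.1.1, fun h0 => β.2 ((B.real_entry β.1.2 d).trans (by simp [h0, check]))⟩ : {β | d.val β ≠ ∅})) ?_) small
      intro β γ hβγ
      have h := congrArg Subtype.val hβγ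
      exact Subtype.ext (Subtype.ext h)
    · rw [real_res, real_entry]
      have hβ := ih β h
      refine ⟨hβ, fun z hz => hz.1, ⟨fun a q hq _ hacc => ?_, fun q hq _ => ?_,
        fun x q hq hqd hx => ?_⟩⟩
      · refine (B.mem_check hq).2 (closed β ⟨hacc.1, fun b hb => ?_⟩)
        obtain ⟨r, hr, -, x, hx⟩ := hacc.2 b hb q hq ((B.forcing β).le_refl q hq)
        exact ⟨x.1, (B.mem_check hr).1 hx, x.2⟩
      · obtain ⟨b, hb⟩ := bounded β
        refine ⟨q, hq, (B.forcing β).le_refl q hq, b, fun x hx r hr _ hm => ?_⟩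
        exact absurd (hb ((B.mem_check hr).1 hm)) (not_le.2 hx)
      · exact avoids β hβ x ((B.mem_check hq).1 hx.1) q hq hqd hx.2

theorem Sound.of {d : FlatCond K (WithTop L)} (limit : Order.IsSuccPrelimit d.sq.top)
    (small : #{β | d.val β ≠ ∅} < #K) (closed : ∀ β, accPoints (d.val β) ⊆ d.val β)
    (bounded : ∀ β, ∃ b, d.val β ⊆ Iic b)
    (avoids : ∀ β, B.real β d ∈ (B.forcing β).cond → ∀ x ∈ d.val β, B.Avoids β d x) :
    B.Sound d :=
  ⟨limit, small, closed, bounded,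
    fun β => avoids β (B.real_mem_of small closed bounded avoids)⟩

variable {B}

theorem Sound.real_mem {d : FlatCond K (WithTop L)} (hd : B.Sound d) (α : WithTop L) :
    B.real α d ∈ (B.forcing α).cond :=
  B.real_mem_of hd.small hd.closed hd.bounded fun β _ => hd.avoids β

theorem Sound.star_mem {d : FlatCond K (WithTop L)} (hd : B.Sound d) (α : WithTop L) :
    B.star α d ∈ (B.threaded α).cond := mk_threadName_mem hd.limit (hd.real_mem α)

/-- The entries of `d` from `α` on survive a strengthening below `α`, because being forced to avoid
the target passes to stronger conditions. Entries that are proper names play no role here. -/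
theorem Sound.glue [UncountableRegularOrder K] {α : WithTop L} {e d : FlatCond K (WithTop L)}
    (he : B.Sound e) (hd : B.Sound d) (h : e.leBelow α d) : B.Sound (FlatCond.glue α e d) := by
  refine Sound.of B he.limit (FlatCond.mk_supp_glue_lt α he.small hd.small) ?_ ?_ ?_
  · intro β
    rcases lt_or_ge β α with hβ | hβ
    · rw [FlatCond.glue_val_of_lt hβ]
      exact he.closed β
    · rw [FlatCond.glue_val_of_ge hβ]
      exact hd.closed β
  · intro β
    rcases lt_or_ge β α with hβ | hβ
    · rw [FlatCond.glue_val_of_lt hβ]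
      exact he.bounded β
    · rw [FlatCond.glue_val_of_ge hβ]
      exact hd.bounded β
  · intro β hmem x hx
    rcases lt_or_ge β α with hβ | hβ
    · rw [FlatCond.glue_val_of_lt hβ] at hx
      refine Avoids.mono B (he.avoids β x hx) hmem (he.real_mem β) (B.real_le
        e.sq.le_refl fun γ hγ => ?_)
      rw [FlatCond.glue_val_of_lt (hγ.trans hβ)]
      exact EndExt.refl _
    · rw [FlatCond.glue_val_of_ge hβ] at hx
      refine Avoids.mono B (hd.avoids β x hx) hmem (hd.real_mem β) (B.real_le h.sq fun γ _ => ?_)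
      exact (FlatCond.glue_le h).val γ

/-- A sound condition can be made arbitrarily long. -/
theorem Sound.exists_raise [UncountableRegularOrder K] {d : FlatCond K (WithTop L)}
    (hd : B.Sound d) (x : K) : ∃ e, B.Sound e ∧ e.le d ∧ x < e.sq.top ∧ d.sq.top < e.sq.top ∧
      e.val = d.val := by
  obtain ⟨t, ht, hx, htop, hlim, hext⟩ := d.sq.exists_extension d.sq.top le_rfl x
  refine ⟨⟨t, d.val⟩, Sound.of B hlim hd.small hd.closed hd.bounded fun β hβ y hy => ?_,
    ⟨ht, hext, fun _ => EndExt.refl _⟩, hx, htop, rfl⟩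
  exact Avoids.mono B (hd.avoids β y hy) hβ (hd.real_mem β)
    (B.real_le ht fun _ _ => EndExt.refl _)

variable [UncountableRegularOrder K]

variable (B) in
/-- The last element of every nonempty entry of `d` is the length of the square sequence, and it is
forced to belong to the club that avoids the set killed at that stage. -/
structure Tight (d : FlatCond K (WithTop L)) : Prop extends B.Sound d where
  le_top : ∀ β, d.val β ⊆ Iic d.sq.top
  top_mem : ∀ β, (d.val β).Nonempty → d.sq.top ∈ d.val β
  club : ∀ β, (d.val β).Nonempty →
    (B.threaded β).mem (B.targetClub β) d.sq.top (B.star β d)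

theorem Tight.congr_club {d e : FlatCond K (WithTop L)} {α : WithTop L} (hsq : d.sq = e.sq)
    (h : ∀ β < α, d.val β = e.val β) (he : (B.threaded α).mem (B.targetClub α) e.sq.top (B.star α e)) :
    (B.threaded α).mem (B.targetClub α) d.sq.top (B.star α d) := by
  rw [B.star_congr hsq h, hsq]
  exact he

theorem Tight.restrict {d : FlatCond K (WithTop L)} (hd : B.Tight d) (α : WithTop L) :
    B.Tight (d.restrict α) := by
  have hv : ∀ β, (d.restrict α).val β ⊆ d.val β := fun β => (FlatCond.le_restrict.val β).1
  have hlt : ∀ β, ((d.restrict α).val β).Nonempty → β < α := fun β h => by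
    by_contra! hβ
    rw [FlatCond.restrict_val_of_ge hβ] at h
    exact not_nonempty_empty h
  have hc : ∀ β, (d.restrict α).val β = d.val β ∨ (d.restrict α).val β = ∅ := fun β =>
    (lt_or_ge β α).imp FlatCond.restrict_val_of_lt FlatCond.restrict_val_of_ge
  refine { toSound := ⟨hd.limit, ?_, ?_, ?_, ?_⟩, le_top := ?_, top_mem := ?_, club := ?_ }
  · refine (mk_le_mk_of_subset ?_).trans_lt hd.small
    intro β hβ h0
    exact hβ (subset_empty_iff.1 (h0 ▸ hv β))
  · intro β
    rcases hc β with h | h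
    · rw [h]
      exact hd.closed β
    · rw [h]
      rintro a ⟨ha, hacc⟩
      obtain ⟨b, hb⟩ := not_isMin_iff.1 ha
      obtain ⟨x, hx, -⟩ := hacc b hb
      exact hx.elim
  · intro β
    obtain ⟨b, hb⟩ := hd.bounded β
    exact ⟨b, (hv β).trans hb⟩
  · intro β x hx
    have h1 : B.real β (d.restrict α) = B.real β d :=
      B.real_congr rfl fun γ hγ => FlatCond.restrict_val_of_lt (hγ.trans (hlt β ⟨x, hx⟩))
    have h2 := hd.avoids β x (hv β hx)
    rw [Avoids] at h2 ⊢
    rwa [h1]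
  · exact fun β => (hv β).trans (hd.le_top β)
  · intro β h
    rw [FlatCond.restrict_val_of_lt (hlt β h)]
    rw [FlatCond.restrict_val_of_lt (hlt β h)] at h
    exact hd.top_mem β h
  · intro β h
    have h' := h
    rw [FlatCond.restrict_val_of_lt (hlt β h')] at h
    exact Tight.congr_club (e := d) rfl
      (fun γ hγ => FlatCond.restrict_val_of_lt (hγ.trans (hlt β h'))) (hd.club β h)

/-- Unlike for soundness, the square sequences have to agree: the entries of both parts must end at
the same length. -/
theorem Tight.glue {α : WithTop L} {e d : FlatCond K (WithTop L)}
    (he : B.Tight e) (hd : B.Tight d) (h : e.leBelow α d) (hsq : e.sq = d.sq) :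
    B.Tight (FlatCond.glue α e d) := by
  have hs := he.toSound.glue hd.toSound h
  refine { toSound := hs, le_top := ?_, top_mem := ?_, club := ?_ }
  · intro β
    rcases lt_or_ge β α with hβ | hβ
    · rw [FlatCond.glue_val_of_lt hβ]
      exact he.le_top β
    · rw [FlatCond.glue_val_of_ge hβ]
      exact (hd.le_top β).trans (by rw [← hsq]; exact Subset.rfl)
  · intro β
    rcases lt_or_ge β α with hβ | hβ
    · rw [FlatCond.glue_val_of_lt hβ]
      exact he.top_mem β
    · rw [FlatCond.glue_val_of_ge hβ]
      intro hn
      show e.sq.top ∈ _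
      rw [hsq]
      exact hd.top_mem β hn
  · intro β hn
    rcases lt_or_ge β α with hβ | hβ
    · rw [FlatCond.glue_val_of_lt hβ] at hn
      exact Tight.congr_club (e := e) rfl
        (fun γ hγ => FlatCond.glue_val_of_lt (hγ.trans hβ)) (he.club β hn)
    · rw [FlatCond.glue_val_of_ge hβ] at hn
      have h1 := ForcingNotion.mem_mono (hd.star_mem β) (hs.star_mem β)
        (B.star_le ((FlatCond.glue_le h).below β)) (hd.club β hn)
      show (B.threaded β).mem (B.targetClub β) e.sq.top _
      rw [hsq]
      exact h1

end Bookkeeping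

/-! ### Limits of chains of tight conditions. -/

namespace FlatCond

variable {K J : Type u} [LinearOrder K]

/-- `d` end-extends `e`, and its square sequence is strictly longer. -/
def lt (d e : FlatCond K J) : Prop := d.le e ∧ e.sq.top < d.sq.top

theorem lt.trans {d e f : FlatCond K J} (h₁ : d.lt e) (h₂ : e.lt f) : d.lt f :=
  ⟨h₁.1.trans h₂.1, h₂.2.trans h₁.2⟩

/-- A linearly ordered set of conditions without a strongest element has a limit, as far as the
square sequences are concerned. -/
theorem exists_limit_sq [UncountableRegularOrder K] {C : Set (FlatCond K J)}
    (hC : #C < #K) (chain : ∀ d ∈ C, ∀ e ∈ C, d = e ∨ d.lt e ∨ e.lt d)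
    (hmax : ∀ d ∈ C, ∃ e ∈ C, e.lt d) :
    ∃ s : SquareCond K, Order.IsSuccPrelimit s.top ∧ (∀ b < s.top, ∃ d ∈ C, b < d.sq.top) ∧
      ∀ d ∈ C, d.sq.top < s.top ∧ s.le d.sq ∧ EndExt (s.C s.top) d.thread := by
  classical
  obtain ⟨γ, hγ, hlt, hub⟩ := UncountableRegularOrder.exists_limit_lub
    ((fun d : FlatCond K J => d.sq.top) '' C) (mk_image_le.trans_lt hC) (by
      rintro _ ⟨d, hd, rfl⟩
      obtain ⟨e, he, h⟩ := hmax d hd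
      exact ⟨_, ⟨e, he, rfl⟩, h.2⟩)
  replace hub : ∀ b < γ, ∃ d ∈ C, b < d.sq.top := fun b hb => by
    obtain ⟨_, ⟨d, hd, rfl⟩, h⟩ := hub b hb
    exact ⟨d, hd, h⟩
  replace hlt : ∀ d ∈ C, d.sq.top < γ := fun d hd => hlt _ ⟨d, hd, rfl⟩
  have coh : ∀ d ∈ C, ∀ e ∈ C, ∀ a, a ≤ d.sq.top → a ≤ e.sq.top → d.sq.C a = e.sq.C a := by
    intro d hd e he a had hae
    rcases chain d hd e he with rfl | h | h
    · rfl
    · exact h.1.sq.2 a hae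
    · exact (h.1.sq.2 a had).symm
  -- The last clubs end-extend each other along the chain. Below the length of each `d` the union
  -- agrees with the last club of `d`, whence closure and coherence at the new level.
  let last : Set K := ⋃ d ∈ C, d.thread
  let f : K → Set K := fun a => if a = γ then last else {x | ∃ d ∈ C, a ≤ d.sq.top ∧ x ∈ d.sq.C a}
  have f1 : ∀ d ∈ C, ∀ a ≤ d.sq.top, f a = d.sq.C a := by
    intro d hd a ha
    have : a ≠ γ := (ha.trans_lt (hlt d hd)).ne
    simp only [f, this, if_false]
    ext x
    constructor
    · rintro ⟨e, he, hae, hx⟩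
      rwa [coh d hd e he a ha hae]
    · exact fun hx => ⟨d, hd, ha, hx⟩
  have f2 : f γ = last := if_pos rfl
  have thread_lt : ∀ d ∈ C, ∀ x ∈ d.thread, x < d.sq.top := fun d hd x hx =>
    (d.sq.club _ le_rfl).1 hx
  have ext : ∀ d ∈ C, EndExt last d.thread := by
    intro d hd
    refine ⟨fun x hx => mem_biUnion hd hx, fun x y hxy hx hy => ?_⟩
    obtain ⟨e, he, hxe⟩ := mem_iUnion₂.1 hx
    rcases chain d hd e he with rfl | h | h
    · exact hxe
    · exact h.1.thread.1 hxe
    · exact h.1.thread.2 x y hxy hxe hy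
  have last_inter : ∀ d ∈ C, ∀ x ∈ last, x < d.sq.top → x ∈ d.thread := by
    intro d hd x hx hxd
    obtain ⟨y, hy, hxy⟩ := (d.sq.club _ le_rfl).2.1 x hxd
    exact (ext d hd).2 x y hxy hx hy
  have last_lt : ∀ x ∈ last, x < γ := by
    intro x hx
    obtain ⟨e, he, hxe⟩ := mem_iUnion₂.1 hx
    exact (thread_lt e he x hxe).trans (hlt e he)
  refine ⟨⟨γ, f, ?_, ?_, ?_, ?_⟩, hγ, hub, fun d hd => ⟨hlt d hd, ⟨(hlt d hd).le, f1 d hd⟩, ?_⟩⟩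
  · intro a ha
    rcases ha.lt_or_eq with ha | rfl
    · obtain ⟨d, hd, had⟩ := hub a ha
      rw [f1 d hd a had.le]
      exact d.sq.club a had.le
    · rw [f2]
      refine ⟨last_lt, fun b hb => ?_, fun b hb hacc => ?_⟩
      · obtain ⟨d, hd, hbd⟩ := hub b hb
        obtain ⟨y, hy, hby⟩ := (d.sq.club _ le_rfl).2.1 b hbd
        exact ⟨y, (ext d hd).1 hy, hby⟩
      · obtain ⟨d, hd, hbd⟩ := hub b hb
        exact (ext d hd).1 ((d.sq.club _ le_rfl).2.2 b hbd
          (accPoints_mono_below hbd.le (last_inter d hd) hacc))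
  · intro a ha b hba
    rcases ha.lt_or_eq with ha | rfl
    · obtain ⟨d, hd, had⟩ := hub a ha
      rw [f1 d hd a had.le]
      exact d.sq.succ a had.le b hba
    · exact absurd hba (hγ b)
  · intro a ha b hb
    rcases ha.lt_or_eq with ha | rfl
    · obtain ⟨d, hd, had⟩ := hub a ha
      rw [f1 d hd a had.le] at hb ⊢
      have hba : b ≤ a := by
        by_contra! h
        exact not_mem_accPoints_of_forall_le h
          (fun y hy _ => ((d.sq.club a had.le).1 hy).le) hb
      rw [f1 d hd b (hba.trans had.le)]
      exact d.sq.coherent a had.le b hb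
    · rw [f2] at hb ⊢
      have hba : b ≤ a := by
        by_contra! h
        exact not_mem_accPoints_of_forall_le h (fun y hy _ => (last_lt y hy).le) hb
      rcases hba.lt_or_eq with hba | rfl
      · obtain ⟨d, hd, hbd⟩ := hub b hba
        rw [f1 d hd b hbd.le, ← d.sq.coherent _ le_rfl b
          (accPoints_mono_below hbd.le (last_inter d hd) hb)]
        ext x
        exact ⟨fun hx => ⟨last_inter d hd x hx.1 (lt_trans hx.2 hbd), hx.2⟩,
          fun hx => ⟨(ext d hd).1 hx.1, hx.2⟩⟩
      · rw [f2]
        exact inter_eq_left.2 last_lt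
  · intro a ha
    have : a ≠ γ := ne_of_gt ha
    simp only [f, this, if_false]
    refine eq_empty_of_forall_notMem ?_
    rintro x ⟨d, hd, had, -⟩
    exact absurd (had.trans_lt (hlt d hd)) (not_lt.2 (le_of_lt ha))
  · show EndExt (f γ) d.thread
    rw [f2]
    exact ext d hd

end FlatCond

namespace Bookkeeping

variable {K L : Type u} [LinearOrder K] [LinearOrder L] [WellFoundedLT L] {B : Bookkeeping K L}
  [UncountableRegularOrder K]

theorem avoids_of_club {β : WithTop L} {d : FlatCond K (WithTop L)} {x : K}
    (hd : B.star β d ∈ (B.threaded β).cond)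
    (hx : (B.threaded β).mem (B.targetClub β) x (B.star β d)) : B.Avoids β d x :=
  fun _ hq hqd => B.not_mem_target hd hx hq hqd

/-- Tight conditions are closed under limits of small length. -/
theorem exists_limit {C : Set (FlatCond K (WithTop L))} (hne : C.Nonempty) (hC : #C < #K)
    (tight : ∀ d ∈ C, B.Tight d) (chain : ∀ d ∈ C, ∀ e ∈ C, d = e ∨ d.lt e ∨ e.lt d)
    (hmax : ∀ d ∈ C, ∃ e ∈ C, e.lt d) :
    ∃ u, B.Tight u ∧ (∀ d ∈ C, u.lt d) ∧ (∀ β, (u.val β).Nonempty → ∃ d ∈ C, (d.val β).Nonempty) ∧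
      ∀ b < u.sq.top, ∃ d ∈ C, b < d.sq.top := by
  obtain ⟨s, hlim, hub, hs⟩ := FlatCond.exists_limit_sq hC chain hmax
  -- Unions along the chain, with the new length on top wherever some entry is nonempty.
  let v : WithTop L → Set K := fun β =>
    {x | (∃ d ∈ C, (d.val β).Nonempty) ∧ x = s.top} ∪ ⋃ d ∈ C, d.val β
  let u : FlatCond K (WithTop L) := ⟨s, v⟩
  have v_ne : ∀ β, (v β).Nonempty → ∃ d ∈ C, (d.val β).Nonempty := by
    rintro β ⟨x, h | h⟩
    · exact h.1
    · obtain ⟨d, hd, hx⟩ := mem_iUnion₂.1 h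
      exact ⟨d, hd, x, hx⟩
  have v_sub : ∀ β, ∀ d ∈ C, d.val β ⊆ v β := fun β d hd x hx => Or.inr (mem_biUnion hd hx)
  have v_le : ∀ β, v β ⊆ Iic s.top := by
    rintro β x (h | h)
    · exact h.2.le
    · obtain ⟨d, hd, hx⟩ := mem_iUnion₂.1 h
      exact ((tight d hd).le_top β hx).trans (hs d hd).1.le
  have hext : ∀ β, ∀ d ∈ C, EndExt (v β) (d.val β) := by
    intro β d hd
    refine ⟨v_sub β d hd, fun x y hxy hx hy => ?_⟩
    rcases hx with h | h
    · exact absurd (hxy.trans ((tight d hd).le_top β hy)) (by rw [h.2]; exact not_le.2 (hs d hd).1)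
    · obtain ⟨e, he, hx⟩ := mem_iUnion₂.1 h
      rcases chain d hd e he with rfl | h | h
      · exact hx
      · exact (h.1.val β).1 hx
      · exact (h.1.val β).2 x y hxy hx hy
  have hle : ∀ d ∈ C, u.le d := fun d hd => ⟨(hs d hd).2.1, (hs d hd).2.2, fun β => hext β d hd⟩
  -- A nonempty entry remains nonempty, so the lengths of conditions nontrivial at `β` are still
  -- cofinal in `s.top`.
  have late : ∀ β, (v β).Nonempty → ∀ b < s.top, ∃ d ∈ C, (d.val β).Nonempty ∧ b < d.sq.top := by
    intro β hβ b hb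
    obtain ⟨d, hd, hdβ⟩ := v_ne β hβ
    obtain ⟨e, he, hbe⟩ := hub b hb
    rcases chain d hd e he with rfl | h | h
    · exact ⟨d, hd, hdβ, hbe⟩
    · exact ⟨d, hd, hdβ, hbe.trans h.2⟩
    · exact ⟨e, he, hdβ.mono (h.1.val β).1, hbe⟩
  have top_mem : ∀ β, (v β).Nonempty → s.top ∈ v β := fun β h => Or.inl ⟨v_ne β h, rfl⟩
  -- Those lengths are forced into the avoiding club, and so is their limit by closedness. Only the
  -- restriction of `u` to `β` is assumed to be a condition, since this is used in proving `u`
  -- sound.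
  have club : ∀ β, (v β).Nonempty → B.real β u ∈ (B.forcing β).cond →
      (B.threaded β).mem (B.targetClub β) s.top (B.star β u) := by
    intro β hβ hu
    have hu' : B.star β u ∈ (B.threaded β).cond := mk_threadName_mem hlim hu
    have hmem : ∀ d ∈ C, (d.val β).Nonempty →
        (B.threaded β).mem (B.targetClub β) d.sq.top (B.star β u) := fun d hd h =>
      ForcingNotion.mem_mono ((tight d hd).star_mem β) hu' (B.star_le ((hle d hd).below β))
        ((tight d hd).club β h)
    refine (B.targetClub_spec β).closed _ hu' _ ⟨?_, fun b hb z hz hzu => ?_⟩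
    · obtain ⟨d, hd⟩ := hne
      exact not_isMin_iff.2 ⟨_, (hs d hd).1⟩
    · obtain ⟨d, hd, hdβ, hbd⟩ := late β hβ b hb
      exact ⟨z, hz, (B.threaded β).le_refl z hz, ⟨d.sq.top, hbd, (hs d hd).1⟩,
        ForcingNotion.mem_mono hu' hz hzu (hmem d hd hdβ)⟩
  have small : #{β | u.val β ≠ ∅} < #K := by
    have h1 : {β | u.val β ≠ ∅} ⊆ ⋃ d ∈ C, {β | d.val β ≠ ∅} := by
      intro β hβ
      obtain ⟨d, hd, hdβ⟩ := v_ne β (nonempty_iff_ne_empty.2 hβ)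
      exact mem_biUnion hd hdβ.ne_empty
    exact (mk_le_mk_of_subset h1).trans_lt ((card_biUnion_lt_iff_forall_of_isRegular
      UncountableRegularOrder.regular hC).2 fun d hd => (tight d hd).small)
  have closed : ∀ β, accPoints (v β) ⊆ v β := by
    intro β a ha
    have hβ : (v β).Nonempty := by
      obtain ⟨b, hb⟩ := not_isMin_iff.1 ha.1
      obtain ⟨x, hx, -⟩ := ha.2 b hb
      exact ⟨x, hx⟩
    rcases lt_trichotomy a s.top with h | rfl | h
    · obtain ⟨d, hd, hdβ, had⟩ := late β hβ a h
      exact v_sub β d hd ((tight d hd).closed β (accPoints_mono_below had.le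
        (fun x hx hxd => (hext β d hd).2 x _ hxd.le hx ((tight d hd).top_mem β hdβ)) ha))
    · exact top_mem β hβ
    · exact absurd ha (not_mem_accPoints_of_forall_le h fun x hx _ => v_le β hx)
  have avoids : ∀ β, B.real β u ∈ (B.forcing β).cond → ∀ x ∈ u.val β, B.Avoids β u x := by
    intro β hu x hx
    rcases hx with h | h
    · rw [h.2]
      exact avoids_of_club (mk_threadName_mem hlim hu) (club β ⟨x, Or.inl h⟩ hu)
    · obtain ⟨d, hd, hx⟩ := mem_iUnion₂.1 h
      exact Avoids.mono B ((tight d hd).avoids β x hx) hu ((tight d hd).real_mem β)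
        (B.real_le (hle d hd).sq fun γ _ => (hle d hd).val γ)
  have sound : B.Sound u := Sound.of B hlim small closed (fun β => ⟨_, v_le β⟩) avoids
  exact ⟨u, { toSound := sound, le_top := v_le, top_mem := top_mem,
              club := fun β hβ => club β hβ (sound.real_mem β) },
    fun d hd => ⟨hle d hd, (hs d hd).1⟩, v_ne, hub⟩

end Bookkeeping

/-! ### Deciding names and adding entries. -/

theorem exists_least (J : Type u) [LinearOrder J] [WellFoundedLT J] [Nonempty J] :
    ∃ m : J, ∀ b, m ≤ b :=
  ⟨wellFounded_lt.min Set.univ univ_nonempty, fun _ =>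
    not_lt.1 (wellFounded_lt.not_lt_min (s := Set.univ) trivial)⟩

theorem accPoints_union_singleton_subset {K : Type u} [LinearOrder K] {S : Set K} {t : K}
    (hS : accPoints S ⊆ S) (ht : ∀ x ∈ S, x < t) : accPoints (S ∪ {t}) ⊆ S ∪ {t} := by
  intro a ha
  rcases lt_trichotomy a t with h | rfl | h
  · exact Or.inl (hS (accPoints_mono_below h.le
      (fun x hx hxt => hx.resolve_right hxt.ne) ha))
  · exact Or.inr rfl
  · refine absurd ha (not_mem_accPoints_of_forall_le h fun x hx _ => ?_)
    rcases hx with hx | hx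
    · exact (ht x hx).le
    · exact (show x = t from hx).le

namespace Bookkeeping

variable {K L : Type u} [LinearOrder K] [LinearOrder L] [WellFoundedLT L] {B : Bookkeeping K L}
  [UncountableRegularOrder K]

variable (B) in
/-- Tight conditions with support below `α`. -/
def tightBelow (α : WithTop L) : Set (FlatCond K (WithTop L)) := {d | B.Tight d ∧ d.SuppBelow α}

variable (B) in
/-- The tight conditions are dense in `S * R_α * T`. -/
def DenseAt (α : WithTop L) : Prop :=
  ∀ z ∈ (B.threaded α).cond, ∃ d ∈ B.tightBelow α, (B.threaded α).le (B.star α d) z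

/-- Lengthening the square sequence may destroy tightness, as entries no longer end at the new
length. A second use of density restores it, and the sequence can only become longer. -/
theorem DenseAt.exists_long {α : WithTop L} (h : B.DenseAt α)
    {z : RawCond K α × SetName (RawCond K α) K} (hz : z ∈ (B.threaded α).cond) (x : K) :
    ∃ e ∈ B.tightBelow α, (B.threaded α).le (B.star α e) z ∧ x < e.sq.top := by
  obtain ⟨d, hd, hdz⟩ := h z hz
  obtain ⟨d', hd', hle, hx, -⟩ := hd.1.toSound.exists_raise x
  obtain ⟨e, he, hed⟩ := h _ (hd'.star_mem α)
  have h1 := B.star_le (hle.below α)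
  have hem := he.1.star_mem α
  exact ⟨e, he, (B.threaded α).le_trans _ hem _ (hd'.star_mem α) _ hz hed
    ((B.threaded α).le_trans _ (hd'.star_mem α) _ (hd.1.star_mem α) _ hz h1 hdz),
    hx.trans_le (B.leBelow_of_star_le (he.1.real_mem α) hed).sq.1⟩

theorem DenseAt.exists_lt {α : WithTop L} (h : B.DenseAt α) {d : FlatCond K (WithTop L)}
    (hd : d ∈ B.tightBelow α) {z : RawCond K α × SetName (RawCond K α) K}
    (hz : z ∈ (B.threaded α).cond) (hzd : (B.threaded α).le z (B.star α d)) (x : K) :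
    ∃ e ∈ B.tightBelow α, (B.threaded α).le (B.star α e) z ∧ e.lt d ∧ x < e.sq.top := by
  obtain ⟨e, he, hez, hx⟩ := h.exists_long hz (max x d.sq.top)
  exact ⟨e, he, hez, ⟨(B.leBelow_of_star_le (he.1.real_mem α) ((B.threaded α).le_trans _
    (he.1.star_mem α) _ hz _ (hd.1.star_mem α) hez hzd)).le hd.2,
    (le_max_right _ _).trans_lt hx⟩, (le_max_left _ _).trans_lt hx⟩

/-- Variant of `DenseAt.exists_lt` for conditions of `S * R_α`. -/
theorem DenseAt.exists_lt_real {α : WithTop L} (h : B.DenseAt α) {d : FlatCond K (WithTop L)}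
    (hd : d ∈ B.tightBelow α) {q : RawCond K α}
    (hq : q ∈ (B.forcing α).cond) (hqd : (B.forcing α).le q (B.real α d)) (x : K) :
    ∃ e ∈ B.tightBelow α, (B.forcing α).le (B.real α e) q ∧ e.lt d ∧ x < e.sq.top := by
  obtain ⟨h1, h2⟩ := twoStep_mk_mem (hd.1.star_mem α) hq hqd
  obtain ⟨e, he, hez, hlt, hx⟩ := h.exists_lt hd h1 h2 x
  exact ⟨e, he, hez.1, hlt, hx⟩

variable (B) in
/-- `d` decides whether `x` belongs to `c`. -/
def Decides (α : WithTop L) (c : SetName (RawCond K α) K) (x : K)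
    (d : FlatCond K (WithTop L)) : Prop :=
  (B.forcing α).mem c x (B.real α d) ∨
    ∀ q ∈ (B.forcing α).cond, (B.forcing α).le q (B.real α d) → ¬ (B.forcing α).mem c x q

theorem Decides.mono {α : WithTop L} {c : SetName (RawCond K α) K} {x : K}
    {d e : FlatCond K (WithTop L)} (hd : B.Tight d) (he : B.Tight e) (hed : e.le d)
    (h : B.Decides α c x d) : B.Decides α c x e := by
  have h1 : (B.forcing α).le (B.real α e) (B.real α d) := B.real_le hed.sq fun β _ => hed.val β
  refine h.imp (ForcingNotion.mem_mono (hd.real_mem α) (he.real_mem α) h1) fun h q hq hqe => ?_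
  exact h q hq ((B.forcing α).le_trans _ hq _ (he.real_mem α) _ (hd.real_mem α) hqe h1)

/-- The usual argument that a forcing closed under short limits adds no bounded subsets: the points
below `b` are decided one at a time, and limits of tight conditions inherit all earlier decisions.
-/
theorem DenseAt.exists_decides {α : WithTop L} (h : B.DenseAt α) (c : SetName (RawCond K α) K)
    (b : K) {d : FlatCond K (WithTop L)} (hd : d ∈ B.tightBelow α) :
    ∃ e ∈ B.tightBelow α, (e = d ∨ e.lt d) ∧ ∀ x < b, B.Decides α c x e := by
  obtain ⟨m, hm⟩ : ∃ m : K, ∀ b, m ≤ b := @exists_least K _ _ ⟨b⟩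
  obtain ⟨e, he, hG⟩ := exists_climb (I := Iic b) (UncountableRegularOrder.mk_Iic_lt b)
    (R := FlatCond.lt) (fun h1 h2 => h1.trans h2)
    (G := fun i d => d ∈ B.tightBelow α ∧ ∀ x < i, B.Decides α c x d) (hm b) (le_refl b)
    (fun i hi => hi) (i₀ := m) (d₀ := d) ⟨hd, fun x hx => absurd hx (not_lt.2 (hm x))⟩
    (by
      rintro i - j hj hij hcov d ⟨hd, hdec⟩
      obtain ⟨q, hq, hqd, hqx⟩ := (B.forcing α).exists_mem_or_not_mem c i (hd.1.real_mem α)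
      obtain ⟨e, he, heq, hlt, -⟩ := h.exists_lt_real hd hq hqd i
      refine ⟨e, hlt, he, fun x hx => ?_⟩
      rcases (hcov x (hx.le.trans hj) hx).lt_or_eq with hxi | rfl
      · exact (hdec x hxi).mono hd.1 he.1 hlt.1
      · refine hqx.imp (ForcingNotion.mem_mono hq (he.1.real_mem α) heq) fun h r hr hre => ?_
        exact h r hr ((B.forcing α).le_trans _ hr _ (he.1.real_mem α) _ hq hre heq))
    (by
      intro j hj C hne hC hG chain hmax hcof
      obtain ⟨u, hu, hlt, hval, -⟩ := exists_limit hne hC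
        (fun d hd => let ⟨_, _, _, h⟩ := hG d hd; h.1.1) chain hmax
      refine ⟨u, hlt, ⟨hu, fun β hβ => ?_⟩, fun x hx => ?_⟩
      · by_contra h
        obtain ⟨d, hd, hdβ⟩ := hval β (nonempty_iff_ne_empty.2 h)
        obtain ⟨_, _, _, hG⟩ := hG d hd
        exact hdβ.ne_empty (hG.1.2 β hβ)
      · obtain ⟨d, hd, i, -, hi, -, hG⟩ := hcof x (hx.le.trans hj) hx
        exact (hG.2 x hi).mono hG.1.1 hu (hlt d hd).1)
  exact ⟨e, hG.1, he, hG.2⟩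

/-- A name for a closed bounded set is decided by a tight condition. -/
theorem DenseAt.exists_check {α : WithTop L} (h : B.DenseAt α) {c : SetName (RawCond K α) K}
    {d : FlatCond K (WithTop L)} (hd : d ∈ B.tightBelow α)
    (hc : (shootClub (B.forcing α) (B.target α)).mem c (B.real α d)) :
    ∃ e ∈ B.tightBelow α, e.lt d ∧ ∃ S : Set K, accPoints S ⊆ S ∧ (∀ x ∈ S, x < e.sq.top) ∧
      (∀ x ∈ S, (B.forcing α).mem c x (B.real α e)) ∧
      ∀ x ∉ S, ∀ q ∈ (B.forcing α).cond, (B.forcing α).le q (B.real α e) →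
        ¬ (B.forcing α).mem c x q := by
  have hdm := hd.1.real_mem α
  obtain ⟨r, hr, hrd, b, hb⟩ := hc.2.1 _ hdm ((B.forcing α).le_refl _ hdm)
  -- Deciding the points below `b'` includes `b` itself; everything from `b'` on is excluded by the
  -- bound.
  obtain ⟨b', hb'⟩ := exists_gt b
  obtain ⟨e₀, he₀, he₀r, hlt₀, htop⟩ := h.exists_lt_real hd hr hrd b'
  obtain ⟨e, he, hle, hdec⟩ := h.exists_decides c b' he₀
  have hee₀ : e.le e₀ := by
    rcases hle with rfl | h
    · exact FlatCond.le.refl _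
    · exact h.1
  have hem := he.1.real_mem α
  have h1 : (B.forcing α).le (B.real α e) (B.real α e₀) := B.real_le hee₀.sq fun β _ => hee₀.val β
  have h2 := (B.forcing α).le_trans _ hem _ (he₀.1.real_mem α) _ hr h1 he₀r
  have h3 := (B.forcing α).le_trans _ hem _ hr _ hdm h2 hrd
  refine ⟨e, he, ⟨hee₀.trans hlt₀.1, hlt₀.2.trans_le hee₀.sq.1⟩,
    {x | (B.forcing α).mem c x (B.real α e)}, ?_, ?_, fun x hx => hx, ?_⟩
  · rintro a ⟨ha, hacc⟩
    refine hc.1 a _ hem h3 ⟨ha, fun y hy q hq hqe => ?_⟩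
    obtain ⟨x, hx, hyx, hxa⟩ := hacc y hy
    exact ⟨q, hq, (B.forcing α).le_refl q hq, ⟨x, hyx, hxa⟩, ForcingNotion.mem_mono hem hq hqe hx⟩
  · intro x hx
    by_contra! hlt
    exact hb x (hb'.trans ((htop.trans_le hee₀.sq.1).trans_le hlt)) _ hem h2 hx
  · intro x hx q hq hqe hm
    rcases lt_or_ge x b' with hxb | hxb
    · exact (hdec x hxb).resolve_left hx q hq hqe hm
    · exact hb x (hb'.trans_le hxb) q hq ((B.forcing α).le_trans _ hq _ hem _ hr hqe h2) hm

/-- There are tight conditions whose length is forced into the club. -/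
theorem DenseAt.exists_top_mem {α : WithTop L} (h : B.DenseAt α) {d : FlatCond K (WithTop L)}
    (hd : d ∈ B.tightBelow α) : ∃ e ∈ B.tightBelow α, e.lt d ∧
      (B.threaded α).mem (B.targetClub α) e.sq.top (B.star α e) := by
  -- Alternate between forcing a new point into the club and growing beyond it. After `ω` steps the
  -- length is a limit of points of the club; countable chains have limits because `#K` is
  -- uncountable.
  have step : ∀ d : B.tightBelow α, ∃ e : B.tightBelow α, e.1.lt d.1 ∧ ∃ x, d.1.sq.top < x ∧
      x < e.1.sq.top ∧ (B.threaded α).mem (B.targetClub α) x (B.star α e.1) := by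
    rintro ⟨d, hd⟩
    obtain ⟨z, hz, hzd, x, hx, hm⟩ :=
      (B.targetClub_spec α).unbounded _ (hd.1.star_mem α) d.sq.top
    obtain ⟨e, he, hez, hlt, hxe⟩ := h.exists_lt hd hz hzd x
    exact ⟨⟨e, he⟩, hlt, x, hx, hxe, ForcingNotion.mem_mono hz (he.1.star_mem α) hez hm⟩
  choose f hf x hx hxf hm using step
  let g : ℕ → B.tightBelow α := fun n => f^[n] ⟨d, hd⟩
  have hg : ∀ n, g (n + 1) = f (g n) := fun n => Function.iterate_succ_apply' _ _ _
  have hlt : ∀ m n, m < n → (g n).1.lt (g m).1 := by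
    intro m n hmn
    induction n, hmn using Nat.le_induction with
    | base => rw [hg]; exact hf _
    | succ n _ ih => rw [hg]; exact (hf _).trans ih
  let C : Set (FlatCond K (WithTop L)) := range fun n => (g n).1
  have hC : #C < #K := (le_aleph0_iff_set_countable.2 (countable_range _)).trans_lt
    UncountableRegularOrder.uncountable
  obtain ⟨u, hu, hul, hval, hub⟩ := exists_limit (B := B) (C := C) ⟨_, 0, rfl⟩ hC
    (by rintro _ ⟨n, rfl⟩; exact (g n).2.1)
    (by
      rintro _ ⟨m, rfl⟩ _ ⟨n, rfl⟩
      rcases lt_trichotomy m n with h | rfl | h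
      · exact Or.inr (Or.inr (hlt _ _ h))
      · exact Or.inl rfl
      · exact Or.inr (Or.inl (hlt _ _ h)))
    (by rintro _ ⟨n, rfl⟩; exact ⟨_, ⟨n + 1, rfl⟩, hlt _ _ n.lt_succ_self⟩)
  have hum := hu.star_mem α
  refine ⟨u, ⟨hu, fun β hβ => ?_⟩, hul _ ⟨0, rfl⟩, (B.targetClub_spec α).closed _ hum _
    ⟨not_isMin_iff.2 ⟨_, (hul _ ⟨0, rfl⟩).2⟩, fun b hb z hz hzu => ?_⟩⟩
  · by_contra h
    obtain ⟨_, ⟨n, rfl⟩, hn⟩ := hval β (nonempty_iff_ne_empty.2 h)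
    exact hn.ne_empty ((g n).2.2 β hβ)
  · obtain ⟨_, ⟨n, rfl⟩, hn⟩ := hub b hb
    have h1 := hul (g (n + 1)).1 ⟨n + 1, rfl⟩
    have h2 := hm (g n)
    have h3 := hxf (g n)
    rw [← hg] at h2 h3
    exact ⟨z, hz, (B.threaded α).le_refl z hz, ⟨x (g n), hn.trans (hx (g n)), h3.trans h1.2⟩,
      ForcingNotion.mem_mono hum hz hzu (ForcingNotion.mem_mono ((g (n + 1)).2.1.star_mem α) hum
        (B.star_le (h1.1.below α)) h2)⟩

/-- Adding an entry to a tight condition. -/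
theorem Tight.update {α : WithTop L} {d : FlatCond K (WithTop L)} (hd : B.Tight d)
    (hs : d.SuppBelow α) {S : Set K} (hS : accPoints S ⊆ S) (hlt : ∀ x ∈ S, x < d.sq.top)
    (hav : ∀ x ∈ S, B.Avoids α d x)
    (hclub : (B.threaded α).mem (B.targetClub α) d.sq.top (B.star α d)) :
    B.Tight ⟨d.sq, Function.update d.val α (S ∪ {d.sq.top})⟩ := by
  set e : FlatCond K (WithTop L) := ⟨d.sq, Function.update d.val α (S ∪ {d.sq.top})⟩ with he
  have e1 : e.val α = S ∪ {d.sq.top} := Function.update_self ..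
  have e2 : ∀ β, β ≠ α → e.val β = d.val β := fun β h => Function.update_of_ne h ..
  -- A stage above `α` has an empty entry, so below a stage with a nonempty entry nothing has been
  -- changed.
  have hval : ∀ β, (e.val β).Nonempty → ∀ γ < β, e.val γ = d.val γ := by
    intro β hβ γ hγ
    refine e2 γ fun h => ?_
    subst h
    rw [e2 β hγ.ne', hs β hγ.le] at hβ
    exact not_nonempty_empty hβ
  have hreal : ∀ β, (e.val β).Nonempty → B.real β e = B.real β d := fun β hβ =>
    B.real_congr rfl (hval β hβ)
  have hstar : ∀ β, (e.val β).Nonempty → B.star β e = B.star β d := fun β hβ =>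
    B.star_congr rfl (hval β hβ)
  have club : ∀ β, (e.val β).Nonempty →
      (B.threaded β).mem (B.targetClub β) d.sq.top (B.star β e) := by
    intro β hβ
    rw [hstar β hβ]
    by_cases h : β = α
    · subst h
      exact hclub
    · rw [e2 β h] at hβ
      exact hd.club β hβ
  refine { toSound := ⟨hd.limit, ?_, fun β => ?_, fun β => ?_, fun β x hx => ?_⟩,
           le_top := fun β => ?_, top_mem := fun β hβ => ?_, club := club }
  · have h1 : {β | e.val β ≠ ∅} ⊆ insert α {β | d.val β ≠ ∅} := by
      intro β hβ
      by_cases h : β = α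
      · exact Or.inl h
      · rw [mem_ofPred_eq, e2 β h] at hβ
        exact Or.inr hβ
    exact (mk_le_mk_of_subset h1).trans_lt (mk_insert_le.trans_lt (add_lt_of_lt
      UncountableRegularOrder.regular.aleph0_le hd.small
      (one_lt_aleph0.trans_le UncountableRegularOrder.regular.aleph0_le)))
  · by_cases h : β = α
    · subst h
      rw [e1]
      exact accPoints_union_singleton_subset hS hlt
    · rw [e2 β h]
      exact hd.closed β
  · by_cases h : β = α
    · subst h
      rw [e1]
      exact ⟨d.sq.top, union_subset (fun x hx => (hlt x hx).le) (by simp)⟩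
    · rw [e2 β h]
      exact hd.bounded β
  · rw [Avoids, hreal β ⟨x, hx⟩]
    by_cases h : β = α
    · subst h
      rw [e1] at hx
      rcases hx with hx | hx
      · exact hav x hx
      · rw [show x = d.sq.top from hx]
        exact avoids_of_club (hd.star_mem β) hclub
    · rw [e2 β h] at hx
      exact hd.avoids β x hx
  · by_cases h : β = α
    · subst h
      rw [e1]
      exact union_subset (fun x hx => (hlt x hx).le) (by simp [he])
    · rw [e2 β h]
      exact hd.le_top β
  · by_cases h : β = α
    · subst h
      rw [e1]
      exact Or.inr rfl
    · rw [e2 β h] at hβ ⊢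
      exact hd.top_mem β hβ

end Bookkeeping

/-! ### Density of the tight conditions. -/

namespace Bookkeeping

variable {K L : Type u} [LinearOrder K] [LinearOrder L] [WellFoundedLT L] {B : Bookkeeping K L}
  [UncountableRegularOrder K]

theorem tight_of_val_eq_empty {s : SquareCond K} (hs : Order.IsSuccPrelimit s.top) :
    B.Tight ⟨s, fun _ => ∅⟩ where
  limit := hs
  small := by
    simpa using aleph0_pos.trans UncountableRegularOrder.uncountable
  closed := by
    rintro _ a ⟨ha, hacc⟩
    obtain ⟨b, hb⟩ := not_isMin_iff.1 ha
    obtain ⟨x, hx, -⟩ := hacc b hb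
    exact hx.elim
  bounded := fun _ => ⟨s.top, empty_subset _⟩
  avoids := fun _ _ hx => hx.elim
  le_top := fun _ => empty_subset _
  top_mem := fun _ h => absurd h not_nonempty_empty
  club := fun _ h => absurd h not_nonempty_empty

/-- Extending a tight condition by an entry that is stronger than a given one. -/
theorem DenseAt.exists_update {α : WithTop L} (h : B.DenseAt α) {c : SetName (RawCond K α) K}
    {d : FlatCond K (WithTop L)} (hd : d ∈ B.tightBelow α)
    (hc : (shootClub (B.forcing α) (B.target α)).mem c (B.real α d)) :
    ∃ e, B.Tight e ∧ e.lt d ∧ (∀ β, α < β → e.val β = ∅) ∧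
      (B.forcing α).endExtName (B.check α (e.val α)) c (B.real α e) := by
  -- First `c` is decided to be `S`; then the length is moved into the avoiding club, so that it may
  -- be put on top of `S`.
  obtain ⟨e₁, he₁, hlt₁, S, hS, hStop, hSc, hSn⟩ := h.exists_check hd hc
  obtain ⟨e, he, hlt, hclub⟩ := h.exists_top_mem he₁
  have hdm := hd.1.real_mem α
  have he₁m := he₁.1.real_mem α
  have hem := he.1.real_mem α
  have hle₁ : (B.forcing α).le (B.real α e₁) (B.real α d) :=
    B.real_le hlt₁.1.sq fun β _ => hlt₁.1.val β
  have hle : (B.forcing α).le (B.real α e) (B.real α e₁) :=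
    B.real_le hlt.1.sq fun β _ => hlt.1.val β
  have hlt' : ∀ x ∈ S, x < e.sq.top := fun x hx => (hStop x hx).trans hlt.2
  have htight := he.1.update he.2 hS hlt' (fun x hx q hq hqe hx' => by
    have h1 := (B.forcing α).le_trans _ hq _ hem _ he₁m hqe hle
    exact hc.2.2 x q hq ((B.forcing α).le_trans _ hq _ he₁m _ hdm h1 hle₁)
      ⟨ForcingNotion.mem_mono he₁m hq h1 (hSc x hx), hx'⟩) hclub
  have e1 : Function.update e.val α (S ∪ {e.sq.top}) α = S ∪ {e.sq.top} :=
    Function.update_self ..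
  have e2 : ∀ β, β ≠ α → Function.update e.val α (S ∪ {e.sq.top}) β = e.val β :=
    fun β h => Function.update_of_ne h ..
  have hreal : B.real α ⟨e.sq, Function.update e.val α (S ∪ {e.sq.top})⟩ = B.real α e :=
    B.real_congr rfl fun β hβ => e2 β hβ.ne
  have hle' : FlatCond.le ⟨e.sq, Function.update e.val α (S ∪ {e.sq.top})⟩ e := by
    refine ⟨e.sq.le_refl, EndExt.refl _, fun β => ?_⟩
    by_cases hβ : β = α
    · subst hβ
      rw [he.2 β le_rfl]
      exact EndExt.empty _
    · show EndExt (Function.update e.val α (S ∪ {e.sq.top}) β) _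
      rw [e2 β hβ]
      exact EndExt.refl _
  refine ⟨_, htight, ⟨hle'.trans (hlt.1.trans hlt₁.1), hlt₁.2.trans hlt.2⟩,
    fun β hβ => (e2 β hβ.ne').trans (he.2 β hβ.le), ?_⟩
  rw [hreal]
  simp only [e1]
  have key : ∀ q ∈ (B.forcing α).cond, (B.forcing α).le q (B.real α e) → ∀ x,
      (B.forcing α).mem c x q ↔ x ∈ S := fun q hq hqe x => by
    have h1 := (B.forcing α).le_trans _ hq _ hem _ he₁m hqe hle
    exact ⟨fun h => by_contra fun hx => hSn x hx q hq h1 h,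
      fun h => ForcingNotion.mem_mono he₁m hq h1 (hSc x h)⟩
  refine ⟨fun x q hq hqe hx => (B.mem_check hq).2 (Or.inl ((key q hq hqe x).1 hx)),
    fun x y hxy q hq hqe hx => (key q hq hqe x).2 ?_⟩
  have hy := (key q hq hqe y).1 hx.2
  rcases (B.mem_check hq).1 hx.1 with h | h
  · exact h
  · exact absurd (hxy.trans_lt (hlt' y hy)) (by rw [show x = e.sq.top from h]; exact lt_irrefl _)

theorem endExtName_mono_check {β : WithTop L} {c : SetName (RawCond K β) K}
    {d e : FlatCond K (WithTop L)} (hd : B.Tight d) (he : B.Tight e) (hed : e.le d)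
    (h : (B.forcing β).endExtName (B.check β (d.val β)) c (B.real β d)) :
    (B.forcing β).endExtName (B.check β (e.val β)) c (B.real β e) :=
  ForcingNotion.endExtName_trans (B.endExtName_check (hed.val β) _)
    (ForcingNotion.endExtName_mono (hd.real_mem β) (he.real_mem β)
      (B.real_le hed.sq fun γ _ => hed.val γ) h)

variable (B) in
-- By induction on `α`. Once `t` is decided to be a member of the square sequence and a last club
-- extends it, one climbs through the support of the condition. What has been built below `i` is
-- stronger than the restriction to `i`, so density at stage `i` turns the `i`-th entry into a
-- ground-model set; `exists_limit` handles limits.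
theorem denseAt (α : WithTop L) : B.DenseAt α := by
  induction α using WellFoundedLT.induction with
  | ind α ih =>
  rintro ⟨p, t⟩ hpt
  obtain ⟨(q : RawCond K α), hq, hqp, ⟨a, ha⟩, heq⟩ := hpt.2.2 p hpt.1 ((B.forcing α).le_refl p hpt.1)
  replace heq : (B.forcing α).eqName t (genericSquare a) q := heq
  -- The first extension makes the sequence long enough to contain the `a`-th club; the second gives
  -- it a last club that end-extends that one.
  obtain ⟨s₁, hs₁, has₁, -, -, -⟩ := q.1.exists_extension q.1.top le_rfl a
  obtain ⟨s, hs, -, -, hlim, hext⟩ := s₁.exists_extension a has₁.le a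
  have hq' := B.mem_forcing.1 hq
  obtain ⟨m, hm⟩ := exists_least (WithTop L)
  -- The support, with a starting point and the endpoint `α` added for the climb.
  let I : Set (WithTop L) := insert m (insert α {β | ∃ h : β < α, q.entry h ≠ ∅})
  have hI : #I < #K := by
    have h1 : #({β | ∃ h : β < α, q.entry h ≠ ∅} : Set (WithTop L)) < #K := by
      refine lt_of_le_of_lt (mk_le_mk_of_subset ?_)
        ((mk_image_le (f := fun β : Iio α => β.1)
          (s := {β : Iio α | q.entry β.2 ≠ ∅})).trans_lt hq'.1)
      rintro β ⟨h, hβ⟩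
      exact ⟨⟨β, h⟩, hβ, rfl⟩
    have h2 := one_lt_aleph0.trans_le (UncountableRegularOrder.regular (K := K)).aleph0_le
    have h3 := (UncountableRegularOrder.regular (K := K)).aleph0_le
    exact mk_insert_le.trans_lt (add_lt_of_lt h3
      (mk_insert_le.trans_lt (add_lt_of_lt h3 h1 h2)) h2)
  have hIle : ∀ i ∈ I, i ≤ α := by
    rintro i (rfl | rfl | ⟨h, -⟩)
    · exact hm α
    · exact le_rfl
    · exact h.le
  have htight : B.Tight (⟨s, fun _ => ∅⟩ : FlatCond K (WithTop L)) := tight_of_val_eq_empty hlim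
  obtain ⟨e, he₀, he⟩ := exists_climb hI (R := FlatCond.lt) (fun h1 h2 => h1.trans h2)
    (G := fun i d => d ∈ B.tightBelow i ∧ d.sq.le s ∧ ∀ β < i, ∀ h : β < α,
      (B.forcing β).endExtName (B.check β (d.val β)) (q.entry h) (B.real β d))
    (i₀ := m) (τ := α) (d₀ := ⟨s, fun _ => ∅⟩) (Or.inl rfl) (Or.inr (Or.inl rfl)) hIle
    ⟨⟨htight, fun _ _ => rfl⟩, s.le_refl, fun β hβ => absurd hβ (not_lt.2 (hm β))⟩
    (by
      rintro i - j hj hij hcov d ⟨hd, hds, hent⟩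
      have hiα : i < α := hij.trans_le (hIle j hj)
      have hle : (B.forcing i).le (B.real i d) (q.res hiα) :=
        B.forcing_le_of (SquareCond.le_trans hds (SquareCond.le_trans hs hs₁)) fun β hβ => by
          simpa using hent β hβ (hβ.trans hiα)
      have hc := (hq'.2 i hiα).2.2
      have hdm := hd.1.real_mem i
      have hqm := (hq'.2 i hiα).1
      have hc' : (shootClub (B.forcing i) (B.target i)).mem (q.entry hiα) (B.real i d) :=
        ⟨fun a => ForcingNotion.imp_mono hqm hdm hle (hc.1 a),
          fun r hr hrd => hc.2.1 r hr ((B.forcing i).le_trans _ hr _ hdm _ hqm hrd hle),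
          fun x r hr hrd => hc.2.2 x r hr ((B.forcing i).le_trans _ hr _ hdm _ hqm hrd hle)⟩
      obtain ⟨e, he, hlt, hval, hee⟩ := (ih i hiα).exists_update hd hc'
      refine ⟨e, hlt, ⟨he, fun β hβ => hval β (hij.trans_le hβ)⟩,
        SquareCond.le_trans hlt.1.sq hds, fun β hβ h => ?_⟩
      rcases lt_trichotomy β i with h' | rfl | h'
      · exact endExtName_mono_check hd.1 he hlt.1 (hent β h' h)
      · exact hee
      · have h0 : q.entry h = ∅ := by
          by_contra h0
          exact absurd (hcov β (Or.inr (Or.inr ⟨h, h0⟩)) hβ) (not_le.2 h')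
        rw [h0]
        exact endExtName_empty _ _)
    (by
      intro j hj C hne hC hG chain hmax hcof
      obtain ⟨u, hu, hlt, hval, -⟩ := exists_limit hne hC
        (fun d hd => let ⟨_, _, _, h⟩ := hG d hd; h.1.1) chain hmax
      refine ⟨u, hlt, ⟨hu, fun β hβ => ?_⟩, ?_, fun β hβ h => ?_⟩
      · by_contra h
        obtain ⟨d, hd, hdβ⟩ := hval β (nonempty_iff_ne_empty.2 h)
        obtain ⟨i, _, hij, hG⟩ := hG d hd
        exact hdβ.ne_empty (hG.1.2 β (hij.le.trans hβ))
      · obtain ⟨d, hd⟩ := hne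
        obtain ⟨i, _, hij, hG⟩ := hG d hd
        exact SquareCond.le_trans (hlt d hd).1.sq hG.2.1
      · by_cases h0 : q.entry h = ∅
        · rw [h0]
          exact endExtName_empty _ _
        · obtain ⟨d, hd, i, -, hβi, -, hG⟩ := hcof β (Or.inr (Or.inr ⟨h, h0⟩)) hβ
          exact endExtName_mono_check hG.1.1 hu (hlt d hd).1 (hG.2.2 β hβi h))
  obtain ⟨he, hes, hent⟩ := he
  have hle : e.le ⟨s, fun _ => ∅⟩ := by
    rcases he₀ with rfl | h
    · exact FlatCond.le.refl _
    · exact h.1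
  have hem := he.1.real_mem α
  have heq' : (B.forcing α).le (B.real α e) q :=
    B.forcing_le_of (SquareCond.le_trans hes (SquareCond.le_trans hs hs₁)) fun β hβ => by
      simpa using hent β hβ hβ
  refine ⟨e, he, (B.forcing α).le_trans _ hem _ hq _ hpt.1 heq' hqp, ?_⟩
  have key : ∀ r ∈ (B.forcing α).cond, (B.forcing α).le r (B.real α e) → ∀ x,
      (B.forcing α).mem t x r ↔ x ∈ s₁.C a := by
    intro r hr hre x
    have hrq := (B.forcing α).le_trans _ hr _ hem _ hq hre heq'
    have hrs : r.1.le s₁ :=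
      SquareCond.le_trans (B.forcing_le_fst _ _ hre) (SquareCond.le_trans hes hs)
    rw [← hrs.2 a has₁.le, ← genericSquare_mem_iff B.forcing_le_fst hr (has₁.le.trans hrs.1)]
    exact ⟨(heq x).1 r hr hrq, (heq x).2 r hr hrq⟩
  have key' : ∀ r ∈ (B.forcing α).cond, (B.forcing α).le r (B.real α e) → ∀ x,
      (B.forcing α).mem (threadName (B.forcing α) e.sq.top) x r ↔ x ∈ e.thread := by
    intro r hr hre x
    have h1 : r.1.le e.sq := B.forcing_le_fst _ _ hre
    rw [threadName_mem_iff B.forcing_le_fst hr h1.1, h1.2 _ le_rfl]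
    rfl
  have hE : EndExt e.thread (s₁.C a) := hle.thread.trans hext
  exact ⟨fun x r hr hre hx => (key' r hr hre x).2 (hE.1 ((key r hr hre x).1 hx)),
    fun x y hxy r hr hre hx => (key r hr hre x).2
      (hE.2 x y hxy ((key' r hr hre x).1 hx.1) ((key r hr hre y).1 hx.2))⟩

end Bookkeeping

/-! ### Counting tight conditions and names, and reflection. -/

/-- By regularity a small subset of `K` is bounded, so it lies in one of `#K` power sets, each of
size at most `2^{<κ} = κ`. -/
theorem mk_small_sets_le {K T : Type u} [LinearOrder K] [UncountableRegularOrder K]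
    (h2 : (2 : Cardinal.{u}) ^< #K = #K) (hT : #T ≤ #K) : #{S : Set T // #S < #K} ≤ #K := by
  obtain ⟨f⟩ := hT
  have h1 : #{S : Set T // #S < #K} ≤ #(⋃ b : K, 𝒫 (Iio b)) := by
    refine mk_le_of_injective (f := fun S => ⟨f '' S.1, ?_⟩) ?_
    · obtain ⟨b, hb⟩ :=
        UncountableRegularOrder.exists_forall_lt (f '' S.1) (mk_image_le.trans_lt S.2)
      exact mem_iUnion.2 ⟨b, hb⟩
    · intro S T h
      exact Subtype.ext (f.injective.image_injective (congrArg Subtype.val h))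
  have hinf : ℵ₀ ≤ #K := UncountableRegularOrder.regular.aleph0_le
  refine h1.trans ((mk_iUnion_le _).trans ?_)
  refine (mul_le_mul' le_rfl (ciSup_le' fun b => ?_)).trans (mul_eq_self hinf).le
  rw [mk_powerset]
  exact (le_powerlt 2 (UncountableRegularOrder.mk_Iio_lt b)).trans h2.le

namespace Bookkeeping

variable {K L : Type u} [LinearOrder K] [LinearOrder L] [WellFoundedLT L] {B : Bookkeeping K L}
  [UncountableRegularOrder K]

/-- A tight condition is coded by its length and the graphs of its two components. These graphs are
small: all points are bounded by the length, and the support is small. -/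
theorem mk_tightBelow_le (h2 : (2 : Cardinal.{u}) ^< #K = #K) {α : WithTop L}
    (hα : #(Iio α) ≤ #K) : #(B.tightBelow α) ≤ #K := by
  have hinf : ℵ₀ ≤ #K := UncountableRegularOrder.regular.aleph0_le
  have hKK : #(K × K) ≤ #K := by
    rw [← mul_def, mul_eq_self hinf]
  have hαK : #(Iio α × K) ≤ #K := by
    rw [← mul_def]
    exact (mul_le_mul' hα le_rfl).trans (mul_eq_self hinf).le
  have hsq : ∀ s : SquareCond K, #{z : K × K | z.2 ∈ s.C z.1} < #K := by
    intro s
    have h1 : {z : K × K | z.2 ∈ s.C z.1} ⊆ Iic s.top ×ˢ Iic s.top := by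
      rintro ⟨a, x⟩ hx
      have ha : a ≤ s.top := by
        by_contra! h
        rw [mem_ofPred_eq, s.junk a h] at hx
        exact hx
      exact ⟨ha, ((s.club a ha).1 hx).le.trans ha⟩
    refine (mk_le_mk_of_subset h1).trans_lt ?_
    rw [mk_setProd]
    exact mul_lt_of_lt hinf (UncountableRegularOrder.mk_Iic_lt _)
      (UncountableRegularOrder.mk_Iic_lt _)
  have hval : ∀ d ∈ B.tightBelow α, #{z : Iio α × K | z.2 ∈ d.val z.1} < #K := by
    intro d hd
    have h1 : {z : Iio α × K | z.2 ∈ d.val z.1} ⊆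
        {β : Iio α | d.val β ≠ ∅} ×ˢ Iic d.sq.top := by
      rintro ⟨β, x⟩ hx
      exact ⟨nonempty_iff_ne_empty.1 ⟨x, hx⟩, hd.1.le_top β hx⟩
    refine (mk_le_mk_of_subset h1).trans_lt ?_
    rw [mk_setProd]
    refine mul_lt_of_lt hinf (lt_of_le_of_lt ?_ hd.1.small) (UncountableRegularOrder.mk_Iic_lt _)
    refine mk_le_of_injective (f := fun β => ⟨β.1.1, β.2⟩) fun β γ h => ?_
    have h := congrArg Subtype.val h
    exact Subtype.ext (Subtype.ext h)
  have key : #(B.tightBelow α) ≤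
      #(K × {S : Set (K × K) // #S < #K} × {S : Set (Iio α × K) // #S < #K}) := by
    refine mk_le_of_injective (f := fun d => (d.1.sq.top, ⟨_, hsq d.1.sq⟩, ⟨_, hval d.1 d.2⟩)) ?_
    rintro ⟨d, hd⟩ ⟨e, he⟩ h
    simp only [Prod.mk.injEq, Subtype.mk.injEq] at h
    obtain ⟨h1, h2, h3⟩ := h
    refine Subtype.ext (FlatCond.ext (SquareCond.ext h1 ?_) ?_)
    · funext a
      ext x
      exact Set.ext_iff.1 h2 (a, x)
    · funext β
      rcases lt_or_ge β α with hβ | hβ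
      · ext x
        exact Set.ext_iff.1 h3 (⟨β, hβ⟩, x)
      · show d.val β = e.val β
        rw [hd.2 β hβ, he.2 β hβ]
  refine key.trans ?_
  rw [← mul_def, ← mul_def]
  exact (mul_le_mul' le_rfl ((mul_le_mul' (mk_small_sets_le h2 hKK)
    (mk_small_sets_le h2 hαK)).trans (mul_eq_self hinf).le)).trans (mul_eq_self hinf).le

theorem exists_tight_le {α : WithTop L} {p : RawCond K α} (hp : p ∈ (B.forcing α).cond) :
    ∃ d ∈ B.tightBelow α, (B.forcing α).le (B.real α d) p := by
  obtain ⟨d, hd, h⟩ := B.denseAt α (p, ∅) (mk_empty_mem B.forcing_le_fst hp)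
  exact ⟨d, hd, h.1⟩

variable (B) in
/-- The `S * R_α`-name given by a relation between tight conditions and elements of `K`. -/
def flatName (α : WithTop L) (φ : K → FlatCond K (WithTop L) → Prop) : SetName (RawCond K α) K :=
  {z | ∃ d ∈ B.tightBelow α, z.1 = B.real α d ∧ φ z.2 d}

theorem flatName_isName (α : WithTop L) (φ : K → FlatCond K (WithTop L) → Prop) :
    (B.forcing α).IsName (B.flatName α φ) := by
  rintro ⟨z, x⟩ ⟨d, hd, hz, -⟩
  rw [hz]
  exact hd.1.real_mem α

theorem mem_flatName {α : WithTop L} {φ : K → FlatCond K (WithTop L) → Prop} {x : K}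
    {d : FlatCond K (WithTop L)} (hd : d ∈ B.tightBelow α) (h : φ x d) :
    (B.forcing α).mem (B.flatName α φ) x (B.real α d) :=
  ForcingNotion.mem_of_mem_name (hd.1.real_mem α) (hd.1.real_mem α) ⟨d, hd, rfl, h⟩
    ((B.forcing α).le_refl _ (hd.1.real_mem α))

theorem exists_of_mem_flatName {α : WithTop L} {φ : K → FlatCond K (WithTop L) → Prop} {x : K}
    {p : RawCond K α} (hp : p ∈ (B.forcing α).cond)
    (h : (B.forcing α).mem (B.flatName α φ) x p) : ∃ q ∈ (B.forcing α).cond,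
      (B.forcing α).le q p ∧ ∃ d ∈ B.tightBelow α, φ x d ∧ (B.forcing α).le q (B.real α d) := by
  obtain ⟨q, hq, hqp, a, -, ⟨d, hd, ha, hφ⟩, hqa⟩ := h p hp ((B.forcing α).le_refl p hp)
  exact ⟨q, hq, hqp, d, hd, hφ, (show a = B.real α d from ha) ▸ hqa⟩

/-- If there are few tight conditions, then there are few names for subsets of `K`. -/
theorem exists_exhausts {α : WithTop L} (hα : #(B.tightBelow α) ≤ #K)
    (hL : (2 : Cardinal.{u}) ^ #K ≤ #L) :
    ∃ e : L → SetName (RawCond K α) K, Exhausts (B.forcing α) e := by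
  have hinf : ℵ₀ ≤ #K := UncountableRegularOrder.regular.aleph0_le
  -- Up to forced equality, a name is determined by which tight conditions force which elements into
  -- it.
  have h1 : #(Set (B.tightBelow α × K)) ≤ #L := by
    rw [mk_set, ← mul_def]
    exact (power_le_power_left two_ne_zero
      ((mul_le_mul' hα le_rfl).trans (mul_eq_self hinf).le)).trans hL
  obtain ⟨g⟩ := h1
  refine ⟨fun γ => B.flatName α fun x d => ∃ h, ((⟨d, h⟩ : B.tightBelow α), x) ∈
    Function.invFun g γ, fun A _ => ⟨g {z | (B.forcing α).mem A z.2 (B.real α z.1.1)}, ?_⟩⟩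
  simp only [Function.leftInverse_invFun g.injective _]
  refine fun p _ x => ⟨fun q hq _ hx => ?_, fun q hq _ hx => ?_⟩
  · refine ForcingNotion.mem_of_dense fun r hr hrq => ?_
    obtain ⟨d, hd, hdr⟩ := exists_tight_le hr
    have hdm := hd.1.real_mem α
    exact ⟨_, hdm, hdr, mem_flatName hd ⟨hd, ForcingNotion.mem_mono hq hdm
      ((B.forcing α).le_trans _ hdm _ hr _ hq hdr hrq) hx⟩⟩
  · refine ForcingNotion.mem_of_dense fun r hr hrq => ?_
    obtain ⟨s, hs, hsr, d, hd, ⟨_, hφ⟩, hsd⟩ :=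
      exists_of_mem_flatName hr (ForcingNotion.mem_mono hq hr hrq hx)
    exact ⟨s, hs, hsr, ForcingNotion.mem_mono (hd.1.real_mem α) hs hsd hφ⟩

/-- Every relation between tight conditions and few indices reflects to some stage. -/
theorem exists_reflecting_stage {ι : Type u} (hι : #ι ≤ #K)
    (hcount : ∀ a : L, #(B.tightBelow (a : WithTop L)) ≤ #K)
    (hL : ∀ S : Set L, #S ≤ #K → ∃ b, ∀ x ∈ S, x < b)
    (φ : ι → FlatCond K (WithTop L) → Prop) :
    ∃ α : L, ∀ d ∈ B.tightBelow ⊤, ∀ i, φ i d → ∃ e ∈ B.tightBelow (α : WithTop L),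
      φ i e ∧ e.sq = d.sq ∧ e.leBelow (α : WithTop L) d := by
  classical
  have hinf : ℵ₀ ≤ #K := UncountableRegularOrder.regular.aleph0_le
  -- Choose one witness for each condition below `a` and each index, whenever there is one. These
  -- are at most `#K` many, each with small support, so some `b` bounds all their supports.
  have step : ∀ a : L, ∃ b : L, a < b ∧ ∀ d ∈ B.tightBelow (a : WithTop L), ∀ i,
      (∃ e ∈ B.tightBelow ⊤, φ i e ∧ e.sq = d.sq ∧ ∀ β < (a : WithTop L), e.val β = d.val β) →
      ∃ e ∈ B.tightBelow (b : WithTop L), φ i e ∧ e.sq = d.sq ∧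
        ∀ β < (a : WithTop L), e.val β = d.val β := by
    intro a
    let W : B.tightBelow (a : WithTop L) × ι → FlatCond K (WithTop L) → Prop := fun z e =>
      e ∈ B.tightBelow ⊤ ∧ φ z.2 e ∧ e.sq = z.1.1.sq ∧
        ∀ β < (a : WithTop L), e.val β = z.1.1.val β
    let G : B.tightBelow (a : WithTop L) × ι → Set L := fun z =>
      if h : ∃ e, W z e then {β : L | h.choose.val β ≠ ∅} else ∅
    have hG : ∀ z, #(G z) ≤ #K := by
      intro z
      by_cases h : ∃ e, W z e
      · simp only [G, h, dif_pos]
        refine le_trans ?_ h.choose_spec.1.1.small.le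
        exact mk_le_of_injective (f := fun β => ⟨β.1, β.2⟩) fun β γ hβγ =>
          Subtype.ext (WithTop.coe_injective (congrArg Subtype.val hβγ))
      · simp [G, h]
    have hU : #(insert a (⋃ z, G z) : Set L) ≤ #K := by
      refine mk_insert_le.trans (add_le_of_le hinf ?_ (one_le_aleph0.trans hinf))
      refine (mk_iUnion_le _).trans ((mul_le_mul' ?_ (ciSup_le' hG)).trans (mul_eq_self hinf).le)
      rw [← mul_def]
      exact (mul_le_mul' (hcount a) hι).trans (mul_eq_self hinf).le
    obtain ⟨b, hb⟩ := hL _ hU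
    refine ⟨b, hb a (mem_insert _ _), fun d hd i he => ?_⟩
    have h : ∃ e, W (⟨d, hd⟩, i) e := he
    obtain ⟨h1, h2⟩ := h.choose_spec
    refine ⟨h.choose, ⟨h1.1, fun β hβ => ?_⟩, h2⟩
    induction β using WithTop.recTopCoe with
    | top => exact h1.2 ⊤ le_rfl
    | coe β =>
      by_contra hne
      have hmem : β ∈ G (⟨d, hd⟩, i) := by
        simp only [G, h, dif_pos]
        exact hne
      exact absurd (hb β (mem_insert_of_mem _ (mem_iUnion.2 ⟨_, hmem⟩)))
        (not_lt.2 (WithTop.coe_le_coe.1 hβ))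
  choose h hlt hstep using step
  have hbd : ∀ (k : K) (f : ∀ j : K, j < k → L), ∃ b, ∀ j (hj : j < k), h (f j hj) < b := by
    intro k f
    obtain ⟨b, hb⟩ := hL (range fun j : Iio k => h (f j.1 j.2))
      (mk_range_le.trans (UncountableRegularOrder.mk_Iio_lt k).le)
    exact ⟨b, fun j hj => hb _ ⟨⟨j, hj⟩, rfl⟩⟩
  choose bd hbd using hbd
  -- Iterating along `K` gives the supremum of the `a k` cofinality `#K`.
  let a : K → L := (wellFounded_lt (α := K)).fix bd
  have ha : ∀ j k, j < k → h (a j) < a k := by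
    intro j k hjk
    have h1 : a k = bd k fun j _ => a j := WellFounded.fix_eq _ _ _
    rw [h1]
    exact hbd k (fun j _ => a j) j hjk
  have hmono : ∀ j k, j < k → a j < a k := fun j k hjk => (hlt _).trans (ha j k hjk)
  have wf : WellFounded ((· < ·) : L → L → Prop) := wellFounded_lt
  let U : Set L := {b | ∀ k, a k < b}
  have hU : U.Nonempty := by
    obtain ⟨b, hb⟩ := hL (range a) mk_range_le
    exact ⟨b, fun k => hb _ ⟨k, rfl⟩⟩
  have hcof : ∀ β < wf.min U hU, ∃ k, β < a k := by
    intro β hβ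
    have : β ∉ U := fun h => wf.not_lt_min U h hβ
    simp only [U, mem_ofPred_eq, not_forall, not_lt] at this
    obtain ⟨k, hk⟩ := this
    obtain ⟨k', hk'⟩ := exists_gt k
    exact ⟨k', hk.trans_lt (hmono _ _ hk')⟩
  refine ⟨wf.min U hU, fun d hd i hi => ?_⟩
  have : Nonempty K := ⟨d.sq.top⟩
  choose! ind hind using hcof
  -- The support of `d` is small, so its part below the supremum lies below a single `a k`; there
  -- `d` loses nothing relevant by restriction. The values of `ind` from the supremum on are
  -- arbitrary and harmless.
  obtain ⟨k, hk⟩ := UncountableRegularOrder.exists_forall_lt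
    (ind '' {β : L | d.val β ≠ ∅}) (mk_image_le.trans_lt (lt_of_le_of_lt
      (mk_le_of_injective (f := fun β => (⟨β.1, β.2⟩ : {β | d.val β ≠ ∅})) fun β γ hβγ =>
          Subtype.ext (WithTop.coe_injective (congrArg Subtype.val hβγ))) hd.1.small))
  obtain ⟨k', hk'⟩ := exists_gt k
  have hr : d.restrict (a k : WithTop L) ∈ B.tightBelow (a k : WithTop L) :=
    ⟨hd.1.restrict _, FlatCond.restrict_suppBelow⟩
  obtain ⟨e, he, hφ, hsq, hval⟩ := hstep (a k) _ hr i
    ⟨d, hd, hi, rfl, fun β hβ => (FlatCond.restrict_val_of_lt hβ).symm⟩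
  have hhα : h (a k) < wf.min U hU := (ha k k' hk').trans (wf.min_mem U hU k')
  refine ⟨e, ⟨he.1, fun β hβ => he.2 β ((WithTop.coe_le_coe.2 hhα.le).trans hβ)⟩, hφ, hsq, ?_⟩
  have hsq' : e.sq = d.sq := hsq
  refine ⟨hsq' ▸ e.sq.le_refl, ?_, fun β hβ => ?_⟩
  · rw [FlatCond.thread, FlatCond.thread, hsq']
    exact EndExt.refl _
  · rcases lt_or_ge β (a k : WithTop L) with hβk | hβk
    · rw [hval β hβk, FlatCond.restrict_val_of_lt hβk]
      exact EndExt.refl _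
    · have h0 : d.val β = ∅ := by
        by_contra hne
        lift β to L using ne_top_of_lt hβ
        have h1 := hind β (WithTop.coe_lt_coe.1 hβ)
        have h2 := hmono _ _ (hk _ ⟨β, hne, rfl⟩)
        exact absurd (h1.trans h2) (not_lt.2 (WithTop.coe_le_coe.1 hβk))
      rw [h0]
      exact EndExt.empty _

end Bookkeeping

/-! ### Lifting names to later stages, and the clubs added by the iteration. -/

namespace FlatCond

variable {K J : Type u} [LinearOrder K] [LinearOrder J] {α β : J} {d e : FlatCond K J}

theorem SuppBelow.mono (h : d.SuppBelow α) (hαβ : α ≤ β) : d.SuppBelow β :=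
  fun γ hγ => h γ (hαβ.trans hγ)

theorem restrict_le (h : d.le e) (he : e.SuppBelow α) : (d.restrict α).le e := by
  refine leBelow.le (α := α) ⟨h.sq, h.thread, fun β hβ => ?_⟩ he
  rw [restrict_val_of_lt hβ]
  exact h.val β

end FlatCond

namespace Bookkeeping

variable {K L : Type u} [LinearOrder K] [LinearOrder L] [WellFoundedLT L] {B : Bookkeeping K L}

theorem entry_le {α β : WithTop L} (h : β < α) {c d : RawCond K α} (hcd : (B.forcing α).le c d) :
    (B.forcing β).endExtName (c.entry h) (d.entry h) (c.res h) := ((B.forcing_le.1 hcd).2 β h).2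

/-- A condition of `S * R_β`, prolonged by trivial entries. -/
def liftCond {β : WithTop L} (α : WithTop L) (b : RawCond K β) : RawCond K α :=
  (b.1, (rawEquiv α).symm fun γ => if h : γ.1 < β then b.entry h else ∅)

theorem liftCond_entry_of_lt {α β γ : WithTop L} (b : RawCond K β) (hα : γ < α) (hβ : γ < β) :
    (liftCond α b).entry hα = b.entry hβ := by
  simp [liftCond, RawCond.entry, hβ]

theorem liftCond_entry_of_ge {α β γ : WithTop L} (b : RawCond K β) (hα : γ < α) (hβ : β ≤ γ) :
    (liftCond α b).entry hα = ∅ := by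
  simp [liftCond, RawCond.entry, not_lt.2 hβ]

theorem liftCond_res {α β γ : WithTop L} (b : RawCond K β) (hα : γ < α) :
    (liftCond α b).res hα = liftCond γ b := by
  simp [liftCond, RawCond.res]

theorem liftCond_of_lt {β γ : WithTop L} (b : RawCond K β) (h : γ < β) :
    liftCond γ b = b.res h := by
  simp only [liftCond, RawCond.res]
  congr 2
  funext δ
  rw [dif_pos (lt_trans δ.2 h)]
  rfl

theorem liftCond_self {β : WithTop L} (b : RawCond K β) : liftCond β b = b := by
  refine Prod.ext rfl ?_
  show (rawEquiv β).symm _ = b.2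
  rw [Equiv.symm_apply_eq]
  funext δ
  rw [dif_pos (show δ.1 < β from δ.2)]
  rfl

theorem shootClub_mem_empty {α : WithTop L} (A : SetName (RawCond K α) K) (p : RawCond K α) :
    (shootClub (B.forcing α) A).mem ∅ p := by
  refine ⟨fun a q hq _ hacc => ?_, fun q hq _ => ⟨q, hq, (B.forcing α).le_refl q hq, q.1.top,
    fun x _ r hr _ => mem_empty_name hr⟩, fun x q hq _ h => mem_empty_name hq h.1⟩
  obtain ⟨b, hb⟩ := not_isMin_iff.1 hacc.1
  obtain ⟨r, hr, -, x, hx⟩ := hacc.2 b hb q hq ((B.forcing α).le_refl q hq)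
  exact (mem_empty_name hr hx).elim

theorem liftCond_mem {α β : WithTop L} {b : RawCond K β} (hb : b ∈ (B.forcing β).cond) :
    liftCond α b ∈ (B.forcing α).cond := by
  induction α using WellFoundedLT.induction with
  | ind α ih =>
    have hb' := B.mem_forcing.1 hb
    refine B.mem_forcing.2 ⟨?_, fun γ hγ => ?_⟩
    · have hlt : ∀ γ : {γ : Iio α | (liftCond α b).entry γ.2 ≠ ∅}, γ.1.1 < β := fun γ => by
        by_contra! h
        exact γ.2 (liftCond_entry_of_ge b γ.1.2 h)
      refine lt_of_le_of_lt (mk_le_of_injective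
        (f := fun γ : {γ : Iio α | (liftCond α b).entry γ.2 ≠ ∅} =>
          (⟨⟨γ.1.1, hlt γ⟩, fun h0 => γ.2 ((liftCond_entry_of_lt b γ.1.2 (hlt γ)).trans h0)⟩ :
            {γ : Iio β | b.entry γ.2 ≠ ∅})) ?_) hb'.1
      intro γ δ h
      have h := congrArg (fun z => z.1.1) h
      exact Subtype.ext (Subtype.ext h)
    · rw [liftCond_res]
      refine ⟨ih γ hγ, ?_⟩
      rcases lt_or_ge γ β with h | h
      · rw [liftCond_entry_of_lt b hγ h, liftCond_of_lt b h]
        exact (hb'.2 γ h).2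
      · rw [liftCond_entry_of_ge b hγ h]
        exact ⟨fun z hz => hz.elim, shootClub_mem_empty _ _⟩

theorem of_mem_liftName {α β : WithTop L} (h : β < α) {N : SetName (RawCond K β) K} {x : K}
    {c : RawCond K α} (hc : c ∈ (B.forcing α).cond)
    (hx : (B.forcing α).mem (liftName h N) x c) : ∃ q ∈ (B.forcing α).cond,
      (B.forcing α).le q c ∧ (B.forcing β).mem N x (q.res h) := by
  obtain ⟨q, hq, hqc, b, hb, hbN, hqb⟩ := hx c hc ((B.forcing α).le_refl c hc)
  exact ⟨q, hq, hqc, ForcingNotion.mem_of_mem_name (B.res_mem h hq) (B.res_mem h hb) hbN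
    (B.res_le h hqb)⟩

variable (B) in
/-- The name of the club that is added at stage `β`. -/
def genericClub {α β : WithTop L} (h : β < α) : SetName (RawCond K α) K :=
  (B.forcing α).nameOf fun x c => (B.forcing β).mem (c.entry h) x (c.res h)

theorem mem_genericClub {α β : WithTop L} (h : β < α) {c : RawCond K α} {x : K}
    (hc : c ∈ (B.forcing α).cond) (hx : (B.forcing β).mem (c.entry h) x (c.res h)) :
    (B.forcing α).mem (B.genericClub h) x c :=
  ForcingNotion.mem_of_mem_name hc hc ⟨hc, hx⟩ ((B.forcing α).le_refl c hc)

theorem mem_entry_mono {α β : WithTop L} (h : β < α) {c d : RawCond K α} {x : K}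
    (hc : c ∈ (B.forcing α).cond) (hd : d ∈ (B.forcing α).cond) (hcd : (B.forcing α).le c d)
    (hx : (B.forcing β).mem (d.entry h) x (d.res h)) :
    (B.forcing β).mem (c.entry h) x (c.res h) :=
  (entry_le h hcd).1 x _ (B.res_mem h hc) ((B.forcing β).le_refl _ (B.res_mem h hc))
    (ForcingNotion.mem_mono (B.res_mem h hd) (B.res_mem h hc) (B.res_le h hcd) hx)

theorem exists_of_mem_genericClub {α β : WithTop L} (h : β < α) {c : RawCond K α} {x : K}
    (hc : c ∈ (B.forcing α).cond) (hx : (B.forcing α).mem (B.genericClub h) x c) :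
    ∃ q ∈ (B.forcing α).cond, (B.forcing α).le q c ∧
      (B.forcing β).mem (q.entry h) x (q.res h) := by
  obtain ⟨q, hq, hqc, a, ha, hax, hqa⟩ := hx c hc ((B.forcing α).le_refl c hc)
  exact ⟨q, hq, hqc, mem_entry_mono h hq ha hqa hax.2⟩

theorem mem_genericClub_real {α β : WithTop L} (h : β < α) {d : FlatCond K (WithTop L)} {x : K}
    (hd : B.Sound d) (hx : x ∈ d.val β) :
    (B.forcing α).mem (B.genericClub h) x (B.real α d) := by
  refine mem_genericClub h (hd.real_mem α) ?_
  rw [real_entry, real_res]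
  exact (B.mem_check (hd.real_mem β)).2 hx

variable [UncountableRegularOrder K]

/-- A pair `(b, x)` in `N` gives the pair with `b` prolonged by trivial entries. To get below it
from a condition of the longer iteration, pass to a tight `d`: its upper entries are ground-model
sets and can be glued to any tight condition that extends `d` below `β`. -/
theorem mem_liftName {α β : WithTop L} (h : β < α) {N : SetName (RawCond K β) K} {x : K}
    {c : RawCond K α} (hc : c ∈ (B.forcing α).cond)
    (hx : (B.forcing β).mem N x (c.res h)) : (B.forcing α).mem (liftName h N) x c := by
  intro c' hc' hc'c
  obtain ⟨d, hd, hdc⟩ := exists_tight_le hc'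
  have hdm := hd.1.real_mem α
  have hdβ := hd.1.real_mem β
  have h1 : (B.forcing β).le (B.real β d) (c.res h) := by
    have := B.res_le h ((B.forcing α).le_trans _ hdm _ hc' _ hc hdc hc'c)
    rwa [real_res] at this
  obtain ⟨r, hr, hrd, b, hb, hbN, hrb⟩ := hx _ hdβ h1
  obtain ⟨h2, h3⟩ := twoStep_mk_mem (hd.1.star_mem β) hr hrd
  obtain ⟨e, he, hez⟩ := B.denseAt β _ h2
  have hem := he.1.real_mem β
  have hed : e.leBelow β d := B.leBelow_of_star_le hem
    ((B.threaded β).le_trans _ (he.1.star_mem β) _ h2 _ (hd.1.star_mem β) hez h3)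
  have heb : (B.forcing β).le (B.real β e) b := (B.forcing β).le_trans _ hem _ hr _ hb hez.1 hrb
  have hg := he.1.toSound.glue hd.1.toSound hed
  have hgd : (B.forcing α).le (B.real α (FlatCond.glue β e d)) (B.real α d) :=
    B.real_le hed.sq fun γ _ => (FlatCond.glue_le hed).val γ
  refine ⟨_, hg.real_mem α, (B.forcing α).le_trans _ (hg.real_mem α) _ hdm _ hc' hgd hdc,
    liftCond α b, liftCond_mem hb, ?_, B.forcing_le_of
      (B.forcing_le_fst (B.real β e) b heb)
      fun γ hγ => ?_⟩
  · show ((liftCond α b).res h, x) ∈ N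
    rwa [liftCond_res, liftCond_self]
  · rcases lt_or_ge γ β with hγβ | hγβ
    · have h4 := entry_le hγβ heb
      rw [real_entry, real_res] at h4
      rw [liftCond_entry_of_lt b hγ hγβ, real_entry, real_res, FlatCond.glue_val_of_lt hγβ,
        B.real_congr (d := FlatCond.glue β e d) (e := e) rfl
          fun δ hδ => FlatCond.glue_val_of_lt (hδ.trans hγβ)]
      exact h4
    · rw [liftCond_entry_of_ge b hγ hγβ]
      exact endExtName_empty _ _

/-- Adding a new last element to an entry of a sound condition. -/
theorem Sound.insert {d : FlatCond K (WithTop L)} (hd : B.Sound d) {β : WithTop L} {x : K}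
    (hx : ∀ y ∈ d.val β, y < x) (hav : B.Avoids β d x) :
    ∃ e, B.Sound e ∧ e.le d ∧ x ∈ e.val β := by
  have e1 : Function.update d.val β (d.val β ∪ {x}) β = d.val β ∪ {x} := Function.update_self ..
  have e2 : ∀ γ, γ ≠ β → Function.update d.val β (d.val β ∪ {x}) γ = d.val γ :=
    fun γ h => Function.update_of_ne h ..
  have hle : FlatCond.le ⟨d.sq, Function.update d.val β (d.val β ∪ {x})⟩ d := by
    refine ⟨d.sq.le_refl, EndExt.refl _, fun γ => ?_⟩
    by_cases h : γ = β
    · subst h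
      simp only [e1]
      refine ⟨subset_union_left, fun y z hyz hy hz => hy.resolve_right fun h => ?_⟩
      exact absurd (hyz.trans_lt (hx z hz)) (by rw [show y = x from h]; exact lt_irrefl _)
    · simp only [e2 γ h]
      exact EndExt.refl _
  refine ⟨⟨d.sq, Function.update d.val β (d.val β ∪ {x})⟩, Sound.of B hd.limit ?_ (fun γ => ?_) (fun γ => ?_) (fun γ hγ y hy => ?_), hle,
    by simp only [e1]; exact Or.inr rfl⟩
  · have h1 : {γ | Function.update d.val β (d.val β ∪ {x}) γ ≠ ∅} ⊆
        Insert.insert β {γ | d.val γ ≠ ∅} := by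
      intro γ hγ
      by_cases h : γ = β
      · exact Or.inl h
      · rw [mem_ofPred_eq, e2 γ h] at hγ
        exact Or.inr hγ
    exact (mk_le_mk_of_subset h1).trans_lt (mk_insert_le.trans_lt (add_lt_of_lt
      UncountableRegularOrder.regular.aleph0_le hd.small
      (one_lt_aleph0.trans_le UncountableRegularOrder.regular.aleph0_le)))
  · by_cases h : γ = β
    · subst h
      simp only [e1]
      exact accPoints_union_singleton_subset (hd.closed γ) hx
    · simp only [e2 γ h]
      exact hd.closed γ
  · by_cases h : γ = β
    · subst h
      simp only [e1]
      exact ⟨x, union_subset (fun y hy => (hx y hy).le) (by simp)⟩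
    · simp only [e2 γ h]
      exact hd.bounded γ
  · have h1 : B.Avoids γ d y := by
      by_cases h : γ = β
      · subst h
        simp only [e1] at hy
        rcases hy with hy | hy
        · exact hd.avoids γ y hy
        · exact (show y = x from hy) ▸ hav
      · simp only [e2 γ h] at hy
        exact hd.avoids γ y hy
    exact Avoids.mono B h1 hγ (hd.real_mem γ) (B.real_le d.sq.le_refl fun δ _ => hle.val δ)

/-- A point of `targetClub` beyond the length of `d` is forced outside the target and may be added
to the entry. Afterwards the entry need not end at the length, so only soundness is kept. -/
theorem genericClub_unbounded {α : WithTop L} (β : WithTop L) {p : RawCond K α}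
    (hp : p ∈ (B.forcing α).cond) (b : K) : ∃ d, B.Sound d ∧
      (B.forcing α).le (B.real α d) p ∧ ∃ x, b < x ∧ x ∈ d.val β := by
  obtain ⟨d, hd, hdp⟩ := exists_tight_le hp
  obtain ⟨z, hz, hzd, x, hx, hm⟩ :=
    (B.targetClub_spec β).unbounded _ (hd.1.star_mem β) (max b d.sq.top)
  obtain ⟨e, he, hez⟩ := B.denseAt β z hz
  have hem := he.1.star_mem β
  have hed : e.leBelow β d := B.leBelow_of_star_le (he.1.real_mem β)
    ((B.threaded β).le_trans _ hem _ hz _ (hd.1.star_mem β) hez hzd)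
  have hg := he.1.toSound.glue hd.1.toSound hed
  have hav : B.Avoids β (FlatCond.glue β e d) x := by
    have h1 := avoids_of_club hem (ForcingNotion.mem_mono hz hem hez hm)
    rw [Avoids] at h1 ⊢
    rwa [B.real_congr (d := FlatCond.glue β e d) (e := e) rfl
      fun γ hγ => FlatCond.glue_val_of_lt hγ]
  obtain ⟨w, hw, hle, hxw⟩ := hg.insert (x := x) (fun y hy => by
    rw [FlatCond.glue_val_of_ge le_rfl] at hy
    exact (hd.1.le_top β hy).trans_lt ((le_max_right _ _).trans_lt hx)) hav
  have hwd := hle.trans (FlatCond.glue_le hed)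
  exact ⟨w, hw, (B.forcing α).le_trans _ (hw.real_mem α) _ (hd.1.real_mem α) _ hp
    (B.real_le hwd.sq fun γ _ => hwd.val γ) hdp, x, (le_max_left _ _).trans_lt hx, hxw⟩

/-- Stage `β` adds a club disjoint from the set that is to be killed there. -/
theorem genericClub_spec {α β : WithTop L} (h : β < α) :
    (B.forcing α).AvoidingClub (liftName h (B.target β)) (B.genericClub h) := by
  refine ⟨fun p hp b => ?_, fun p hp y hacc => ?_, fun p hp x hx hx' => ?_⟩
  · obtain ⟨d, hd, hdp, x, hbx, hx⟩ := genericClub_unbounded β hp b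
    exact ⟨_, hd.real_mem α, hdp, x, hbx, mem_genericClub_real h hd hx⟩
  · refine ForcingNotion.mem_of_dense fun q hq hqp => ?_
    -- An entry reaching beyond `y` fixes the generic club below `y`, since later entries end-extend
    -- it. So `y` is a limit of a closed ground-model set.
    obtain ⟨d, hd, hdq, x, hyx, hx⟩ := genericClub_unbounded β hq y
    have hdm := hd.real_mem α
    refine ⟨_, hdm, hdq, mem_genericClub_real h hd (hd.closed β ⟨hacc.1, fun b hb => ?_⟩)⟩
    obtain ⟨r, hr, hrd, ⟨z, hbz, hzy⟩, hz⟩ :=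
      hacc.2 b hb _ hdm ((B.forcing α).le_trans _ hdm _ hq _ hp hdq hqp)
    obtain ⟨s, hs, hsr, hzs⟩ := exists_of_mem_genericClub h hr hz
    have hsd := (B.forcing α).le_trans _ hs _ hr _ hdm hsr hrd
    have h1 := entry_le h hsd
    rw [real_entry] at h1
    have hsm := B.res_mem h hs
    exact ⟨z, (B.mem_check hsm).1 (h1.2 z x (hzy.trans hyx).le _ hsm
      ((B.forcing β).le_refl _ hsm) ⟨hzs, (B.mem_check hsm).2 hx⟩), hbz, hzy⟩
  · obtain ⟨q, hq, hqp, hxq⟩ := exists_of_mem_genericClub h hp hx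
    obtain ⟨r, hr, hrq, hxr⟩ := of_mem_liftName h hq (ForcingNotion.mem_mono hp hq hqp hx')
    have hrm := B.res_mem h hr
    exact ((B.mem_forcing.1 hr).2 β h).2.2.2.2 x _ hrm ((B.forcing β).le_refl _ hrm)
      ⟨mem_entry_mono h hr hq hrq hxq, hxr⟩

end Bookkeeping

/-! ### The reflected set is killed at some stage. -/

namespace Bookkeeping

variable {K L : Type u} [LinearOrder K] [LinearOrder L] [WellFoundedLT L] {B : Bookkeeping K L}

theorem candidate_eq {a α γ δ : L} (ha : B.f a = (α, γ, δ))
    (h : (α : WithTop L) < (a : WithTop L)) :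
    B.candidate a = liftName h (B.enum (B.forcing α) γ) := by
  obtain rfl : (B.f a).1 = α := by rw [ha]
  obtain rfl : (B.f a).2.1 = γ := by rw [ha]
  ext z
  constructor
  · rintro ⟨a', ha', h', hz⟩
    obtain rfl : a = a' := WithTop.coe_injective ha'
    exact hz
  · exact fun hz => ⟨a, rfl, h, hz⟩

theorem target_eq_candidate [UncountableRegularOrder K] {α : WithTop L}
    {E : SetName (RawCond K α × SetName (RawCond K α) K) K}
    (hE : (B.threaded α).AvoidingClub (twoStepName (B.candidate α)) E) :
    B.target α = B.candidate α := by
  rw [target_eq, if_pos hE.valid]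

variable [UncountableRegularOrder K]

/-- If `T` kills the stationarity of `A` over `S * R`, then it also does so at every stage to which
`A` and the club avoiding it reflect. -/
theorem exists_avoidingClub_of_reflects {A : SetName (RawCond K (⊤ : WithTop L)) K}
    {E : SetName (RawCond K (⊤ : WithTop L) × SetName (RawCond K (⊤ : WithTop L)) K) K}
    (hE : (B.threaded ⊤).AvoidingClub (twoStepName A) E) {α a : WithTop L} (h : α < a)
    (hrefl : ∀ d ∈ B.tightBelow ⊤, ∀ x, (B.threaded ⊤).mem E x (B.star ⊤ d) →
      ∃ e ∈ B.tightBelow α, (B.threaded ⊤).mem E x (B.star ⊤ e) ∧ e.sq = d.sq ∧ e.leBelow α d)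
    {N : SetName (RawCond K α) K} (hN : (B.forcing α).Valid ((B.forcing α).eqName
      (B.flatName α fun x d => (B.forcing ⊤).mem A x (B.real ⊤ d)) N)) :
    ∃ E', (B.threaded a).AvoidingClub (twoStepName (liftName h N)) E' := by
  -- Tight conditions below `a` are evaluated in the full iteration, with empty entries from `a` on.
  let E' : SetName (RawCond K a × SetName (RawCond K a) K) K :=
    {z | ∃ d ∈ B.tightBelow a, z.1 = B.star a d ∧ (B.threaded ⊤).mem E z.2 (B.star ⊤ d)}
  have of_mem : ∀ z ∈ (B.threaded a).cond, ∀ x, (B.threaded a).mem E' x z →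
      ∃ r ∈ (B.threaded a).cond, (B.threaded a).le r z ∧ ∃ d ∈ B.tightBelow a,
        (B.threaded ⊤).mem E x (B.star ⊤ d) ∧ (B.threaded a).le r (B.star a d) := by
    intro z hz x hx
    obtain ⟨r, hr, hrz, c, -, ⟨d, hd, hc, hm⟩, hrc⟩ := hx z hz ((B.threaded a).le_refl z hz)
    exact ⟨r, hr, hrz, d, hd, hm, (show c = B.star a d from hc) ▸ hrc⟩
  have mem_of : ∀ d ∈ B.tightBelow a, ∀ x, (B.threaded ⊤).mem E x (B.star ⊤ d) →
      (B.threaded a).mem E' x (B.star a d) := fun d hd x hx =>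
    ForcingNotion.mem_of_mem_name (hd.1.star_mem a) (hd.1.star_mem a) ⟨d, hd, rfl, hx⟩
      ((B.threaded a).le_refl _ (hd.1.star_mem a))
  have memE_mono : ∀ d e : FlatCond K (WithTop L), B.Sound d → B.Sound e → e.le d → ∀ x,
      (B.threaded ⊤).mem E x (B.star ⊤ d) → (B.threaded ⊤).mem E x (B.star ⊤ e) :=
    fun d e hd he hed x hx => ForcingNotion.mem_mono (hd.star_mem ⊤) (he.star_mem ⊤)
      (B.star_le (hed.below ⊤)) hx
  have dense : ∀ β, ∀ z ∈ (B.threaded β).cond, ∃ d ∈ B.tightBelow β,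
      (B.threaded β).le (B.star β d) z := fun β => B.denseAt β
  have le_of : ∀ β, ∀ d, B.Sound d → ∀ e, B.Sound e → ∀ z ∈ (B.threaded β).cond,
      (B.threaded β).le (B.star β d) z → (B.threaded β).le z (B.star β e) → d.leBelow β e :=
    fun β d hd e he z hz h1 h2 => B.leBelow_of_star_le (hd.real_mem β)
      ((B.threaded β).le_trans _ (hd.star_mem β) _ hz _ (he.star_mem β) h1 h2)
  refine ⟨E', fun z hz b => ?_, fun z hz y hacc => ?_, fun z hz x hx hx' => ?_⟩
  · obtain ⟨d, hd, hdz⟩ := dense a z hz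
    obtain ⟨z', hz', hz'd, x, hbx, hx⟩ := hE.unbounded _ (hd.1.star_mem ⊤) b
    obtain ⟨d', hd', hd'z⟩ := dense ⊤ z' hz'
    have hle : d'.le d :=
      (le_of ⊤ d' hd'.1.toSound d hd.1.toSound z' hz' hd'z hz'd).le (hd.2.mono le_top)
    -- The condition `d'` may have entries beyond `a`; `e` forces the same point into `E` from below
    -- `α`. Gluing `e` with `d'` and cutting off at `a` leaves a condition stronger than both `d`
    -- and `e`.
    obtain ⟨e, he, hm, hsq, hed⟩ := hrefl d' hd' x
      (ForcingNotion.mem_mono hz' (hd'.1.star_mem ⊤) hd'z hx)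
    have hu := he.1.glue hd'.1 hed hsq
    have hud := (FlatCond.glue_le hed).trans hle
    have hue := FlatCond.glue_le_of_suppBelow (d := d') he.2
    have hr := hu.restrict a
    have hrd := FlatCond.restrict_le hud hd.2
    have hre := FlatCond.restrict_le hue (he.2.mono h.le)
    exact ⟨_, hr.star_mem a, (B.threaded a).le_trans _ (hr.star_mem a) _ (hd.1.star_mem a) _ hz
      (B.star_le (hrd.below a)) hdz, x, hbx,
      mem_of _ ⟨hr, FlatCond.restrict_suppBelow⟩ x (memE_mono _ _ he.1.toSound hr.toSound hre x hm)⟩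
  · refine ForcingNotion.mem_of_dense fun z' hz' hz'z => ?_
    obtain ⟨d, hd, hdz⟩ := dense a z' hz'
    have hdm := hd.1.star_mem a
    have hdz' := (B.threaded a).le_trans _ hdm _ hz' _ hz hdz hz'z
    refine ⟨_, hdm, hdz, mem_of d hd y (hE.closed _ (hd.1.star_mem ⊤) y
      ⟨hacc.1, fun b hb z₁ hz₁ hz₁d => ?_⟩)⟩
    obtain ⟨d₁, hd₁, hd₁z⟩ := dense ⊤ z₁ hz₁
    have hd₁d : d₁.le d :=
      (le_of ⊤ d₁ hd₁.1.toSound d hd.1.toSound z₁ hz₁ hd₁z hz₁d).le (hd.2.mono le_top)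
    have hd₁m := hd₁.1.star_mem a
    -- The limit is tested at an extension `d₁` in the full iteration. Its part at stage `a` finds
    -- the point `x`, and the condition found there is glued back to `d₁`.
    obtain ⟨r, hr, hrd, ⟨x, hx⟩, hm⟩ := hacc.2 b hb _ hd₁m
      ((B.threaded a).le_trans _ hd₁m _ hdm _ hz (B.star_le (hd₁d.below a)) hdz')
    obtain ⟨r₁, hr₁, hr₁r, d₂, hd₂, hm₂, hr₁d₂⟩ := of_mem r hr x hm
    obtain ⟨e, he, her⟩ := dense a r₁ hr₁
    have hed₂ := (le_of a e he.1.toSound d₂ hd₂.1.toSound r₁ hr₁ her hr₁d₂).le hd₂.2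
    have hed₁ := le_of a e he.1.toSound d₁ hd₁.1.toSound r₁ hr₁ her
      ((B.threaded a).le_trans _ hr₁ _ hr _ hd₁m hr₁r hrd)
    have hw := he.1.toSound.glue hd₁.1.toSound hed₁
    have hwe := FlatCond.glue_le_of_suppBelow (d := d₁) he.2
    exact ⟨_, hw.star_mem ⊤, (B.threaded ⊤).le_trans _ (hw.star_mem ⊤) _ (hd₁.1.star_mem ⊤) _ hz₁
      (B.star_le ((FlatCond.glue_le hed₁).below ⊤)) hd₁z, ⟨x, hx⟩,
      memE_mono _ _ hd₂.1.toSound hw (hwe.trans hed₂) x hm₂⟩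
  · obtain ⟨r, hr, hrz, d₀, hd₀, hm₀, hrd₀⟩ := of_mem z hz x hx
    have hx₁ := (B.mem_twoStepName hr).1 (ForcingNotion.mem_mono hz hr hrz hx')
    obtain ⟨q, hq, hqr, hxq⟩ := of_mem_liftName h hr.1 hx₁
    obtain ⟨h1, h2⟩ := twoStep_mk_mem hr hq hqr
    obtain ⟨d, hd, hdq⟩ := dense a _ h1
    have hdd₀ := (le_of a d hd.1.toSound d₀ hd₀.1.toSound _ h1 hdq
      ((B.threaded a).le_trans _ h1 _ hr _ (hd₀.1.star_mem a) h2 hrd₀)).le hd₀.2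
    have hdα := hd.1.real_mem α
    have hle := B.res_le h hdq.1
    rw [show (B.star a d).1.res h = B.real α d from B.real_res h d] at hle
    have hxd := ForcingNotion.mem_mono (B.res_mem h hq) hdα hle hxq
    have hxA := (hN _ hdα x).2 _ hdα ((B.forcing α).le_refl _ hdα) hxd
    -- Membership in `N` traces back to a tight `d₁` below `α` that forces `x` into `A` over the
    -- full iteration. A common extension of `d` and `d₁` below `α`, glued to `d`, then forces `x`
    -- into both `A` and `E`.
    obtain ⟨q', hq', hq'd, d₁, hd₁, hxd₁, hq'd₁⟩ := exists_of_mem_flatName hdα hxA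
    obtain ⟨h3, h4⟩ := twoStep_mk_mem (hd.1.star_mem α) hq' hq'd
    obtain ⟨d₂, hd₂, hd₂q⟩ := dense α _ h3
    have hd₂d := le_of α d₂ hd₂.1.toSound d hd.1.toSound _ h3 hd₂q h4
    have hd₂m := hd₂.1.real_mem α
    have hd₂d₁ := B.le_of_real_le hd₂m
      ((B.forcing α).le_trans _ hd₂m _ hq' _ (hd₁.1.real_mem α) hd₂q.1 hq'd₁)
    have hw := hd₂.1.toSound.glue hd.1.toSound hd₂d
    have hwd₁ : (B.forcing ⊤).le (B.real ⊤ (FlatCond.glue α d₂ d)) (B.real ⊤ d₁) := by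
      refine B.real_le hd₂d₁.1 fun β _ => ?_
      rcases lt_or_ge β α with hβ | hβ
      · rw [FlatCond.glue_val_of_lt hβ]
        exact hd₂d₁.2 β hβ
      · rw [hd₁.2 β hβ]
        exact EndExt.empty _
    refine hE.disjoint _ (hw.star_mem ⊤) x
      (memE_mono _ _ hd₀.1.toSound hw ((FlatCond.glue_le hd₂d).trans hdd₀) x hm₀)
      ((B.mem_twoStepName (hw.star_mem ⊤)).2
        (ForcingNotion.mem_mono (hd₁.1.real_mem ⊤) (hw.real_mem ⊤) hwd₁ hxd₁))

/-- If no condition below `p` allows a condition of `T` to force that `A` is stationary, then `A`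
can be changed outside of `p` to a name that `T` forces to be non-stationary. -/
theorem valid_nonstationary {A : SetName (RawCond K (⊤ : WithTop L)) K}
    {p : RawCond K (⊤ : WithTop L)} (hp : p ∈ (B.forcing ⊤).cond)
    (hno : ∀ z ∈ (B.threaded ⊤).cond, (B.forcing ⊤).le z.1 p →
      ¬ (B.threaded ⊤).stationaryName (twoStepName A) z) :
    (B.threaded ⊤).Valid ((B.threaded ⊤).neg ((B.threaded ⊤).stationaryName (twoStepName
      ((B.forcing ⊤).nameOf fun x c => (B.forcing ⊤).le c p ∧ (B.forcing ⊤).mem A x c)))) := by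
  intro _ _ z hz _ hs
  -- A stationary set meets the full club. Any witness of membership in the truncated name leads to
  -- a condition below `p`, where that name agrees with `A`.
  have hfull := (ForcingNotion.avoidingClub_empty (K := K) (F := B.threaded (⊤ : WithTop L)))
  obtain ⟨w, hw, hwz, x, hx, -⟩ := hs _ z hz ((B.threaded ⊤).le_refl z hz) (hfull.clubName z)
    z hz ((B.threaded ⊤).le_refl z hz)
  have hx' := (B.mem_twoStepName hw).1 hx
  obtain ⟨c, hc, hcw, a, ha, hax, hca⟩ := hx' w.1 hw.1 ((B.forcing ⊤).le_refl _ hw.1)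
  have hcp := (B.forcing ⊤).le_trans _ hc _ ha _ hp hca hax.2.1
  obtain ⟨h1, h2⟩ := twoStep_mk_mem hw hc hcw
  refine hno _ h1 hcp fun C q hq hqc hC r hr hrq => ?_
  have hqz := (B.threaded ⊤).le_trans _ hq _ h1 _ hz hqc
    ((B.threaded ⊤).le_trans _ h1 _ hw _ hz h2 hwz)
  obtain ⟨s, hsc, hsr, y, hyA, hyC⟩ := hs C q hq hqz hC r hr hrq
  have hsp : (B.forcing ⊤).le s.1 p := (B.forcing ⊤).le_trans _ hsc.1 _ hc _ hp
    ((B.threaded ⊤).le_trans _ hsc _ hq _ h1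
      ((B.threaded ⊤).le_trans _ hsc _ hr _ hq hsr hrq) hqc).1 hcp
  exact ⟨s, hsc, hsr, y, (B.mem_twoStepName hsc).2
    ((ForcingNotion.mem_nameOf_below hsc.1 hsp).1 ((B.mem_twoStepName hsc).1 hyA)), hyC⟩

/-- After `S * R`, the threading forcing generically preserves stationary sets. -/
theorem generically_preserves (h2lt : (2 : Cardinal.{u}) ^< #K = #K)
    (hpow : (2 : Cardinal.{u}) ^ #K ≤ #L) (hIio : ∀ a : L, #(Iio a) ≤ #K)
    (hL : ∀ S : Set L, #S ≤ #K → ∃ b, ∀ x ∈ S, x < b) :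
    GenericallyPreservesStationary (B.forcing ⊤) (threadForcing (B.forcing ⊤)) := by
  have hinf : ℵ₀ ≤ #K := UncountableRegularOrder.regular.aleph0_le
  have hcount : ∀ a : L, #(B.tightBelow (a : WithTop L)) ≤ #K := fun a => by
    refine mk_tightBelow_le h2lt ?_
    rw [← WithTop.image_coe_Iio]
    exact mk_image_le.trans (hIio a)
  intro p₀ hp₀ A p₁ hp₁ hp₁p₀ hstat p hp hpp₁
  by_contra hno
  have hno' : ∀ z ∈ (B.threaded ⊤).cond, (B.forcing ⊤).le z.1 p →
      ¬ (B.threaded ⊤).stationaryName (twoStepName A) z := fun z hz hzp hs =>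
    hno ⟨z.1, hz.1, hzp, z.2, hz, hs⟩
  obtain ⟨E, hE⟩ := ForcingNotion.exists_avoidingClub (valid_nonstationary hp hno')
  set A' := (B.forcing ⊤).nameOf fun x c => (B.forcing ⊤).le c p ∧ (B.forcing ⊤).mem A x c
  -- Membership in `E` and in `A'` must reflect to the same stage, hence the indices `K ⊕ K`.
  obtain ⟨α, hα⟩ := exists_reflecting_stage (B := B) (ι := K ⊕ K)
    (by rw [mk_sum, lift_id]; exact (add_eq_self hinf).le) hcount hL
    (fun i d => Sum.elim (fun x => (B.threaded ⊤).mem E x (B.star ⊤ d))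
      (fun x => (B.forcing ⊤).mem A' x (B.real ⊤ d)) i)
  obtain ⟨γ, hγ⟩ := B.enum_exhausts (B.forcing (α : WithTop L)) (exists_exhausts (hcount α) hpow)
    (B.flatName α fun x d => (B.forcing ⊤).mem A' x (B.real ⊤ d)) (flatName_isName _ _)
  -- `f_lt` says nothing about the least stage. The spare third coordinate provides two different
  -- stages with the same `(α, γ)`, and at least one of them is not the least.
  obtain ⟨a, δ, ha, haα⟩ : ∃ a δ, B.f a = (α, γ, δ) ∧ α < a := by
    obtain ⟨δ, hδ⟩ := hL {α} (by simpa using one_le_aleph0.trans hinf)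
    have hδα : α ≠ δ := (hδ α rfl).ne
    obtain ⟨a₁, ha₁⟩ := B.f_surjective (α, γ, α)
    obtain ⟨a₂, ha₂⟩ := B.f_surjective (α, γ, δ)
    have hne : a₁ ≠ a₂ := by
      rintro rfl
      rw [ha₁] at ha₂
      simp only [Prod.mk.injEq, true_and] at ha₂
      exact hδα ha₂
    rcases lt_or_gt_of_ne hne with h | h
    · have := B.f_lt a₂ (not_isMin_iff.2 ⟨_, h⟩)
      rw [ha₂] at this
      exact ⟨a₂, δ, ha₂, this⟩
    · have := B.f_lt a₁ (not_isMin_iff.2 ⟨_, h⟩)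
      rw [ha₁] at this
      exact ⟨a₁, α, ha₁, this⟩
  have hαa : (α : WithTop L) < (a : WithTop L) := WithTop.coe_lt_coe.2 haα
  obtain ⟨E', hE'⟩ := exists_avoidingClub_of_reflects hE hαa
    (fun d hd x hx => hα d hd (Sum.inl x) hx) hγ
  rw [← candidate_eq ha hαa] at hE'
  have htarget := target_eq_candidate hE'
  rw [candidate_eq ha hαa] at htarget
  have hG := genericClub_spec (B := B) (WithTop.coe_lt_top a)
  have hpp : (B.forcing ⊤).le p p := (B.forcing ⊤).le_refl p hp
  -- The club added at stage `a` is forced to meet `A`, in `x` say. Reflecting membership in `A'`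
  -- below `α` and gluing back gives a condition that also forces `x` into the set killed at `a`,
  -- which this club avoids.
  obtain ⟨q, hq, hqp, x, hxA, hxG⟩ := hstat _ p hp hpp₁ (hG.clubName p) p hp hpp
  obtain ⟨d, hd, hdq⟩ := exists_tight_le hq
  have hdm := hd.1.real_mem ⊤
  have hdp := (B.forcing ⊤).le_trans _ hdm _ hq _ hp hdq hqp
  have hxd : (B.forcing ⊤).mem A' x (B.real ⊤ d) :=
    (ForcingNotion.mem_nameOf_below hdm hdp).2 (ForcingNotion.mem_mono hq hdm hdq hxA)
  obtain ⟨e, he, hxe, hsq, hed⟩ := hα d hd (Sum.inr x) hxd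
  have hu := he.1.glue hd.1 hed hsq
  have huα : B.real α (FlatCond.glue (α : WithTop L) e d) = B.real α e :=
    B.real_congr rfl fun β hβ => FlatCond.glue_val_of_lt hβ
  have hem := he.1.real_mem α
  have hN : (B.forcing α).mem (B.enum (B.forcing α) γ) x
      (B.real α (FlatCond.glue (α : WithTop L) e d)) := by
    rw [huα]
    exact (hγ _ hem x).1 _ hem ((B.forcing α).le_refl _ hem) (mem_flatName he hxe)
  have hN' : (B.forcing a).mem (B.target a) x (B.real a (FlatCond.glue (α : WithTop L) e d)) := by
    rw [htarget]
    exact mem_liftName hαa (hu.real_mem a) (by rwa [real_res])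
  have hum := hu.real_mem ⊤
  have hud : (B.forcing ⊤).le (B.real ⊤ (FlatCond.glue (α : WithTop L) e d)) (B.real ⊤ d) :=
    B.real_le hed.sq fun β _ => (FlatCond.glue_le hed).val β
  exact hG.disjoint _ hum x
    (ForcingNotion.mem_mono hq hum ((B.forcing ⊤).le_trans _ hum _ hdm _ hq hud hdq) hxG)
    (mem_liftName (WithTop.coe_lt_top a) hum (by rwa [real_res]))

end Bookkeeping

theorem uncountableRegularOrder_toType {κ : Cardinal.{u}} (hκ : κ.IsRegular) (hω : ℵ₀ < κ) :
    UncountableRegularOrder κ.ord.ToType where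
  regular := by rwa [mk_ord_toType]
  uncountable := by rwa [mk_ord_toType]
  mk_Iio_lt := fun a => mk_Iio_lt a (by simp)

end

theorem mainTheorem5 (κ : Cardinal.{u}) (hκ : κ.IsRegular) (hω : ℵ₀ < κ)
    (h2lt : (2 : Cardinal.{u}) ^< κ = κ) (h2 : (2 : Cardinal.{u}) ^ κ = Order.succ κ)
    (B : Bookkeeping κ.ord.ToType (Order.succ κ).ord.ToType) :
    GenericallyPreservesStationary (squarePreparation B)
      (threadForcing (squarePreparation B)) := by
  have hK := uncountableRegularOrder_toType hκ hω
  have hL := uncountableRegularOrder_toType (isRegular_succ hκ.aleph0_le)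
    (hω.trans (Order.lt_succ κ))
  refine Bookkeeping.generically_preserves (B := B) ?_ ?_ (fun a => ?_) fun S hS => ?_
  · rwa [mk_ord_toType]
  · rw [mk_ord_toType, mk_ord_toType, h2]
  · have h := UncountableRegularOrder.mk_Iio_lt a
    rw [mk_ord_toType] at h ⊢
    exact Order.lt_succ_iff.1 h
  · refine UncountableRegularOrder.exists_forall_lt S ?_
    rw [mk_ord_toType] at hS ⊢
    exact Order.lt_succ_iff.2 hS
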